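/- **Theorem 4.1.** *Conventions.* Algorithms are deterministic random access machine programs with finitely many registers and an infinite random access memory holding natural numbers, using assignment, indirect addressing, addition, truncated subtraction, multiplication, integer division, sequencing, branching and loops. Running time is logarithmic cost: each operation is charged one plus the bit length of every number it handles. $\mathsf{SETH}$ is the hypothesis that for every $\delta>0$ there is a $k$ such that no such algorithm decides satisfiability of CNF formulas $\varphi$ with at most $k$ literals per clause on $n$ variables in time $2^{(1-\delta)n}\cdot\mathrm{poly}(|\varphi|)$, where $|\varphi|$ is the size of the formula, including $n$. For a finite set $V$ of points in $\mathbb R^d$, an *ultrametric embedding of $V$ of distortion at most $\alpha$* is a metric $\Delta$ on $V$ with $\Delta(x,y)\le\max(\Delta(x,z),\Delta(z,y))$ for all $x,y,z\in V$ and $\|u-v\|_\infty\le\Delta(u,v)\le\alpha\,\|u-v\|_\infty$ for all $u,v\in V$; it is *isometric* if this holds with $\alpha=1$. *Statement.* Assume $\mathsf{SETH}$. Then for every $\varepsilon>0$ there is a constant $C=C(\varepsilon)\in\mathbb N$ such that no algorithm running in time $O(n^{2-\varepsilon})$ can, given as input a set of $n\ge1$ distinct points of dimension $d=C\lceil\log_2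 n\rceil$ in the $\ell_\infty$-metric, distinguish between the following two cases: * **Completeness:** the point set has an isometric ultrametric embedding. * **Soundness:** every ultrametric embedding of the point set has distortion at least $3/2$. This holds even if all coordinates of the points are integers between $0$ and $n$, and even if the algorithm is required to be correct and to respect the time bound only on inputs that fall into one of the two cases. -/

import Mathlib

namespace UltraFit

/-! ## Machine model: random access machines with logarithmic cost

Programs act on finitely many registers and on an infinite random access memory, both holding
natural numbers of arbitrary size.  Control flow is structured (sequence, test, loop).  Every
operation is charged the bit lengths of the numbers it handles, so that large numbers are not free.
-/

/-- The contents of the registers and of the memory. -/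
structure State where
  reg : ℕ → ℕ
  mem : ℕ → ℕ

/-- Arithmetic expressions.  `sub` is truncated subtraction, `div` rounds down (and `x / 0 = 0`). -/
inductive Term where
  | lit (c : ℕ)
  | reg (r : ℕ)
  | load (addr : Term)
  | add (a b : Term)
  | sub (a b : Term)
  | mul (a b : Term)
  | div (a b : Term)

/-- The value of an expression; `load e` is the content of the memory cell whose address is the
value of `e` (indirect addressing). -/
def Term.val (s : State) : Term → ℕ
  | .lit c => c
  | .reg r => s.reg r
  | .load e => s.mem (e.val s)
  | .add a b => a.val s + b.val s
  | .sub a b => a.val s - b.val s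
  | .mul a b => a.val s * b.val s
  | .div a b => a.val s / b.val s

/-- The logarithmic cost of evaluating an expression: one plus the bit length of the value, summed
over all subexpressions.  Thus operands, results and addresses are all charged their length. -/
def Term.cost (s : State) : Term → ℕ
  | .lit c => 1 + Nat.size c
  | .reg r => 1 + Nat.size (s.reg r)
  | .load e => e.cost s + 1 + Nat.size ((Term.load e).val s)
  | .add a b => a.cost s + b.cost s + 1 + Nat.size ((Term.add a b).val s)
  | .sub a b => a.cost s + b.cost s + 1 + Nat.size ((Term.sub a b).val s)
  | .mul a b => a.cost s + b.cost s + 1 + Nat.size ((Term.mul a b).val s)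
  | .div a b => a.cost s + b.cost s + 1 + Nat.size ((Term.div a b).val s)

/-- Programs.  A test succeeds when the value of the expression is not zero. -/
inductive Program where
  | assign (r : ℕ) (e : Term)
  | store (addr e : Term)
  | seq (P Q : Program)
  | ite (b : Term) (P Q : Program)
  | while (b : Term) (P : Program)

/-- `Exec P s s' t`: started in the state `s`, the program `P` halts in the state `s'` after
running for time `t`. -/
inductive Exec : Program → State → State → ℕ → Prop
  | assign (r : ℕ) (e : Term) (s : State) :
      Exec (.assign r e) s ⟨Function.update s.reg r (e.val s), s.mem⟩ (1 + e.cost s)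
  | store (addr e : Term) (s : State) :
      Exec (.store addr e) s ⟨s.reg, Function.update s.mem (addr.val s) (e.val s)⟩
        (1 + addr.cost s + e.cost s)
  | seq {P Q : Program} {s₁ s₂ s₃ : State} {t₁ t₂ : ℕ} :
      Exec P s₁ s₂ t₁ → Exec Q s₂ s₃ t₂ → Exec (.seq P Q) s₁ s₃ (t₁ + t₂)
  | ite_true {b : Term} {P Q : Program} {s s' : State} {t : ℕ} :
      b.val s ≠ 0 → Exec P s s' t → Exec (.ite b P Q) s s' (1 + b.cost s + t)
  | ite_false {b : Term} {P Q : Program} {s s' : State} {t : ℕ} :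
      b.val s = 0 → Exec Q s s' t → Exec (.ite b P Q) s s' (1 + b.cost s + t)
  | while_true {b : Term} {P : Program} {s₁ s₂ s₃ : State} {t₁ t₂ : ℕ} :
      b.val s₁ ≠ 0 → Exec P s₁ s₂ t₁ → Exec (.while b P) s₂ s₃ t₂ →
        Exec (.while b P) s₁ s₃ (1 + b.cost s₁ + t₁ + t₂)
  | while_false {b : Term} {P : Program} {s : State} :
      b.val s = 0 → Exec (.while b P) s s (1 + b.cost s)

/-- The initial state on the input `x`: the input is written to the first memory cells, register
`0` holds its length, and everything else is zero. -/
def State.init (x : List ℕ) : State where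
  reg := Function.update (fun _ => 0) 0 x.length
  mem := fun i => x.getD i 0

/-- On the input `x`, the program halts within time `T` and accepts (register `0` is not zero). -/
def AcceptsWithin (P : Program) (x : List ℕ) (T : ℝ) : Prop :=
  ∃ s t, Exec P (State.init x) s t ∧ (t : ℝ) ≤ T ∧ s.reg 0 ≠ 0

/-- On the input `x`, the program halts within time `T` and rejects (register `0` is zero). -/
def RejectsWithin (P : Program) (x : List ℕ) (T : ℝ) : Prop :=
  ∃ s t, Exec P (State.init x) s t ∧ (t : ℝ) ≤ T ∧ s.reg 0 = 0

/-! ## The Strong Exponential Time Hypothesis -/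

/-- The formula as an input: number of variables, number of clauses, and then for every clause its
length followed by its literals, where `xᵢ` is written as `2 i + 1` and `¬ xᵢ` as `2 i`. -/
def encodeCNF {n : ℕ} (φ : Std.Sat.CNF (Fin n)) : List ℕ :=
  n :: φ.clauses.size ::
    φ.clauses.toList.flatMap (fun c => c.length :: c.map (fun l => 2 * (l.1 : ℕ) + l.2.toNat))

/-- The program decides satisfiability of the CNF formulas with at most `k` literals per clause,
within time `T n L` on formulas with `n` variables whose encoding has length `L`. -/
def DecidesSAT (P : Program) (k : ℕ) (T : ℕ → ℕ → ℝ) : Prop :=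
  ∀ (n : ℕ) (φ : Std.Sat.CNF (Fin n)), (∀ c ∈ φ.clauses, c.length ≤ k) →
    ((∃ a : Fin n → Bool, φ.Sat a) →
      AcceptsWithin P (encodeCNF φ) (T n (encodeCNF φ).length)) ∧
    ((¬ ∃ a : Fin n → Bool, φ.Sat a) →
      RejectsWithin P (encodeCNF φ) (T n (encodeCNF φ).length))

/-- The Strong Exponential Time Hypothesis: for every `δ > 0` there is a `k` such that no
deterministic algorithm decides `k`-SAT on `n` variables in time `2 ^ ((1 - δ) n)`, up to factors
polynomial in the size of the formula. -/
def SETH : Prop :=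
  ∀ δ : ℝ, 0 < δ → ∃ k : ℕ, ¬ ∃ (P : Program) (c : ℕ),
    DecidesSAT P k (fun n L => c * ((n : ℝ) + L) ^ c * (2 : ℝ) ^ ((1 - δ) * n))

/-! ## Best ultrametric fit -/

/-- There is an ultrametric `Δ` on `V` with `w u v ≤ Δ u v ≤ α * w u v` for all `u`, `v`, that is,
`w` has an ultrametric embedding of distortion at most `α`. -/
def HasUltrametricFit {V : Type*} (w : V → V → ℝ) (α : ℝ) : Prop :=
  ∃ Δ : MetricSpace V, @IsUltrametricDist V Δ.toDist ∧
    ∀ u v : V, w u v ≤ Δ.dist u v ∧ Δ.dist u v ≤ α * w u v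

/-- The `ℓ∞` distances of the points `p i` (the metric on `Fin d → ℝ` is the supremum metric). -/
noncomputable def linftyDist {n d : ℕ} (p : Fin n → Fin d → ℕ) (i j : Fin n) : ℝ :=
  dist (fun t => (p i t : ℝ)) (fun t => (p j t : ℝ))

/-- A point set as an input: the number of points, the dimension, and then the coordinates of the
points, one point after the other. -/
def encodePoints {n d : ℕ} (p : Fin n → Fin d → ℕ) : List ℕ :=
  n :: d :: (List.ofFn p).flatMap List.ofFn

/-- On all sets of `n ≥ 1` points of dimension `d n` in the `ℓ∞` metric, with integer coordinates
between `0` and `n`, the program halts within time `T n` and accepts if the set has an isometric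
ultrametric embedding, and it halts within time `T n` and rejects if every ultrametric embedding has
distortion at least `3 / 2`.  Nothing is required on other inputs. -/
def DistinguishesULT (P : Program) (d : ℕ → ℕ) (T : ℕ → ℝ) : Prop :=
  ∀ n : ℕ, 1 ≤ n → ∀ p : Fin n → Fin (d n) → ℕ, Function.Injective p → (∀ i t, p i t ≤ n) →
    (HasUltrametricFit (linftyDist p) 1 → AcceptsWithin P (encodePoints p) (T n)) ∧
    ((∀ α : ℝ, HasUltrametricFit (linftyDist p) α → 3 / 2 ≤ α) →
      RejectsWithin P (encodePoints p) (T n))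

end UltraFit

/-! Geometry. A family of clauses over `2h` variables becomes `N = 2^(h+1)` points, one for every
assignment of either half of the variables. Every clause gives a coordinate: on the left half `0` if
the half assignment falsifies its part of the clause and `1` if not, on the right half `3` and `2`
respectively. Another `h` coordinates with values `1` and `2` spell out the bits of the half
assignment. Distinct points of one half are then at distance `1`; a left and a right point are at
distance `3` if the joint assignment falsifies some clause, and at distance at most `2` otherwise.
For an unsatisfiable family all cross distances are `3`, and the metric is itself an ultrametric
(`hasUltrametricFit_of_unsat`). For a satisfiable family some cross pair has distance at most `2`,
while a unit clause on a fresh variable ensures that another one has distance `3`. If the distortion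
were below `3/2`, the first pair and all pairs inside a half would get ultrametric distance below
`3`, and the strong triangle inequality would force this on the second pair too
(`le_distortion_of_sat`).

Sparsification. The dimension is the number of clauses plus `h` and has to be linear in `h`, so the
formula is sparsified first. If many minimal clauses share a heart (a sunflower whose petals may
overlap), then an assignment that satisfies them satisfies the heart or all petals; branching on
this until no sunflower remains yields leaves with linearly many minimal clauses (`card_minIds_le`).
Always taking the smallest clauses, and among them the smallest petals, bounds how often added
clauses can absorb one another (`Inv`, `Inv.le_of_rec`). A potential that decreases in both branches
then bounds the number of leaves by `exp (η u)`, where `u` is the number of possible literals and `η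
> 0` is arbitrary (`leaves_le_exp`, `exists_thresholds`). The thresholds depend on `k` and `η` only,
so the dimension constant does as well.

Machine. The tree is traversed without a stack: a number `w` encodes a path, the leaf is recomputed
from the root, and adding the weight of that leaf to `w` gives the next path (`orbit`). Each leaf is
turned into points, and the hypothetical distinguisher is run on them in odd memory cells that no
earlier round has touched (`exec_reloc`, `exec_round`, `exec_rounds`). All other code is written
with counting loops, whose cost is bounded once and for all (`LoopProg.exec`).

Balance. For `ε ≤ 1`, the time `N^(2-ε)` is of order `2^((1-ε/2)n)`; with about `2^(εn/4)` leaves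
the total is `2^((1-ε/4)n)` up to polynomial factors, which contradicts `SETH`. -/

namespace UltraFit

open Finset

/-! ### Sunflowers and sparse families of sets -/

section Sparsification

variable {Λ : Type*} [DecidableEq Λ]

/-- The members of a family of clauses that contain no other member. -/
def minimals (F : Finset (Finset Λ)) : Finset (Finset Λ) :=
  F.filter fun C => ∀ E ∈ F, ¬ E ⊂ C

/-- The minimal clauses of size `c` that contain `E`. -/
def link (F : Finset (Finset Λ)) (c : ℕ) (E : Finset Λ) : Finset (Finset Λ) :=
  (minimals F).filter fun C => C.card = c ∧ E ⊆ C

/-- `H` is the heart of a sunflower with petals of size `i` among the minimal clauses of size `c`,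
and there is no sunflower among smaller clauses, or with smaller petals. -/
structure IsPick (θ : ℕ → ℕ) (F : Finset (Finset Λ)) (c i : ℕ) (H : Finset Λ) : Prop where
  pos : 1 ≤ i
  nonempty : H.Nonempty
  card : H.card + i = c
  le : θ i ≤ (link F c H).card
  lt_size : ∀ c' < c, ∀ E : Finset Λ, E.Nonempty → E.card < c' →
    (link F c' E).card < θ (c' - E.card)
  lt_petal : ∀ E : Finset Λ, H.card < E.card → E.card < c → (link F c E).card < θ (c - E.card)

/-- The invariant of the branching process; `a j` counts the clauses of size `j` added so far. -/
structure Inv (θ : ℕ → ℕ) (F : Finset (Finset Λ)) (a : ℕ → ℕ) : Prop where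
  zero : a 0 = 0
  deg : ∀ j, 0 < a j → ∀ E : Finset Λ, E.Nonempty → E.card < j →
    (link F j E).card ≤ 2 * θ (j - E.card)
  cnt : ∀ j, a j ≤ ((minimals F).filter fun C => C.card = j).card +
    ∑ i ∈ range j, 2 * θ (j - i) * a i

theorem mem_minimals {F : Finset (Finset Λ)} {C : Finset Λ} :
    C ∈ minimals F ↔ C ∈ F ∧ ∀ E ∈ F, ¬ E ⊂ C := by
  simp [minimals]

theorem mem_link {F : Finset (Finset Λ)} {c : ℕ} {E C : Finset Λ} :
    C ∈ link F c E ↔ C ∈ minimals F ∧ C.card = c ∧ E ⊆ C := by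
  simp [link]

theorem Inv.init (θ : ℕ → ℕ) (F : Finset (Finset Λ)) : Inv θ F 0 :=
  ⟨rfl, fun j h => by simp at h, fun j => by simp⟩

variable {θ : ℕ → ℕ} {F G : Finset (Finset Λ)} {a : ℕ → ℕ} {i : ℕ}

theorem minimals_union_of_card_ne {C : Finset Λ} (h : C ∈ minimals (F ∪ G)) (hC : C ∉ G) :
    C ∈ minimals F := by
  rw [mem_minimals] at h ⊢
  refine ⟨by simpa [hC] using h.1, fun E hE => h.2 E (by simp [hE])⟩

theorem mem_minimals_union_right {C : Finset Λ} (hG : ∀ E ∈ G, E.card = i)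
    (hnew : ∀ E ∈ G, ∀ X ∈ F, ¬ X ⊆ E) (h : C ∈ G) : C ∈ minimals (F ∪ G) := by
  rw [mem_minimals]
  refine ⟨by simp [h], fun E hE hEC => ?_⟩
  rcases mem_union.1 hE with hE | hE
  · exact hnew C h E hE hEC.subset
  · have := card_lt_card hEC
    rw [hG E hE, hG C h] at this
    exact lt_irrefl _ this

theorem mem_minimals_union_left {C : Finset Λ} (h : C ∈ minimals F)
    (hC : ∀ E ∈ G, ¬ E ⊂ C) : C ∈ minimals (F ∪ G) := by
  rw [mem_minimals] at h ⊢
  refine ⟨by simp [h.1], fun E hE => ?_⟩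
  rcases mem_union.1 hE with hE | hE
  · exact h.2 E hE
  · exact hC E hE

/-- Adding new clauses of size `i` keeps the invariant. -/
theorem Inv.union (h : Inv θ F a) (hi : 1 ≤ i) (hG : ∀ E ∈ G, E.card = i)
    (hnew : ∀ E ∈ G, ∀ X ∈ F, ¬ X ⊆ E)
    (hdeg : ∀ E : Finset Λ, E.Nonempty → E.card < i →
      (link F i E).card + (G.filter fun X => E ⊆ X).card ≤ 2 * θ (i - E.card)) :
    Inv θ (F ∪ G) (Function.update a i (a i + G.card)) := by
  have hdisj : Disjoint F G := by
    rw [disjoint_left]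
    intro X hX hXG
    exact hnew X hXG X hX subset_rfl
  refine ⟨?_, ?_, ?_⟩
  · rw [Function.update_of_ne (by omega)]; exact h.zero
  · intro j hj E hE hEj
    by_cases hji : j = i
    · subst hji
      refine le_trans ?_ (hdeg E hE hEj)
      refine le_trans (card_le_card ?_) (card_union_le _ _)
      intro C hC
      rw [mem_link] at hC
      by_cases hCG : C ∈ G
      · simp [hCG, hC.2.2]
      · exact mem_union_left _ (mem_link.2 ⟨minimals_union_of_card_ne hC.1 hCG, hC.2⟩)
    · rw [Function.update_of_ne hji] at hj
      refine le_trans (card_le_card ?_) (h.deg j hj E hE hEj)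
      intro C hC
      rw [mem_link] at hC ⊢
      exact ⟨minimals_union_of_card_ne hC.1 fun hCG => hji (by rw [← hC.2.1, hG C hCG]), hC.2⟩
  · intro j
    -- New clauses of size `i` leave smaller minimal clauses alone, are minimal themselves and so
    -- pay for the growth of `a i`, and each of them removes at most `2 * θ (j - i)` minimal clauses
    -- of a larger size `j`, which the sum pays for.
    rcases lt_trichotomy j i with hji | hji | hji
    · rw [Function.update_of_ne hji.ne]
      refine le_trans (h.cnt j) (add_le_add (card_le_card ?_) (sum_le_sum fun x hx => ?_))
      · intro C hC
        rw [mem_filter] at hC ⊢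
        refine ⟨mem_minimals_union_left hC.1 fun E hE hEC => ?_, hC.2⟩
        have := card_lt_card hEC
        rw [hG E hE, hC.2] at this
        omega
      · rw [mem_range] at hx
        rw [Function.update_of_ne (by omega)]
    · subst hji
      rw [Function.update_self]
      have h1 : ∑ x ∈ range j, 2 * θ (j - x) * Function.update a j (a j + G.card) x =
          ∑ x ∈ range j, 2 * θ (j - x) * a x := by
        refine sum_congr rfl fun x hx => ?_
        rw [mem_range] at hx
        rw [Function.update_of_ne (by omega)]
      rw [h1]
      have h2 : ((minimals F).filter fun C => C.card = j).card + G.card ≤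
          ((minimals (F ∪ G)).filter fun C => C.card = j).card := by
        rw [← card_union_of_disjoint]
        · refine card_le_card ?_
          intro C hC
          rcases mem_union.1 hC with hC | hC
          · rw [mem_filter] at hC ⊢
            refine ⟨mem_minimals_union_left hC.1 fun E hE hEC => ?_, hC.2⟩
            have := card_lt_card hEC
            rw [hG E hE, hC.2] at this
            omega
          · rw [mem_filter]
            exact ⟨mem_minimals_union_right hG hnew hC, hG C hC⟩
        · refine disjoint_of_subset_left ?_ hdisj
          exact (filter_subset _ _).trans (filter_subset _ _)
      have := h.cnt j
      omega
    · rw [Function.update_of_ne (by omega)]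
      -- The degree bound that limits the loss is available only if clauses of size `j` have been
      -- added; otherwise the inequality is trivial.
      rcases Nat.eq_zero_or_pos (a j) with h0 | h0
      · omega
      have h1 : ∑ x ∈ range j, 2 * θ (j - x) * Function.update a i (a i + G.card) x =
          ∑ x ∈ range j, 2 * θ (j - x) * a x + 2 * θ (j - i) * G.card := by
        have : ∀ x, 2 * θ (j - x) * Function.update a i (a i + G.card) x =
            2 * θ (j - x) * a x + if x = i then 2 * θ (j - i) * G.card else 0 := by
          intro x
          by_cases hx : x = i
          · subst hx; simp; ring
          · simp [hx]
        simp_rw [this]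
        rw [sum_add_distrib]
        simp [hji]
      have h2 : ((minimals F).filter fun C => C.card = j).card ≤
          ((minimals (F ∪ G)).filter fun C => C.card = j).card + 2 * θ (j - i) * G.card := by
        have h3 : ((minimals F).filter fun C => C.card = j) ⊆
            ((minimals (F ∪ G)).filter fun C => C.card = j) ∪ G.biUnion (link F j) := by
          intro C hC
          rw [mem_filter] at hC
          by_cases hex : ∃ E ∈ G, E ⊂ C
          · obtain ⟨E, hE, hEC⟩ := hex
            exact mem_union_right _ (mem_biUnion.2 ⟨E, hE, mem_link.2 ⟨hC.1, hC.2, hEC.subset⟩⟩)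
          · push Not at hex
            exact mem_union_left _ (mem_filter.2 ⟨mem_minimals_union_left hC.1 hex, hC.2⟩)
        refine (card_le_card h3).trans ((card_union_le _ _).trans ?_)
        refine Nat.add_le_add_left ?_ _
        refine (card_biUnion_le_card_mul _ _ (2 * θ (j - i)) fun E hE => ?_).trans ?_
        · have := h.deg j h0 E (card_pos.1 (by rw [hG E hE]; omega)) (by rw [hG E hE]; omega)
          rwa [hG E hE] at this
        · rw [mul_comm]
      have := h.cnt j
      omega

/-- A member inside the heart would lie strictly inside a clause of the sunflower, against the
minimality of that clause. In particular the heart is a new clause. -/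
theorem IsPick.not_subset {c : ℕ} {H : Finset Λ} (hp : IsPick θ F c i H) (hθ : 1 ≤ θ i)
    {X : Finset Λ} (hX : X ∈ F) : ¬ X ⊆ H := by
  intro hXH
  have : 0 < (link F c H).card := lt_of_lt_of_le hθ hp.le
  obtain ⟨C, hC⟩ := card_pos.1 this
  rw [mem_link, mem_minimals] at hC
  refine hC.1.2 X hX ((ssubset_iff_subset_ne).2 ⟨hXH.trans hC.2.2, fun h => ?_⟩)
  have h1 := card_le_card hXH
  have := hp.card
  have := hp.pos
  rw [h] at h1
  omega

/-- Adding the heart of a sunflower keeps the invariant. -/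
theorem Inv.heart (h : Inv θ F a) {c : ℕ} {H : Finset Λ} (hp : IsPick θ F c i H)
    (hθ : ∀ j, 1 ≤ θ j) :
    Inv θ (insert H F) (Function.update a H.card (a H.card + 1)) := by
  have h1 := h.union (G := {H}) (i := H.card) (card_pos.2 hp.nonempty) (by simp)
    (by
      intro E hE X hX
      rw [mem_singleton] at hE
      subst hE
      exact hp.not_subset (hθ i) hX)
    (by
      intro E hE hEH
      -- The heart is smaller than `c`, so the old link is strictly below the threshold and has room
      -- for one more clause.
      have h2 := hp.lt_size H.card (by have := hp.card; have := hp.pos; omega) E hE hEH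
      have h3 : (filter (fun X => E ⊆ X) {H}).card ≤ 1 := by
        refine (card_filter_le _ _).trans (by simp)
      omega)
  rwa [card_singleton, union_comm, ← insert_eq] at h1

/-- The petals of a sunflower. -/
def petals (F : Finset (Finset Λ)) (c : ℕ) (H : Finset Λ) : Finset (Finset Λ) :=
  (link F c H).image fun C => C \ H

theorem card_petals (F : Finset (Finset Λ)) (c : ℕ) (H : Finset Λ) :
    (petals F c H).card = (link F c H).card := by
  refine card_image_of_injOn ?_
  intro C hC C' hC' hCC
  have h1 := (mem_link.1 (mem_coe.1 hC)).2.2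
  have h2 := (mem_link.1 (mem_coe.1 hC')).2.2
  simp only at hCC
  rw [← sdiff_union_of_subset h1, ← sdiff_union_of_subset h2, hCC]

/-- Adding the petals of a sunflower keeps the invariant. -/
theorem Inv.petals (h : Inv θ F a) {c : ℕ} {H : Finset Λ} (hp : IsPick θ F c i H) :
    Inv θ (F ∪ petals F c H) (Function.update a i (a i + (link F c H).card)) := by
  rw [← card_petals]
  have hci := hp.card
  have hH := card_pos.2 hp.nonempty
  refine h.union hp.pos ?_ ?_ ?_
  · intro E hE
    obtain ⟨C, hC, rfl⟩ := mem_image.1 hE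
    rw [mem_link] at hC
    rw [card_sdiff_of_subset hC.2.2, hC.2.1]
    omega
  · intro E hE X hX hXE
    obtain ⟨C, hC, rfl⟩ := mem_image.1 hE
    rw [mem_link, mem_minimals] at hC
    refine hC.1.2 X hX ((ssubset_iff_subset_ne).2 ⟨hXE.trans sdiff_subset, fun hh => ?_⟩)
    have h1 := card_le_card hXE
    rw [card_sdiff_of_subset hC.2.2, hh, hC.2.1] at h1
    omega
  · intro E hE hEi
    -- Here the factor `2` arises: fewer than `θ` old clauses contain `E` because `i < c`, and fewer
    -- than `θ` petals do because the heart was chosen with the smallest petals.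
    have h1 := hp.lt_size i (by omega) E hE hEi
    have h2 : ((UltraFit.petals F c H).filter fun X => E ⊆ X).card < θ (i - E.card) := by
      by_cases hd : Disjoint E H
      · have hcard : (H ∪ E).card = H.card + E.card := card_union_of_disjoint hd.symm
        -- Petals that contain `E` come from clauses that contain the strictly larger heart `H ∪ E`.
        have h3 := hp.lt_petal (H ∪ E) (by rw [hcard]; have := card_pos.2 hE; omega)
          (by rw [hcard]; omega)
        have h4 : c - (H ∪ E).card = i - E.card := by rw [hcard]; omega
        rw [h4] at h3
        refine lt_of_le_of_lt ?_ h3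
        refine le_trans (card_le_card (t := (link F c (H ∪ E)).image fun C => C \ H) ?_)
          card_image_le
        intro X hX
        rw [mem_filter, UltraFit.petals, mem_image] at hX
        obtain ⟨⟨C, hC, rfl⟩, hEX⟩ := hX
        refine mem_image.2 ⟨C, ?_, rfl⟩
        rw [mem_link] at hC ⊢
        exact ⟨hC.1, hC.2.1, union_subset hC.2.2 (hEX.trans sdiff_subset)⟩
      · have h0 : ((UltraFit.petals F c H).filter fun X => E ⊆ X) = ∅ := by
          refine filter_eq_empty_iff.2 fun X hX hEX => hd ?_
          obtain ⟨C, -, rfl⟩ := mem_image.1 hX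
          exact disjoint_of_subset_left hEX sdiff_disjoint
        rw [h0, card_empty]
        omega
    omega

/-- Every clause of positive size lies in the link of one of its elements. Singletons are counted
directly, since no link bound is assumed for them. -/
theorem card_minimals_filter_le {U : Finset Λ} (hU : ∀ C ∈ F, C ⊆ U) {j b : ℕ} (hj : 1 ≤ j)
    (hb : 1 ≤ b) (hlink : 2 ≤ j → ∀ x, (link F j {x}).card ≤ b) :
    ((minimals F).filter fun C => C.card = j).card ≤ U.card * b := by
  rcases Nat.eq_or_lt_of_le hj with h1 | h1
  · subst h1
    have : ((minimals F).filter fun C => C.card = 1) ⊆ U.image fun x => {x} := by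
      intro C hC
      rw [mem_filter, card_eq_one] at hC
      obtain ⟨hC, x, rfl⟩ := hC
      exact mem_image.2 ⟨x, hU _ (mem_minimals.1 hC).1 (mem_singleton_self x), rfl⟩
    calc _ ≤ _ := card_le_card this
      _ ≤ U.card := card_image_le
      _ ≤ _ := Nat.le_mul_of_pos_right _ hb
  · have : ((minimals F).filter fun C => C.card = j) ⊆ U.biUnion fun x => link F j {x} := by
      intro C hC
      rw [mem_filter] at hC
      obtain ⟨x, hx⟩ := card_pos.1 (by omega : 0 < C.card)
      exact mem_biUnion.2 ⟨x, hU _ (mem_minimals.1 hC.1).1 hx,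
        mem_link.2 ⟨hC.1, hC.2, by simpa using hx⟩⟩
    exact (card_le_card this).trans (card_biUnion_le_card_mul _ _ _ fun x _ => hlink h1 x)

/-- Strong induction on `j`. As soon as a clause of size `j` has been added, the degree bound at
single elements allows at most `2 * θ (j - 1)` minimal clauses of size `j` per element of `U`; the
sum in `Inv.cnt` accounts for those that have been absorbed, and `β` solves the resulting recursion.
-/
theorem Inv.le_of_rec (h : Inv θ F a) (hθ : ∀ j, 1 ≤ θ j) {U : Finset Λ} (hU : ∀ C ∈ F, C ⊆ U)
    {β : ℕ → ℕ} {k : ℕ}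
    (hβ : ∀ j, 1 ≤ j → j ≤ k → 2 * θ (j - 1) + ∑ i ∈ range j, 2 * θ (j - i) * β i ≤ β j)
    {j : ℕ} (hjk : j ≤ k) : a j ≤ β j * U.card := by
  induction j using Nat.strong_induction_on with
  | _ j ih =>
    rcases Nat.eq_zero_or_pos (a j) with h0 | h0
    · omega
    have hj : 1 ≤ j := by
      by_contra hj
      have : j = 0 := by omega
      rw [this, h.zero] at h0
      omega
    refine (h.cnt j).trans ?_
    have h1 := card_minimals_filter_le hU hj (b := 2 * θ (j - 1)) (by have := hθ (j - 1); omega)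
      (fun h2 x => by
        have := h.deg j h0 {x} (by simp) (by rw [card_singleton]; omega)
        rwa [card_singleton] at this)
    have h2 : ∑ i ∈ range j, 2 * θ (j - i) * a i ≤
        (∑ i ∈ range j, 2 * θ (j - i) * β i) * U.card := by
      rw [sum_mul]
      refine sum_le_sum fun x hx => ?_
      rw [mem_range] at hx
      rw [mul_assoc _ (β x)]
      exact Nat.mul_le_mul_left _ (ih x hx (by omega))
    calc _ ≤ U.card * (2 * θ (j - 1)) + (∑ i ∈ range j, 2 * θ (j - i) * β i) * U.card :=
          add_le_add h1 h2
      _ = (2 * θ (j - 1) + ∑ i ∈ range j, 2 * θ (j - i) * β i) * U.card := by ring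
      _ ≤ _ := Nat.mul_le_mul_right _ (hβ j hj hjk)

/-- A family without sunflowers is sparse. -/
theorem card_minimals_le (hθ : ∀ j, 1 ≤ θ j) {U : Finset Λ} {k : ℕ} (hU : ∀ C ∈ F, C ⊆ U)
    (hk : ∀ C ∈ F, C.card ≤ k)
    (hno : ∀ c ≤ k, ∀ E : Finset Λ, E.Nonempty → E.card < c →
      (link F c E).card < θ (c - E.card)) :
    (minimals F).card ≤ 1 + U.card * ∑ j ∈ range k, θ j := by
  -- The empty clause is responsible for the summand `1` in the bound; the other clauses are sorted
  -- by size.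
  have h1 : minimals F ⊆ insert ∅ ((range k).biUnion fun j =>
      (minimals F).filter fun C => C.card = j + 1) := by
    intro C hC
    rcases C.eq_empty_or_nonempty with rfl | hne
    · simp
    · have h2 := card_pos.2 hne
      have h3 := hk C (mem_minimals.1 hC).1
      refine mem_insert_of_mem (mem_biUnion.2 ⟨C.card - 1, by rw [mem_range]; omega, ?_⟩)
      rw [mem_filter]
      exact ⟨hC, by omega⟩
  refine (card_le_card h1).trans ((card_insert_le _ _).trans ?_)
  rw [add_comm, mul_sum]
  refine Nat.add_le_add_left (card_biUnion_le.trans (sum_le_sum fun j hj => ?_)) _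
  rw [mem_range] at hj
  refine card_minimals_filter_le hU (by omega) (hθ j) fun h2 x => ?_
  have := hno (j + 1) (by omega) {x} (by simp) (by rw [card_singleton]; omega)
  rw [card_singleton] at this
  exact this.le

end Sparsification


/-! ### Clauses as numbers to the base `B` -/

section Digits

/-- The digit of `C` at position `j` to the base `B`. -/
def dig (B C j : ℕ) : ℕ := C / B ^ j % B

/-- The number with the digits `f 0, ..., f (k - 1)` to the base `B`. -/
def enc (B k : ℕ) (f : ℕ → ℕ) : ℕ := ∑ j ∈ range k, f j * B ^ j

variable {B k : ℕ}

theorem dig_lt (hB : 0 < B) (C j : ℕ) : dig B C j < B := Nat.mod_lt _ hB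

theorem enc_succ (f : ℕ → ℕ) : enc B (k + 1) f = f 0 + B * enc B k fun j => f (j + 1) := by
  rw [enc, enc, sum_range_succ', mul_sum, add_comm]
  simp only [pow_zero, mul_one, pow_succ]
  congr 1
  exact sum_congr rfl fun j _ => by ring

theorem dig_zero (C : ℕ) : dig B C 0 = C % B := by simp [dig]

theorem dig_succ (C j : ℕ) : dig B C (j + 1) = dig B (C / B) j := by
  rw [dig, dig, pow_succ, mul_comm, Nat.div_div_eq_div_mul]

theorem enc_lt {f : ℕ → ℕ} (hf : ∀ j < k, f j < B) : enc B k f < B ^ k := by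
  induction k generalizing f with
  | zero => simp [enc]
  | succ k ih =>
    rw [enc_succ]
    have h1 := ih (f := fun j => f (j + 1)) fun j hj => hf (j + 1) (by omega)
    have h2 := hf 0 (by omega)
    calc _ < B + B * enc B k fun j => f (j + 1) := by omega
      _ = B * ((enc B k fun j => f (j + 1)) + 1) := by ring
      _ ≤ B * B ^ k := Nat.mul_le_mul_left _ h1
      _ = _ := by ring

theorem dig_enc {f : ℕ → ℕ} (hf : ∀ j < k, f j < B) {j : ℕ} (hj : j < k) :
    dig B (enc B k f) j = f j := by
  induction k generalizing f j with
  | zero => omega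
  | succ k ih =>
    have hf0 := hf 0 (by omega)
    rw [enc_succ]
    cases j with
    | zero => rw [dig_zero, Nat.add_mul_mod_self_left, Nat.mod_eq_of_lt hf0]
    | succ j =>
      rw [dig_succ, Nat.add_mul_div_left _ _ (by omega), Nat.div_eq_of_lt hf0, zero_add]
      exact ih (f := fun j => f (j + 1)) (fun j hj => hf (j + 1) (by omega)) (by omega)

theorem enc_dig {C : ℕ} (hC : C < B ^ k) : enc B k (dig B C) = C := by
  induction k generalizing C with
  | zero => simp at hC; simp [enc, hC]
  | succ k ih =>
    have : C / B < B ^ k := Nat.div_lt_of_lt_mul (by rw [pow_succ] at hC; linarith)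
    rw [enc_succ, dig_zero]
    simp only [dig_succ]
    rw [ih this, Nat.mod_add_div]

theorem eq_of_dig_eq {C E : ℕ} (hC : C < B ^ k) (hE : E < B ^ k)
    (h : ∀ j < k, dig B C j = dig B E j) : C = E := by
  rw [← enc_dig hC, ← enc_dig hE]
  exact sum_congr rfl fun j hj => by rw [h j (mem_range.1 hj)]

theorem enc_sub {f g : ℕ → ℕ} (h : ∀ j < k, g j ≤ f j) :
    enc B k f - enc B k g = enc B k fun j => f j - g j := by
  refine Nat.sub_eq_of_eq_add ?_
  rw [enc, enc, enc, ← sum_add_distrib]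
  refine sum_congr rfl fun j hj => ?_
  rw [← add_mul, Nat.sub_add_cancel (h j (mem_range.1 hj))]

theorem dig_sub {C H : ℕ} (hB : 0 < B) (hC : C < B ^ k) (hH : H < B ^ k)
    (h : ∀ j < k, dig B H j ≤ dig B C j) {j : ℕ} (hj : j < k) :
    dig B (C - H) j = dig B C j - dig B H j := by
  have : C - H = enc B k fun j => dig B C j - dig B H j := by
    rw [← enc_sub h, enc_dig hC, enc_dig hH]
  rw [this]
  exact dig_enc (f := fun j => dig B C j - dig B H j)
    (fun j _ => lt_of_le_of_lt (Nat.sub_le _ _) (dig_lt hB C j)) hj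

end Digits

section Ids

/-- The clause with number `C`: its digits that are not zero, with their positions. -/
def dec (B k C : ℕ) : Finset (ℕ × ℕ) :=
  ((range k).filter fun j => dig B C j ≠ 0).image fun j => (j, dig B C j)

variable {B k : ℕ}

theorem mem_dec {C : ℕ} {x : ℕ × ℕ} : x ∈ dec B k C ↔ x.1 < k ∧ x.2 ≠ 0 ∧ dig B C x.1 = x.2 := by
  rw [dec, mem_image]
  constructor
  · rintro ⟨j, hj, rfl⟩
    rw [mem_filter, mem_range] at hj
    exact ⟨hj.1, hj.2, rfl⟩
  · rintro ⟨h1, h2, h3⟩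
    exact ⟨x.1, by rw [mem_filter, mem_range, h3]; exact ⟨h1, h2⟩, by rw [h3]⟩

theorem card_dec (C : ℕ) : (dec B k C).card = ∑ j ∈ range k, if dig B C j ≠ 0 then 1 else 0 := by
  rw [dec, card_image_of_injective _ fun a b h => (Prod.ext_iff.1 h).1, card_filter]

theorem card_dec_le (C : ℕ) : (dec B k C).card ≤ k :=
  card_image_le.trans ((card_filter_le _ _).trans (by simp))

theorem dec_subset_iff {E C : ℕ} :
    dec B k E ⊆ dec B k C ↔ ∀ j < k, dig B E j = 0 ∨ dig B E j = dig B C j := by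
  constructor
  · intro h j hj
    by_cases h0 : dig B E j = 0
    · exact Or.inl h0
    · have : (j, dig B E j) ∈ dec B k E := mem_dec.2 ⟨hj, h0, rfl⟩
      exact Or.inr (mem_dec.1 (h this)).2.2.symm
  · intro h x hx
    rw [mem_dec] at hx ⊢
    refine ⟨hx.1, hx.2.1, ?_⟩
    rcases h x.1 hx.1 with h1 | h1
    · exact absurd (hx.2.2.symm.trans h1) hx.2.1
    · rw [← h1, hx.2.2]

theorem dec_subset_univ (hB : 0 < B) (C : ℕ) : dec B k C ⊆ range k ×ˢ Ico 1 B := by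
  intro x hx
  rw [mem_dec] at hx
  rw [mem_product, mem_range, mem_Ico]
  have := dig_lt hB C x.1
  exact ⟨hx.1, by omega, by omega⟩

/-- The elements of a clause carry their position, so the digits can be recovered from the set. The
same literal at two positions counts as two elements, which is harmless because satisfaction depends
on the digit only. -/
theorem dec_injOn {C E : ℕ} (hC : C < B ^ k) (hE : E < B ^ k) (h : dec B k C = dec B k E) :
    C = E := by
  refine eq_of_dig_eq hC hE fun j hj => ?_
  rcases dec_subset_iff.1 h.subset j hj with h1 | h1
  · rcases dec_subset_iff.1 h.symm.subset j hj with h2 | h2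
    · rw [h1, h2]
    · exact h2.symm
  · exact h1

/-- The nonzero digits of a subclause agree with those of the clause, so the subtraction has no
borrows and clears exactly these digits. The machine obtains a petal by a single subtraction. -/
theorem dec_sub {C H : ℕ} (hB : 0 < B) (hC : C < B ^ k) (hH : H < B ^ k)
    (h : dec B k H ⊆ dec B k C) : dec B k (C - H) = dec B k C \ dec B k H := by
  have h' := dec_subset_iff.1 h
  have hle : ∀ j < k, dig B H j ≤ dig B C j := fun j hj => by
    rcases h' j hj with h1 | h1 <;> omega
  ext x
  rw [mem_sdiff, mem_dec, mem_dec, mem_dec]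
  by_cases hx : x.1 < k
  · rw [dig_sub hB hC hH hle hx]
    rcases h' x.1 hx with h1 | h1 <;> omega
  · simp [hx]

/-- Erasing the digits outside of `E` gives the number. Hence a search over numbers below `B ^ k`
meets every possible heart. -/
theorem exists_dec_eq {C : ℕ} (hB : 0 < B) {E : Finset (ℕ × ℕ)} (h : E ⊆ dec B k C) :
    ∃ H < B ^ k, dec B k H = E := by
  classical
  have hlt : ∀ j < k, (if (j, dig B C j) ∈ E then dig B C j else 0) < B := fun j _ => by
    split_ifs
    · exact dig_lt hB _ _
    · exact hB
  refine ⟨enc B k fun j => if (j, dig B C j) ∈ E then dig B C j else 0, enc_lt hlt, ?_⟩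
  ext x
  rw [mem_dec]
  constructor
  · rintro ⟨h1, h2, h3⟩
    rw [dig_enc hlt h1] at h3
    split_ifs at h3 with h4
    · rwa [h3] at h4
    · exact absurd h3.symm h2
  · intro hx
    obtain ⟨h1, h2, h3⟩ := mem_dec.1 (h hx)
    refine ⟨h1, h2, ?_⟩
    rw [dig_enc hlt h1, h3, if_pos hx]

end Ids

/-! ### The branching tree and its traversal -/

section Tree

variable (B k : ℕ) (θ : ℕ → ℕ)

/-- The numbers of the minimal clauses. -/
def minIds (F : Finset ℕ) : Finset ℕ := F.filter fun C => ∀ E ∈ F, dec B k E ⊆ dec B k C → E = C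

/-- The numbers of the minimal clauses of size `c` that contain the clause number `H`. -/
def star (F : Finset ℕ) (c H : ℕ) : Finset ℕ :=
  (minIds B k F).filter fun C => (dec B k C).card = c ∧ dec B k H ⊆ dec B k C

/-- `z` describes a sunflower: heart, size of the clauses, and size of the petals. -/
def IsFlower (F : Finset ℕ) (z : ℕ) : Prop :=
  1 ≤ z / B ^ k % (k + 1) ∧ 1 ≤ (dec B k (z % B ^ k)).card ∧
    (dec B k (z % B ^ k)).card + z / B ^ k % (k + 1) = z / B ^ k / (k + 1) ∧
    θ (z / B ^ k % (k + 1)) ≤ (star B k F (z / B ^ k / (k + 1)) (z % B ^ k)).card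

instance (F : Finset ℕ) (z : ℕ) : Decidable (IsFlower B k θ F z) := by
  unfold IsFlower; infer_instance

/-- The first sunflower. -/
def pick (F : Finset ℕ) : Option ℕ :=
  (List.range ((k + 1) ^ 2 * B ^ k)).find? fun z => IsFlower B k θ F z

/-- Add the heart. -/
def heartStep (F : Finset ℕ) (z : ℕ) : Finset ℕ := insert (z % B ^ k) F

/-- Add the petals. -/
def petalStep (F : Finset ℕ) (z : ℕ) : Finset ℕ :=
  F ∪ (star B k F (z / B ^ k / (k + 1)) (z % B ^ k)).image fun C => C - z % B ^ k

/-- The number of leaves of the branching tree. -/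
def leaves : ℕ → Finset ℕ → ℕ
  | 0, _ => 1
  | f + 1, F => match pick B k θ F with
    | none => 1
    | some z => leaves f (heartStep B k F z) + leaves f (petalStep B k F z)

variable {B k θ} {F : Finset ℕ}

theorem mem_minIds {C : ℕ} :
    C ∈ minIds B k F ↔ C ∈ F ∧ ∀ E ∈ F, dec B k E ⊆ dec B k C → E = C := by
  simp [minIds]

theorem mem_star {c H C : ℕ} : C ∈ star B k F c H ↔
    C ∈ minIds B k F ∧ (dec B k C).card = c ∧ dec B k H ⊆ dec B k C := by
  simp [star]

theorem star_subset {c H : ℕ} : star B k F c H ⊆ F :=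
  (filter_subset _ _).trans (filter_subset _ _)

theorem minimals_image (hF : ∀ C ∈ F, C < B ^ k) :
    minimals (F.image (dec B k)) = (minIds B k F).image (dec B k) := by
  ext X
  rw [mem_minimals, mem_image, mem_image]
  constructor
  · rintro ⟨⟨C, hC, rfl⟩, h⟩
    refine ⟨C, mem_minIds.2 ⟨hC, fun E hE hEC => ?_⟩, rfl⟩
    by_contra hne
    refine h _ (mem_image_of_mem _ hE) (Finset.ssubset_iff_subset_ne.2 ⟨hEC, fun he => hne ?_⟩)
    exact dec_injOn (hF E hE) (hF C hC) he
  · rintro ⟨C, hC, rfl⟩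
    rw [mem_minIds] at hC
    refine ⟨⟨C, hC.1, rfl⟩, fun E hE hEC => ?_⟩
    obtain ⟨E, hE', rfl⟩ := mem_image.1 hE
    exact hEC.ne (by rw [hC.2 E hE' hEC.subset])

theorem link_image (hF : ∀ C ∈ F, C < B ^ k) (c H : ℕ) :
    link (F.image (dec B k)) c (dec B k H) = (star B k F c H).image (dec B k) := by
  ext X
  rw [mem_link, minimals_image hF, mem_image, mem_image]
  constructor
  · rintro ⟨⟨C, hC, rfl⟩, h⟩
    exact ⟨C, mem_star.2 ⟨hC, h⟩, rfl⟩
  · rintro ⟨C, hC, rfl⟩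
    rw [mem_star] at hC
    exact ⟨⟨C, hC.1, rfl⟩, hC.2⟩

theorem card_link_image (hF : ∀ C ∈ F, C < B ^ k) (c H : ℕ) :
    (link (F.image (dec B k)) c (dec B k H)).card = (star B k F c H).card := by
  rw [link_image hF]
  refine card_image_of_injOn fun C hC E hE h => ?_
  exact dec_injOn (hF C (star_subset hC)) (hF E (star_subset hE)) h

theorem card_minIds (hF : ∀ C ∈ F, C < B ^ k) :
    (minIds B k F).card = (minimals (F.image (dec B k))).card := by
  rw [minimals_image hF]
  refine (card_image_of_injOn fun C hC E hE h => ?_).symm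
  exact dec_injOn (hF C (filter_subset _ _ hC)) (hF E (filter_subset _ _ hE)) h

/-- Testing numbers misses no sunflower: if the link is not empty, then `E` is part of a clause and
therefore has a number `H`. An empty link is below every threshold. -/
theorem link_lt_of_not_isFlower (hB : 0 < B) (hF : ∀ C ∈ F, C < B ^ k) (hθ : ∀ j, 1 ≤ θ j)
    {c : ℕ} (hc : c ≤ k) {E : Finset (ℕ × ℕ)} (hE : E.Nonempty) (hEc : E.card < c)
    (h : ∀ H < B ^ k, dec B k H = E →
      ¬ IsFlower B k θ F ((c * (k + 1) + (c - E.card)) * B ^ k + H)) :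
    (link (F.image (dec B k)) c E).card < θ (c - E.card) := by
  rcases (link (F.image (dec B k)) c E).eq_empty_or_nonempty with h0 | ⟨X, hX⟩
  · rw [h0, card_empty]
    exact hθ _
  rw [mem_link, minimals_image hF, mem_image] at hX
  obtain ⟨⟨C, -, rfl⟩, -, hEC⟩ := hX
  obtain ⟨H, hH, rfl⟩ := exists_dec_eq hB hEC
  have h1 := h H hH rfl
  have hR : 0 < B ^ k := Nat.pow_pos hB
  have hE1 := card_pos.2 hE
  have e1 : ((c * (k + 1) + (c - (dec B k H).card)) * B ^ k + H) / B ^ k =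
      c * (k + 1) + (c - (dec B k H).card) := by
    rw [mul_comm, Nat.mul_add_div hR, Nat.div_eq_of_lt hH, add_zero]
  have e2 : ((c * (k + 1) + (c - (dec B k H).card)) * B ^ k + H) % B ^ k = H := by
    rw [mul_comm, Nat.mul_add_mod, Nat.mod_eq_of_lt hH]
  have e3 : (c * (k + 1) + (c - (dec B k H).card)) / (k + 1) = c := by
    rw [mul_comm, Nat.mul_add_div (by omega), Nat.div_eq_of_lt (by omega), add_zero]
  have e4 : (c * (k + 1) + (c - (dec B k H).card)) % (k + 1) = c - (dec B k H).card := by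
    rw [mul_comm, Nat.mul_add_mod, Nat.mod_eq_of_lt (by omega)]
  rw [IsFlower, e1, e2, e3, e4] at h1
  rw [card_link_image hF]
  by_contra h2
  exact h1 ⟨by omega, hE1, by omega, by omega⟩

theorem pick_index_lt {c i H : ℕ} (hc : c ≤ k) (hi : i ≤ k) (hH : H < B ^ k) :
    (c * (k + 1) + i) * B ^ k + H < (k + 1) ^ 2 * B ^ k := by
  have h1 : (c * (k + 1) + i) + 1 ≤ (k + 1) ^ 2 := by nlinarith
  calc _ < ((c * (k + 1) + i) + 1) * B ^ k := by rw [add_mul _ 1]; omega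
    _ ≤ _ := Nat.mul_le_mul_right _ h1

/-- In the mixed radix number `z` the clause size is the leading digit, followed by the petal size
and the heart. The first hit therefore minimises the clause size and then the petal size, which is
the extremality in `IsPick`. -/
theorem isPick_of_pick (hB : 0 < B) (hF : ∀ C ∈ F, C < B ^ k) (hθ : ∀ j, 1 ≤ θ j) {z : ℕ}
    (hz : pick B k θ F = some z) :
    z / B ^ k / (k + 1) ≤ k ∧ IsPick θ (F.image (dec B k)) (z / B ^ k / (k + 1))
      (z / B ^ k % (k + 1)) (dec B k (z % B ^ k)) := by
  have hR : 0 < B ^ k := Nat.pow_pos hB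
  rw [pick, List.find?_range_eq_some] at hz
  obtain ⟨h1, h2, h3⟩ := hz
  simp only [decide_eq_true_eq, Bool.not_eq_true', decide_eq_false_iff_not, List.mem_range]
    at h1 h2 h3
  have hc : z / B ^ k / (k + 1) ≤ k := by
    rw [← Nat.lt_succ_iff, Nat.div_lt_iff_lt_mul (by omega), Nat.div_lt_iff_lt_mul hR]
    rw [pow_two] at h2
    exact h2
  obtain ⟨f1, f2, f3, f4⟩ := h1
  have hlt : ∀ c i H, H < B ^ k → c * (k + 1) + i < z / B ^ k →
      (c * (k + 1) + i) * B ^ k + H < z := by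
    intro c i H hH hlt
    calc _ < ((c * (k + 1) + i) + 1) * B ^ k := by rw [add_mul _ 1]; omega
      _ ≤ z / B ^ k * B ^ k := Nat.mul_le_mul_right _ hlt
      _ ≤ z := Nat.div_mul_le_self _ _
  have hz' : z / B ^ k = z / B ^ k / (k + 1) * (k + 1) + z / B ^ k % (k + 1) :=
    (Nat.div_add_mod' _ _).symm
  refine ⟨hc, f1, card_pos.1 f2, f3, ?_, ?_, ?_⟩
  · rwa [card_link_image hF]
  · intro c' hc' E hE hEc
    refine link_lt_of_not_isFlower hB hF hθ (by omega) hE hEc fun H hH _ => h3 _ (hlt _ _ _ hH ?_)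
    have := card_pos.2 hE
    rw [hz']
    have h5 : (c' + 1) * (k + 1) ≤ z / B ^ k / (k + 1) * (k + 1) := Nat.mul_le_mul_right _ hc'
    rw [add_mul] at h5
    omega
  · intro E hE hEc
    refine link_lt_of_not_isFlower hB hF hθ hc (card_pos.1 (by omega)) hEc
      fun H hH _ => h3 _ (hlt _ _ _ hH ?_)
    omega

theorem no_flower_of_pick (hB : 0 < B) (hF : ∀ C ∈ F, C < B ^ k) (hθ : ∀ j, 1 ≤ θ j)
    (hz : pick B k θ F = none) (c : ℕ) (hc : c ≤ k) (E : Finset (ℕ × ℕ)) (hE : E.Nonempty)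
    (hEc : E.card < c) : (link (F.image (dec B k)) c E).card < θ (c - E.card) := by
  rw [pick, List.find?_range_eq_none] at hz
  refine link_lt_of_not_isFlower hB hF hθ hc hE hEc fun H hH _ => ?_
  have := hz _ (pick_index_lt (i := c - E.card) hc (by omega) hH)
  simpa only [Bool.not_eq_true', decide_eq_false_iff_not] using this

/-- This is the sparsity of the leaves; the ground set consists of the `k * (B - 1)` pairs of a
position and a nonzero digit. -/
theorem card_minIds_le (hB : 0 < B) (hF : ∀ C ∈ F, C < B ^ k) (hθ : ∀ j, 1 ≤ θ j)
    (hz : pick B k θ F = none) :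
    (minIds B k F).card ≤ 1 + k * (B - 1) * ∑ j ∈ range k, θ j := by
  have h := card_minimals_le (F := F.image (dec B k)) hθ (U := range k ×ˢ Ico 1 B) (k := k)
    (by
      intro C hC
      obtain ⟨E, -, rfl⟩ := mem_image.1 hC
      exact dec_subset_univ hB E)
    (by
      intro C hC
      obtain ⟨E, -, rfl⟩ := mem_image.1 hC
      exact card_dec_le E)
    (no_flower_of_pick hB hF hθ hz)
  rw [card_minIds hF]
  simpa using h

theorem image_heartStep (z : ℕ) : (heartStep B k F z).image (dec B k) =
    insert (dec B k (z % B ^ k)) (F.image (dec B k)) := image_insert _ _ _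

theorem image_petalStep (hB : 0 < B) (hF : ∀ C ∈ F, C < B ^ k) (z : ℕ) :
    (petalStep B k F z).image (dec B k) = F.image (dec B k) ∪
      petals (F.image (dec B k)) (z / B ^ k / (k + 1)) (dec B k (z % B ^ k)) := by
  have hR : 0 < B ^ k := Nat.pow_pos hB
  rw [petalStep, image_union, petals, link_image hF, image_image, image_image]
  congr 1
  refine image_congr fun C hC => ?_
  have hC' := mem_star.1 (mem_coe.1 hC)
  exact dec_sub hB (hF C (star_subset hC)) (Nat.mod_lt _ hR) hC'.2.2

theorem heartStep_lt (hB : 0 < B) (hF : ∀ C ∈ F, C < B ^ k) (z : ℕ) :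
    ∀ C ∈ heartStep B k F z, C < B ^ k := by
  intro C hC
  rcases mem_insert.1 hC with rfl | hC
  · exact Nat.mod_lt _ (Nat.pow_pos hB)
  · exact hF C hC

theorem petalStep_lt (hF : ∀ C ∈ F, C < B ^ k) (z : ℕ) :
    ∀ C ∈ petalStep B k F z, C < B ^ k := by
  intro C hC
  rcases mem_union.1 hC with hC | hC
  · exact hF C hC
  · obtain ⟨E, hE, rfl⟩ := mem_image.1 hC
    exact lt_of_le_of_lt (Nat.sub_le _ _) (hF E (star_subset hE))

theorem card_lt_heartStep (hB : 0 < B) (hF : ∀ C ∈ F, C < B ^ k) (hθ : ∀ j, 1 ≤ θ j) {z : ℕ}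
    (hz : pick B k θ F = some z) : F.card < (heartStep B k F z).card := by
  have hp := (isPick_of_pick hB hF hθ hz).2
  refine card_lt_card (ssubset_insert fun hH => ?_)
  exact hp.not_subset (hθ _) (mem_image_of_mem _ hH) subset_rfl

/-- If the petal `C - H` were present already, minimality of `C` would give `C - H = C`, so `C`
would be disjoint from its nonempty subset `H`. Since both branches enlarge the family, the tree has
depth at most `B ^ k`. -/
theorem card_lt_petalStep (hB : 0 < B) (hF : ∀ C ∈ F, C < B ^ k) (hθ : ∀ j, 1 ≤ θ j) {z : ℕ}
    (hz : pick B k θ F = some z) : F.card < (petalStep B k F z).card := by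
  have hR : 0 < B ^ k := Nat.pow_pos hB
  have hp := (isPick_of_pick hB hF hθ hz).2
  have h1 := (hθ _).trans hp.le
  rw [card_link_image hF] at h1
  obtain ⟨C, hC⟩ := card_pos.1 h1
  refine card_lt_card (ssubset_iff_of_subset subset_union_left |>.2
    ⟨C - z % B ^ k, mem_union_right _ (mem_image_of_mem _ hC), fun hmem => ?_⟩)
  rw [mem_star, mem_minIds] at hC
  have h2 := dec_sub hB (hF C hC.1.1) (Nat.mod_lt _ hR) hC.2.2
  have h3 := hC.1.2 _ hmem (by rw [h2]; exact sdiff_subset)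
  rw [h3] at h2
  have h4 := hp.nonempty
  have h5 : dec B k (z % B ^ k) = ∅ := by
    have : Disjoint (dec B k C) (dec B k (z % B ^ k)) := by
      rw [h2]; exact sdiff_disjoint
    exact disjoint_self.1 (disjoint_of_subset_left hC.2.2 this)
  rw [h5] at h4
  exact absurd h4 (by simp)

/-- Every clause has a literal in `T`. -/
def SatIds (B k : ℕ) (T : ℕ → Prop) (F : Finset ℕ) : Prop := ∀ C ∈ F, ∃ x ∈ dec B k C, T x.2

theorem exists_minIds_subset (hF : ∀ C ∈ F, C < B ^ k) {C : ℕ} (hC : C ∈ F) :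
    ∃ X ∈ minIds B k F, dec B k X ⊆ dec B k C := by
  obtain ⟨X, hX, hXmin⟩ := exists_min_image (F.filter fun E => dec B k E ⊆ dec B k C)
    (fun E => (dec B k E).card) ⟨C, by simp [hC]⟩
  rw [mem_filter] at hX
  refine ⟨X, mem_minIds.2 ⟨hX.1, fun E hE hEX => ?_⟩, hX.2⟩
  have h1 := hXmin E (mem_filter.2 ⟨hE, hEX.trans hX.2⟩)
  exact dec_injOn (hF E hE) (hF X hX.1) (eq_of_subset_of_card_le hEX h1)

theorem satIds_minIds {T : ℕ → Prop} (hF : ∀ C ∈ F, C < B ^ k) :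
    SatIds B k T (minIds B k F) ↔ SatIds B k T F := by
  constructor
  · intro h C hC
    obtain ⟨X, hX, hXC⟩ := exists_minIds_subset hF hC
    obtain ⟨x, hx, hT⟩ := h X hX
    exact ⟨x, hXC hx, hT⟩
  · exact fun h C hC => h C (filter_subset _ _ hC)

/-- If no literal of the heart is true, then every clause of the sunflower owes its true literal to
its petal. -/
theorem satIds_step (hB : 0 < B) (hF : ∀ C ∈ F, C < B ^ k) {T : ℕ → Prop} (h : SatIds B k T F)
    (z : ℕ) : SatIds B k T (heartStep B k F z) ∨ SatIds B k T (petalStep B k F z) := by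
  have hR : 0 < B ^ k := Nat.pow_pos hB
  by_cases hH : ∃ x ∈ dec B k (z % B ^ k), T x.2
  · left
    intro C hC
    rcases mem_insert.1 hC with rfl | hC
    · exact hH
    · exact h C hC
  · right
    intro C hC
    rcases mem_union.1 hC with hC | hC
    · exact h C hC
    · obtain ⟨E, hE, rfl⟩ := mem_image.1 hC
      obtain ⟨x, hx, hT⟩ := h E (star_subset hE)
      refine ⟨x, ?_, hT⟩
      rw [dec_sub hB (hF E (star_subset hE)) (Nat.mod_lt _ hR) (mem_star.1 hE).2.2, mem_sdiff]
      exact ⟨hx, fun hx' => hH ⟨x, hx', hT⟩⟩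

variable (B k θ) in
/-- One branching step along the path that the binary digits of `w` describe. -/
def stepW (w : ℕ) (p : Finset ℕ × ℕ) : Finset ℕ × ℕ :=
  match pick B k θ p.1 with
  | none => p
  | some z => if w / (p.2 / 2) % 2 = 1 then (petalStep B k p.1 z, p.2 / 2)
    else (heartStep B k p.1 z, p.2 / 2)

variable (B k θ) in
/-- The leaf that the path `w` leads to, and the weight of that leaf. -/
def replay (F₀ : Finset ℕ) (w : ℕ) : Finset ℕ × ℕ := (stepW B k θ w)^[B ^ k] (F₀, 2 ^ B ^ k)

variable (B k θ) in
/-- The path to the next leaf. -/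
def nextPath (F₀ : Finset ℕ) (w : ℕ) : ℕ := w + (replay B k θ F₀ w).2

/-- A node with remaining depth `f` owns the interval `[w, w + 2 ^ f)` of paths, all of which lead
to it (`hreach`). The heart branch inherits the lower half of the interval and the petal branch the
upper half; a leaf has the length of its interval as weight, so the odometer leaves the interval in
one jump. The budget `hcard` excludes `f = 0`, because a family has at most `B ^ k` members and
every branching adds one. -/
theorem orbit_aux (hB : 0 < B) (hθ : ∀ j, 1 ≤ θ j) (F₀ : Finset ℕ) (f : ℕ) (F : Finset ℕ)
    (w : ℕ) (hf : f ≤ B ^ k) (hF : ∀ C ∈ F, C < B ^ k) (hcard : B ^ k + 1 ≤ F.card + f)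
    (hw : 2 ^ f ∣ w) (hreach : ∀ w', w ≤ w' → w' < w + 2 ^ f →
      (stepW B k θ w')^[B ^ k - f] (F₀, 2 ^ B ^ k) = (F, 2 ^ f)) :
    (nextPath B k θ F₀)^[leaves B k θ f F] w = w + 2 ^ f ∧
    (∀ j < leaves B k θ f F, (nextPath B k θ F₀)^[j] w < w + 2 ^ f ∧
      w ≤ (nextPath B k θ F₀)^[j] w ∧
      pick B k θ (replay B k θ F₀ ((nextPath B k θ F₀)^[j] w)).1 = none ∧
      (∀ C ∈ (replay B k θ F₀ ((nextPath B k θ F₀)^[j] w)).1, C < B ^ k) ∧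
      F ⊆ (replay B k θ F₀ ((nextPath B k θ F₀)^[j] w)).1) ∧
    (∀ T, SatIds B k T F → ∃ j < leaves B k θ f F,
      SatIds B k T (replay B k θ F₀ ((nextPath B k θ F₀)^[j] w)).1) := by
  induction f generalizing F w with
  | zero =>
    exfalso
    have : F.card ≤ B ^ k := by
      have h1 : F ⊆ range (B ^ k) := fun C hC => mem_range.2 (hF C hC)
      simpa using card_le_card h1
    omega
  | succ f ih =>
    cases hz : pick B k θ F with
    | none =>
      have hrep : replay B k θ F₀ w = (F, 2 ^ (f + 1)) := by
        rw [replay]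
        have h1 : B ^ k = (f + 1) + (B ^ k - (f + 1)) := by omega
        -- The steps that remain after a leaf has been reached do nothing.
        have h2 : ∀ n, (stepW B k θ w)^[n] (F, 2 ^ (f + 1)) = (F, 2 ^ (f + 1)) := by
          intro n
          refine Function.iterate_fixed ?_ n
          simp [stepW, hz]
        conv_lhs => arg 2; rw [h1]
        rw [Function.iterate_add_apply, hreach w le_rfl (by simp), h2]
      have hl : leaves B k θ (f + 1) F = 1 := by simp [leaves, hz]
      rw [hl]
      refine ⟨by simp [nextPath, hrep], ?_, ?_⟩
      · intro j hj
        obtain rfl : j = 0 := by omega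
        simp only [Function.iterate_zero, id_eq, hrep]
        exact ⟨by simp, le_rfl, hz, hF, subset_rfl⟩
      · intro T hT
        exact ⟨0, by omega, by simpa [hrep] using hT⟩
    | some z =>
      have hl : leaves B k θ (f + 1) F =
          leaves B k θ f (heartStep B k F z) + leaves B k θ f (petalStep B k F z) := by
        simp [leaves, hz]
      have hp2 : (2 : ℕ) ^ (f + 1) = 2 ^ f + 2 ^ f := by rw [pow_succ]; ring
      have hpos : 0 < 2 ^ f := by positivity
      obtain ⟨v, rfl⟩ := hw
      -- The binary digit at position `f` separates the two halves of the interval.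
      have hb0 : ∀ w', 2 ^ (f + 1) * v ≤ w' → w' < 2 ^ (f + 1) * v + 2 ^ f →
          w' / 2 ^ f % 2 = 0 := by
        intro w' h1 h2
        have : w' / 2 ^ f = 2 * v := by
          refine Nat.div_eq_of_lt_le ?_ ?_
          · rw [pow_succ] at h1; linarith
          · rw [pow_succ] at h2; linarith
        omega
      have hb1 : ∀ w', 2 ^ (f + 1) * v + 2 ^ f ≤ w' → w' < 2 ^ (f + 1) * v + 2 ^ f + 2 ^ f →
          w' / 2 ^ f % 2 = 1 := by
        intro w' h1 h2
        have : w' / 2 ^ f = 2 * v + 1 := by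
          refine Nat.div_eq_of_lt_le ?_ ?_
          · rw [pow_succ] at h1; linarith
          · rw [pow_succ] at h2; linarith
        omega
      have hstep : B ^ k - f = (B ^ k - (f + 1)) + 1 := by omega
      have hhalf : 2 ^ (f + 1) / 2 = 2 ^ f := by omega
      obtain ⟨a1, a2, a3⟩ := ih (heartStep B k F z) (2 ^ (f + 1) * v) (by omega)
        (heartStep_lt hB hF z)
        (by have := card_lt_heartStep hB hF hθ hz; omega)
        (Dvd.dvd.mul_right (pow_dvd_pow 2 (by omega)) v)
        (by
          intro w' h1 h2
          rw [hstep, Function.iterate_succ_apply', hreach w' h1 (by omega)]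
          simp [stepW, hz, hhalf, hb0 w' h1 h2])
      obtain ⟨b1, b2, b3⟩ := ih (petalStep B k F z) (2 ^ (f + 1) * v + 2 ^ f) (by omega)
        (petalStep_lt hF z)
        (by have := card_lt_petalStep hB hF hθ hz; omega)
        (Dvd.dvd.add (Dvd.dvd.mul_right (pow_dvd_pow 2 (by omega)) v) dvd_rfl)
        (by
          intro w' h1 h2
          rw [hstep, Function.iterate_succ_apply', hreach w' (by omega) (by omega)]
          simp [stepW, hz, hhalf, hb1 w' h1 h2])
      set lh := leaves B k θ f (heartStep B k F z)
      set lp := leaves B k θ f (petalStep B k F z)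
      have hit : ∀ j, (nextPath B k θ F₀)^[j + lh] (2 ^ (f + 1) * v) =
          (nextPath B k θ F₀)^[j] (2 ^ (f + 1) * v + 2 ^ f) := by
        intro j
        rw [Function.iterate_add_apply, a1]
      rw [hl]
      refine ⟨?_, ?_, ?_⟩
      · rw [add_comm lh, hit, b1]; omega
      · intro j hj
        by_cases hjl : j < lh
        · obtain ⟨c1, c2, c3, c4, c5⟩ := a2 j hjl
          exact ⟨by omega, c2, c3, c4, (subset_insert _ _).trans c5⟩
        · obtain ⟨c1, c2, c3, c4, c5⟩ := b2 (j - lh) (by omega)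
          rw [← hit, Nat.sub_add_cancel (by omega)] at c1 c2 c3 c4 c5
          exact ⟨by omega, by omega, c3, c4, subset_union_left.trans c5⟩
      · intro T hT
        rcases satIds_step hB hF hT z with h | h
        · obtain ⟨j, hj, hs⟩ := a3 T h
          exact ⟨j, by omega, hs⟩
        · obtain ⟨j, hj, hs⟩ := b3 T h
          refine ⟨j + lh, by omega, ?_⟩
          rwa [hit]

/-- The odometer visits all leaves of the branching tree. -/
theorem orbit (hB : 0 < B) (hθ : ∀ j, 1 ≤ θ j) {F₀ : Finset ℕ} (hF : ∀ C ∈ F₀, C < B ^ k)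
    (hne : F₀.Nonempty) :
    (nextPath B k θ F₀)^[leaves B k θ (B ^ k) F₀] 0 = 2 ^ B ^ k ∧
    (∀ j < leaves B k θ (B ^ k) F₀, (nextPath B k θ F₀)^[j] 0 < 2 ^ B ^ k ∧
      pick B k θ (replay B k θ F₀ ((nextPath B k θ F₀)^[j] 0)).1 = none ∧
      (∀ C ∈ (replay B k θ F₀ ((nextPath B k θ F₀)^[j] 0)).1, C < B ^ k) ∧
      F₀ ⊆ (replay B k θ F₀ ((nextPath B k θ F₀)^[j] 0)).1) ∧
    (∀ T, SatIds B k T F₀ → ∃ j < leaves B k θ (B ^ k) F₀,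
      SatIds B k T (replay B k θ F₀ ((nextPath B k θ F₀)^[j] 0)).1) := by
  obtain ⟨h1, h2, h3⟩ := orbit_aux (k := k) hB hθ F₀ (B ^ k) F₀ 0 le_rfl hF
    (by have := card_pos.2 hne; omega) (dvd_zero _) (by intro w' _ _; simp)
  refine ⟨by simpa using h1, fun j hj => ?_, h3⟩
  obtain ⟨c1, -, c3⟩ := h2 j hj
  exact ⟨by simpa using c1, c3⟩

end Tree


/-! ### Choice of the thresholds and the number of leaves -/

/-- The sunflower thresholds. -/
def threshold (M D j : ℕ) : ℕ := if j = 0 then 1 else M * D ^ (2 * j - 1)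

/-- The bound on the number of clauses of size `j` that are added, relative to the number of
literals. -/
def growth (D j : ℕ) : ℕ := if j = 0 then 0 else D ^ (2 * j - 1)

theorem one_le_threshold {M D : ℕ} (hM : 1 ≤ M) (hD : 1 ≤ D) (j : ℕ) : 1 ≤ threshold M D j := by
  rw [threshold]
  split_ifs
  · exact le_rfl
  · exact Nat.mul_pos hM (Nat.pow_pos hD)

/-- The exponents are chosen so that `θ (j - i) * β i = M * D ^ (2 * j - 2)` whenever `1 ≤ i < j`.
The left side then consists of `j` contributions of at most `2 * M * D ^ (2 * j - 2)` each, and `2 *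
M * j ≤ D`. -/
theorem growth_rec {M D k : ℕ} (hM : 1 ≤ M) (hD : D = 2 * M * k) (j : ℕ) (hj : 1 ≤ j)
    (hjk : j ≤ k) : 2 * threshold M D (j - 1) +
      ∑ i ∈ range j, 2 * threshold M D (j - i) * growth D i ≤ growth D j := by
  have hD1 : 1 ≤ D := by
    rw [hD]
    have : 1 ≤ k := hj.trans hjk
    have := Nat.mul_pos hM this
    linarith [mul_assoc 2 M k]
  obtain ⟨m, rfl⟩ : ∃ m, j = m + 1 := ⟨j - 1, by omega⟩
  have h1 : threshold M D m ≤ M * D ^ (2 * m) := by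
    rw [threshold]
    split_ifs
    · exact Nat.mul_pos hM (Nat.pow_pos hD1)
    · exact Nat.mul_le_mul_left _ (Nat.pow_le_pow_right hD1 (by omega))
  have h2 : ∀ i ∈ range m, 2 * threshold M D (m + 1 - (i + 1)) * growth D (i + 1) ≤
      2 * (M * D ^ (2 * m)) := by
    intro i hi
    rw [mem_range] at hi
    rw [threshold, growth, if_neg (by omega), if_neg (by omega)]
    rw [mul_assoc, mul_assoc M, ← pow_add]
    gcongr
    omega
  rw [sum_range_succ']
  have h3 := sum_le_card_nsmul _ _ _ h2
  rw [card_range, smul_eq_mul] at h3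
  have h4 : growth D 0 = 0 := rfl
  rw [h4, mul_zero, add_zero, growth, if_neg (by omega), Nat.add_sub_cancel]
  calc _ ≤ 2 * (M * D ^ (2 * m)) + m * (2 * (M * D ^ (2 * m))) :=
        add_le_add (Nat.mul_le_mul_left _ h1) h3
    _ = (2 * M * (m + 1)) * D ^ (2 * m) := by ring
    _ ≤ D * D ^ (2 * m) := by
        refine Nat.mul_le_mul_right _ ?_
        rw [hD]
        exact Nat.mul_le_mul_left _ hjk
    _ = _ := by
        rw [← pow_succ']
        congr 1

/-- The potential that bounds the number of leaves. -/
noncomputable def potential (θ β : ℕ → ℕ) (k : ℕ) (u y z : ℝ) (a : ℕ → ℕ) : ℝ :=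
  ∑ j ∈ range (k + 1), (β j * u - a j) * (y + z / θ j)

theorem potential_update {θ β : ℕ → ℕ} {k : ℕ} {u y z : ℝ} {a : ℕ → ℕ} {i : ℕ} (hi : i ≤ k)
    (s : ℕ) : potential θ β k u y z (Function.update a i (a i + s)) =
      potential θ β k u y z a - s * (y + z / θ i) := by
  have h : ∀ j ∈ range (k + 1), (β j * u - (Function.update a i (a i + s) j : ℕ)) *
      (y + z / θ j) = (β j * u - a j) * (y + z / θ j) - if j = i then s * (y + z / θ i) else 0 := by
    intro j _
    by_cases hj : j = i
    · subst hj
      simp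
      ring
    · simp [hj]
  rw [potential, potential, sum_congr rfl h, sum_sub_distrib]
  simp [Nat.lt_succ_of_le hi]

/-- Induction along the tree. The heart branch adds one clause and lowers the potential by at least
`y`; the petal branch adds at least `θ i` clauses of size `i`, each worth at least `z / θ i`, and
lowers it by at least `z`. The condition on `y` and `z` closes the recursion, and at a leaf the
potential is nonnegative because `a j ≤ β j * u`. -/
theorem leaves_le_exp {B k : ℕ} {θ β : ℕ → ℕ} (hB : 0 < B) (hθ : ∀ j, 1 ≤ θ j)
    (hβ : ∀ j, 1 ≤ j → j ≤ k → 2 * θ (j - 1) + ∑ i ∈ range j, 2 * θ (j - i) * β i ≤ β j)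
    {y z : ℝ} (hy : 0 ≤ y) (hz : 0 ≤ z) (hyz : Real.exp (-y) + Real.exp (-z) ≤ 1) (f : ℕ)
    (F : Finset ℕ) (a : ℕ → ℕ) (hF : ∀ C ∈ F, C < B ^ k) (ha : Inv θ (F.image (dec B k)) a) :
    (leaves B k θ f F : ℝ) ≤
      Real.exp (potential θ β k ((k * (B - 1) : ℕ) : ℝ) y z a) := by
  have nonneg : ∀ (G : Finset ℕ) (b : ℕ → ℕ), Inv θ (G.image (dec B k)) b →
      0 ≤ potential θ β k ((k * (B - 1) : ℕ) : ℝ) y z b := by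
    intro G b hb
    refine sum_nonneg fun j hj => mul_nonneg ?_ (by positivity)
    rw [mem_range] at hj
    have := hb.le_of_rec hθ (U := range k ×ˢ Ico 1 B) (k := k) (β := β)
      (by
        intro C hC
        obtain ⟨E, -, rfl⟩ := mem_image.1 hC
        exact dec_subset_univ hB E) hβ (j := j) (by omega)
    rw [card_product, card_range, Nat.card_Ico] at this
    rw [sub_nonneg]
    exact_mod_cast this
  induction f generalizing F a with
  | zero => simpa [leaves] using nonneg F a ha
  | succ f ih =>
    cases hp : pick B k θ F with
    | none => simpa [leaves, hp] using nonneg F a ha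
    | some x =>
      have hl : leaves B k θ (f + 1) F =
          leaves B k θ f (heartStep B k F x) + leaves B k θ f (petalStep B k F x) := by
        simp [leaves, hp]
      obtain ⟨hc, hpick⟩ := isPick_of_pick hB hF hθ hp
      have hsize := hpick.card
      have i1 : Inv θ ((heartStep B k F x).image (dec B k))
          (Function.update a (dec B k (x % B ^ k)).card (a (dec B k (x % B ^ k)).card + 1)) := by
        rw [image_heartStep]
        exact ha.heart hpick hθ
      have i2 : Inv θ ((petalStep B k F x).image (dec B k))
          (Function.update a (x / B ^ k % (k + 1)) (a (x / B ^ k % (k + 1)) +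
            (link (F.image (dec B k)) (x / B ^ k / (k + 1)) (dec B k (x % B ^ k))).card)) := by
        rw [image_petalStep hB hF]
        exact ha.petals hpick
      have h1 := ih (heartStep B k F x) _ (heartStep_lt hB hF x) i1
      have h2 := ih (petalStep B k F x) _ (petalStep_lt hF x) i2
      rw [potential_update (by omega)] at h1
      rw [potential_update (by omega)] at h2
      rw [hl, Nat.cast_add]
      set Φ := potential θ β k ((k * (B - 1) : ℕ) : ℝ) y z a
      have hθpos : ∀ j, (0 : ℝ) < θ j := fun j => by exact_mod_cast hθ j
      have h3 : (leaves B k θ f (heartStep B k F x) : ℝ) ≤ Real.exp Φ * Real.exp (-y) := by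
        rw [← Real.exp_add]
        refine h1.trans (Real.exp_le_exp.2 ?_)
        have : 0 ≤ z / θ ((dec B k (x % B ^ k)).card) := by positivity
        push_cast
        linarith
      have h4 : (leaves B k θ f (petalStep B k F x) : ℝ) ≤ Real.exp Φ * Real.exp (-z) := by
        rw [← Real.exp_add]
        refine h2.trans (Real.exp_le_exp.2 ?_)
        have h5 : (θ (x / B ^ k % (k + 1)) : ℝ) ≤
            ((link (image (dec B k) F) (x / B ^ k / (k + 1)) (dec B k (x % B ^ k))).card : ℕ) := by
          exact_mod_cast hpick.le
        have h6 : z ≤ ((link (image (dec B k) F) (x / B ^ k / (k + 1))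
            (dec B k (x % B ^ k))).card : ℕ) * (y + z / θ (x / B ^ k % (k + 1))) := by
          calc z = θ (x / B ^ k % (k + 1)) * (z / θ (x / B ^ k % (k + 1))) := by
                field_simp [(hθpos (x / B ^ k % (k + 1))).ne']
            _ ≤ _ := by
                refine mul_le_mul h5 (by linarith) (by positivity) (by positivity)
        linarith
      calc _ ≤ Real.exp Φ * Real.exp (-y) + Real.exp Φ * Real.exp (-z) := add_le_add h3 h4
        _ = Real.exp Φ * (Real.exp (-y) + Real.exp (-z)) := by ring
        _ ≤ Real.exp Φ * 1 := mul_le_mul_of_nonneg_left hyz (Real.exp_pos _).le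
        _ = _ := mul_one _

/-- On this interval `(1 - x) * (1 + 2 * x) ≥ 1`, and `1 + 2 * x ≤ exp (2 * x)`. -/
theorem exp_neg_two_mul_le {x : ℝ} (h0 : 0 ≤ x) (h1 : x ≤ 1 / 2) : Real.exp (-(2 * x)) ≤ 1 - x := by
  rw [Real.exp_neg, inv_le_comm₀ (Real.exp_pos _) (by linarith)]
  refine le_trans ?_ (Real.add_one_le_exp (2 * x))
  rw [inv_le_iff_one_le_mul₀ (by linarith)]
  nlinarith

-- For fixed `k` the left side is of order `log M / M`. It is the rate at which the potential of the
-- root grows with the number of literals.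
open Filter in
theorem exists_log_le (k : ℕ) (hk : 1 ≤ k) {η : ℝ} (hη : 0 < η) : ∃ M : ℕ, 1 ≤ M ∧
    2 / (M : ℝ) + k * ((2 * k + 1) * Real.log (2 * k * M)) / M ≤ η := by
  have h1 : Tendsto (fun M : ℕ => Real.log M / M) atTop (nhds 0) :=
    (Real.isLittleO_log_id_atTop.tendsto_div_nhds_zero).comp tendsto_natCast_atTop_atTop
  have h2 : Tendsto (fun M : ℕ => 1 / (M : ℝ)) atTop (nhds 0) := tendsto_one_div_atTop_nhds_zero_nat
  have h3 : Tendsto (fun M : ℕ => (2 + k * (2 * k + 1) * Real.log (2 * k)) * (1 / (M : ℝ)) +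
      k * (2 * k + 1) * (Real.log M / M)) atTop (nhds 0) := by
    have := (h2.const_mul (2 + k * (2 * k + 1) * Real.log (2 * k))).add
      (h1.const_mul ((k : ℝ) * (2 * k + 1)))
    simpa using this
  obtain ⟨M, hM1, hM2⟩ := ((h3.eventually (eventually_le_nhds hη)).and (eventually_ge_atTop 1)).exists
  refine ⟨M, hM2, le_trans (le_of_eq ?_) hM1⟩
  have hM0 : (M : ℝ) ≠ 0 := by positivity
  rw [Real.log_mul (by positivity) hM0]
  field_simp
  ring

/-- There are thresholds for which the branching tree has few leaves. -/
theorem exists_thresholds (k : ℕ) (hk : 1 ≤ k) {η : ℝ} (hη : 0 < η) : ∃ θ : ℕ → ℕ,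
    (∀ j, 1 ≤ θ j) ∧ ∀ (B f : ℕ) (F : Finset ℕ), 0 < B → (∀ C ∈ F, C < B ^ k) →
      (leaves B k θ f F : ℝ) ≤ Real.exp (η * ((k * (B - 1) : ℕ) : ℝ)) := by
  obtain ⟨M, hM, hle⟩ := exists_log_le k hk hη
  set D := 2 * M * k with hD
  have hMk : 1 ≤ M * k := Nat.mul_pos hM hk
  have hD2 : 2 ≤ D := by rw [hD, mul_assoc]; omega
  have hθ := one_le_threshold (M := M) (D := D) hM (by omega)
  refine ⟨threshold M D, hθ, fun B f F hB hF => ?_⟩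
  set S := ∑ j ∈ range (k + 1), growth D j with hS
  have hS2 : 2 ≤ S := by
    have : growth D 1 ≤ S := single_le_sum (f := growth D) (fun _ _ => Nat.zero_le _)
      (mem_range.2 (by omega))
    have h1 : growth D 1 = D := by simp [growth]
    omega
  have hSle : S ≤ k * D ^ (2 * k - 1) := by
    rw [hS, sum_range_succ']
    have : ∀ j ∈ range k, growth D (j + 1) ≤ D ^ (2 * k - 1) := by
      intro j hj
      rw [mem_range] at hj
      rw [growth, if_neg (by omega)]
      exact Nat.pow_le_pow_right (by omega) (by omega)
    have h1 := sum_le_card_nsmul _ _ _ this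
    simpa [growth] using h1
  have hE : M * S ≤ D ^ (2 * k + 1) := by
    calc M * S ≤ M * (k * D ^ (2 * k - 1)) := Nat.mul_le_mul_left _ hSle
      _ = M * k * D ^ (2 * k - 1) := by ring
      _ ≤ D * D ^ (2 * k - 1) := Nat.mul_le_mul_right _ (by rw [hD, mul_assoc]; omega)
      _ = D ^ (2 * k) := by rw [← pow_succ']; congr 1; omega
      _ ≤ _ := Nat.pow_le_pow_right (by omega) (by omega)
  have hMS : 2 ≤ M * S := le_trans hS2 (Nat.le_mul_of_pos_left _ hM)
  have hMSr : (2 : ℝ) ≤ (M * S : ℕ) := by exact_mod_cast hMS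
  -- With `y = 2 / (M * S)` and this `z`, the two exponentials are at most `1 - 1 / (M * S)` and
  -- equal to `1 / (M * S)`. The former needs `M * S ≥ 2`.
  set z := Real.log (M * S : ℕ) with hzdef
  have hz0 : 0 ≤ z := Real.log_nonneg (by linarith)
  have hz1 : z ≤ (2 * k + 1) * Real.log (2 * k * M) := by
    have h1 : z ≤ Real.log ((D ^ (2 * k + 1) : ℕ) : ℝ) :=
      Real.log_le_log (by linarith) (by exact_mod_cast hE)
    rw [Nat.cast_pow, Real.log_pow] at h1
    refine h1.trans (le_of_eq ?_)
    rw [hD]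
    push_cast
    congr 2
    ring
  have hexp : Real.exp (-z) = 1 / (M * S : ℕ) := by
    rw [Real.exp_neg, hzdef, Real.exp_log (by linarith), one_div]
  have hhalf : 1 / ((M * S : ℕ) : ℝ) ≤ 1 / 2 := one_div_le_one_div_of_le (by norm_num) hMSr
  have hyz : Real.exp (-(2 * (1 / ((M * S : ℕ) : ℝ)))) + Real.exp (-z) ≤ 1 := by
    have := exp_neg_two_mul_le (x := 1 / ((M * S : ℕ) : ℝ)) (by positivity) hhalf
    rw [hexp]
    linarith
  have h := leaves_le_exp (k := k) (β := growth D) hB hθ (fun j hj hjk => growth_rec hM hD j hj hjk)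
    (y := 2 * (1 / ((M * S : ℕ) : ℝ))) (by positivity) hz0 hyz f F 0 hF (Inv.init _ _)
  refine h.trans (Real.exp_le_exp.2 ?_)
  set u : ℝ := ((k * (B - 1) : ℕ) : ℝ) with hu
  have hu0 : 0 ≤ u := by positivity
  have hMr : (0 : ℝ) < M := by exact_mod_cast hM
  have hSr : (0 : ℝ) < S := by exact_mod_cast (by omega : 0 < S)
  -- Since `θ j = M * β j` for `j ≥ 1`, the part of the potential that belongs to `z` is the same
  -- for all sizes, and the whole is `(2 / M + k * z / M) * u`.
  have hterm : ∀ j ∈ range k, ((growth D (j + 1) : ℕ) * u - ((0 : ℕ → ℕ) (j + 1) : ℕ)) *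
      (2 * (1 / ((M * S : ℕ) : ℝ)) + z / (threshold M D (j + 1) : ℕ)) =
      (growth D (j + 1) : ℕ) * (u * (2 * (1 / ((M * S : ℕ) : ℝ)))) + u * z / M := by
    intro j _
    have h1 : ((threshold M D (j + 1) : ℕ) : ℝ) = M * (growth D (j + 1) : ℕ) := by
      rw [threshold, growth, if_neg (by omega), if_neg (by omega)]
      push_cast
      ring
    have h2 : (0 : ℝ) < (growth D (j + 1) : ℕ) := by
      rw [growth, if_neg (by omega)]
      exact_mod_cast Nat.pow_pos (by omega)
    rw [h1]
    simp only [Pi.zero_apply, Nat.cast_zero, sub_zero]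
    field_simp
  rw [potential, sum_range_succ', sum_congr rfl hterm, sum_add_distrib, ← sum_mul]
  have hg0 : growth D 0 = 0 := rfl
  have hSum : (∑ j ∈ range k, ((growth D (j + 1) : ℕ) : ℝ)) = S := by
    rw [hS, sum_range_succ', hg0]
    push_cast
    simp
  rw [hSum, hg0, sum_const, card_range, nsmul_eq_mul]
  simp only [Nat.cast_zero, zero_mul, Pi.zero_apply, sub_zero, add_zero]
  calc (S : ℝ) * (u * (2 * (1 / ((M * S : ℕ) : ℝ)))) + k * (u * z / M)
      = (2 / M + k * z / M) * u := by
        push_cast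
        field_simp
    _ ≤ η * u := by
        refine mul_le_mul_of_nonneg_right (le_trans ?_ hle) hu0
        gcongr


/-! ### Bounds for the values and costs of expressions -/

section States

/-- Write a register. -/
def State.set (s : State) (r v : ℕ) : State := ⟨Function.update s.reg r v, s.mem⟩

/-- Write a memory cell. -/
def State.put (s : State) (a v : ℕ) : State := ⟨s.reg, Function.update s.mem a v⟩

@[simp] theorem State.set_mem (s : State) (r v : ℕ) : (s.set r v).mem = s.mem := rfl

@[simp] theorem State.put_reg (s : State) (a v : ℕ) : (s.put a v).reg = s.reg := rfl

theorem State.set_reg (s : State) (r v x : ℕ) :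
    (s.set r v).reg x = if x = r then v else s.reg x := by
  simp [State.set, Function.update_apply]

theorem State.put_mem (s : State) (a v x : ℕ) :
    (s.put a v).mem x = if x = a then v else s.mem x := by
  simp [State.put, Function.update_apply]

end States

section Terms

theorem size_add_le (a b : ℕ) : Nat.size (a + b) ≤ Nat.size a + Nat.size b + 1 := by
  rw [Nat.size_le]
  have h1 := Nat.lt_size_self a
  have h2 := Nat.lt_size_self b
  have h3 : 2 ^ a.size ≤ 2 ^ (a.size + b.size) := Nat.pow_le_pow_right (by omega) (by omega)
  have h4 : 2 ^ b.size ≤ 2 ^ (a.size + b.size) := Nat.pow_le_pow_right (by omega) (by omega)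
  rw [pow_succ]
  omega

theorem size_mul_le (a b : ℕ) : Nat.size (a * b) ≤ Nat.size a + Nat.size b := by
  rw [Nat.size_le, pow_add]
  exact Nat.mul_lt_mul'' (Nat.lt_size_self a) (Nat.lt_size_self b)

/-- A size of expressions. -/
def Term.weight : Term → ℕ
  | .lit c => 1 + Nat.size c
  | .reg _ => 1
  | .load e => e.weight + 2
  | .add a b => a.weight + b.weight + 1
  | .sub a b => a.weight + b.weight + 1
  | .mul a b => a.weight + b.weight + 1
  | .div a b => a.weight + b.weight + 1

/-- The expression reads only registers below `40` and memory cells in `D`. -/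
def Term.Ok (D : Set ℕ) : Term → Prop
  | .lit _ => True
  | .reg r => r < 40
  | .load e => e.Ok D ∧ ∀ s, e.val s ∈ D
  | .add a b => a.Ok D ∧ b.Ok D
  | .sub a b => a.Ok D ∧ b.Ok D
  | .mul a b => a.Ok D ∧ b.Ok D
  | .div a b => a.Ok D ∧ b.Ok D

/-- The value is bounded by the numbers in the state. -/
def Term.Tame : Term → Prop
  | .lit c => c ≤ 3
  | .reg _ => True
  | .load _ => True
  | .add _ _ => False
  | .sub a _ => a.Tame
  | .mul _ _ => False
  | .div a _ => a.Tame

/-- The registers below `40` and the memory cells in `D` are at most `V`. -/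
structure Bdd (D : Set ℕ) (V : ℕ) (s : State) : Prop where
  reg : ∀ r < 40, s.reg r ≤ V
  mem : ∀ a ∈ D, s.mem a ≤ V

variable {D : Set ℕ} {V : ℕ} {s : State}

theorem Bdd.set (h : Bdd D V s) {r v : ℕ} (hv : v ≤ V) : Bdd D V (s.set r v) := by
  refine ⟨fun x hx => ?_, h.mem⟩
  rw [State.set_reg]
  split_ifs
  · exact hv
  · exact h.reg x hx

theorem Bdd.put (h : Bdd D V s) {a v : ℕ} (hv : v ≤ V) : Bdd D V (s.put a v) := by
  refine ⟨h.reg, fun x hx => ?_⟩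
  rw [State.put_mem]
  split_ifs
  · exact hv
  · exact h.mem x hx

/-- A syntactic guarantee: boundedness of all written values can be read off the program, without
knowing what it computes. The literals are at most `3`, whence `3 ≤ V`. -/
theorem Term.Tame.val_le {e : Term} (he : e.Tame) (hok : e.Ok D) (h : Bdd D V s) (hV : 3 ≤ V) :
    e.val s ≤ V := by
  induction e with
  | lit c => exact le_trans he hV
  | reg r => exact h.reg r hok
  | load e => exact h.mem _ (hok.2 s)
  | add => exact he.elim
  | mul => exact he.elim
  | sub a b iha => exact (Nat.sub_le _ _).trans (iha he hok.1)
  | div a b iha => exact (Nat.div_le_self _ _).trans (iha he hok.1)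

/-- An operation at most adds the bit lengths of its operands, plus one. Lengths are thus linear in
the weight, and their sum over all subexpressions is quadratic: a fixed expression costs a constant
times `Nat.size V`. -/
theorem Term.size_and_cost_le {e : Term} (hok : e.Ok D) (h : Bdd D V s) (hV : 1 ≤ V) :
    Nat.size (e.val s) ≤ e.weight * Nat.size V ∧
      e.cost s ≤ 2 * e.weight ^ 2 * Nat.size V := by
  have hS : 1 ≤ Nat.size V := Nat.size_pos.2 hV
  set S := Nat.size V
  induction e with
  | lit c =>
    simp only [Term.val, Term.cost, Term.weight]
    constructor <;> nlinarith [Nat.zero_le (Nat.size c)]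
  | reg r =>
    have := Nat.size_le_size (h.reg r hok)
    simp only [Term.val, Term.cost, Term.weight]
    constructor <;> omega
  | load e ih =>
    obtain ⟨i1, i2⟩ := ih hok.1
    have := Nat.size_le_size (h.mem _ (hok.2 s))
    simp only [Term.val, Term.cost, Term.weight]
    constructor
    · nlinarith
    · nlinarith
  | add a b iha ihb =>
    obtain ⟨a1, a2⟩ := iha hok.1
    obtain ⟨b1, b2⟩ := ihb hok.2
    have h1 := size_add_le (a.val s) (b.val s)
    simp only [Term.val, Term.cost, Term.weight]
    have h2 : Nat.size (a.val s + b.val s) ≤ (a.weight + b.weight + 1) * S := by nlinarith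
    exact ⟨h2, by nlinarith [Nat.zero_le (a.weight * b.weight * S)]⟩
  | sub a b iha ihb =>
    obtain ⟨a1, a2⟩ := iha hok.1
    obtain ⟨b1, b2⟩ := ihb hok.2
    have h1 := Nat.size_le_size (Nat.sub_le (a.val s) (b.val s))
    simp only [Term.val, Term.cost, Term.weight]
    have h2 : Nat.size (a.val s - b.val s) ≤ (a.weight + b.weight + 1) * S := by nlinarith
    exact ⟨h2, by nlinarith [Nat.zero_le (a.weight * b.weight * S)]⟩
  | mul a b iha ihb =>
    obtain ⟨a1, a2⟩ := iha hok.1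
    obtain ⟨b1, b2⟩ := ihb hok.2
    have h1 := size_mul_le (a.val s) (b.val s)
    simp only [Term.val, Term.cost, Term.weight]
    have h2 : Nat.size (a.val s * b.val s) ≤ (a.weight + b.weight + 1) * S := by nlinarith
    exact ⟨h2, by nlinarith [Nat.zero_le (a.weight * b.weight * S)]⟩
  | div a b iha ihb =>
    obtain ⟨a1, a2⟩ := iha hok.1
    obtain ⟨b1, b2⟩ := ihb hok.2
    have h1 := Nat.size_le_size (Nat.div_le_self (a.val s) (b.val s))
    simp only [Term.val, Term.cost, Term.weight]
    have h2 : Nat.size (a.val s / b.val s) ≤ (a.weight + b.weight + 1) * S := by nlinarith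
    exact ⟨h2, by nlinarith [Nat.zero_le (a.weight * b.weight * S)]⟩

end Terms

/-! ### Counting loops and their running time -/

/-- Programs with counting loops.  The registers below `20` hold constants, in particular the
bounds of the loops, and the registers from `20` to `39` hold variables. -/
inductive LoopProg where
  | assign (r : ℕ) (e : Term)
  | store (addr e : Term)
  | seq (p q : LoopProg)
  | ite (b : Term) (p q : LoopProg)
  | loop (r b : ℕ) (p : LoopProg)

/-- The state of a counting loop with counter `r` after `i` rounds. -/
def forState (f : State → State) (r : ℕ) (s : State) : ℕ → State
  | 0 => s.set r 0
  | i + 1 => (f (forState f r s i)).set r (i + 1)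

/-- A loop invariant. -/
theorem forState_induction {f : State → State} {r : ℕ} {s : State} (I : ℕ → State → Prop) {n : ℕ}
    (h0 : I 0 (s.set r 0))
    (h1 : ∀ i < n, ∀ σ, σ.reg r = i → I i σ → I (i + 1) ((f σ).set r (i + 1))) :
    I n (forState f r s n) := by
  have : ∀ i ≤ n, (forState f r s i).reg r = i ∧ I i (forState f r s i) := by
    intro i
    induction i with
    | zero => exact fun _ => ⟨by simp [forState, State.set_reg], h0⟩
    | succ i ih =>
      intro hi
      obtain ⟨h2, h3⟩ := ih (by omega)
      exact ⟨by simp [forState, State.set_reg], h1 i (by omega) _ h2 h3⟩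
  exact (this n le_rfl).2

namespace LoopProg

/-- The final state. -/
def eval : LoopProg → State → State
  | .assign r e, s => s.set r (e.val s)
  | .store a e, s => s.put (a.val s) (e.val s)
  | .seq p q, s => q.eval (p.eval s)
  | .ite b p q, s => if b.val s ≠ 0 then p.eval s else q.eval s
  | .loop r b p, s => forState p.eval r s (s.reg b)

/-- The random access machine program. -/
def compile : LoopProg → Program
  | .assign r e => .assign r e
  | .store a e => .store a e
  | .seq p q => .seq p.compile q.compile
  | .ite b p q => .ite b p.compile q.compile
  | .loop r b p => .seq (.assign r (.lit 0)) (.while (.sub (.reg b) (.reg r))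
      (.seq p.compile (.assign r (.add (.reg r) (.lit 1)))))

/-- The program may write the register `x`. -/
def writes (x : ℕ) : LoopProg → Bool
  | .assign r _ => r == x
  | .store _ _ => false
  | .seq p q => p.writes x || q.writes x
  | .ite _ p q => p.writes x || q.writes x
  | .loop r _ p => r == x || p.writes x

/-- Constants are not written, loops are bounded by constants, and all expressions are fine. -/
def Ok (D : Set ℕ) : LoopProg → Prop
  | .assign r e => 20 ≤ r ∧ r < 40 ∧ e.Ok D
  | .store a e => a.Ok D ∧ e.Ok D
  | .seq p q => p.Ok D ∧ q.Ok D
  | .ite b p q => b.Ok D ∧ p.Ok D ∧ q.Ok D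
  | .loop r b p => 20 ≤ r ∧ r < 40 ∧ b < 20 ∧ p.writes r = false ∧ p.Ok D

/-- All values that are written are bounded by the numbers in the state. -/
def Tame : LoopProg → Prop
  | .assign _ e => e.Tame
  | .store _ e => e.Tame
  | .seq p q => p.Tame ∧ q.Tame
  | .ite _ p q => p.Tame ∧ q.Tame
  | .loop _ _ p => p.Tame

/-- All values that are written in a run from the state `s` are at most `V`. -/
def Safe (V : ℕ) : LoopProg → State → Prop
  | .assign _ e, s => e.val s ≤ V
  | .store _ e, s => e.val s ≤ V
  | .seq p q, s => p.Safe V s ∧ q.Safe V (p.eval s)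
  | .ite b p q, s => if b.val s ≠ 0 then p.Safe V s else q.Safe V s
  | .loop r b p, s => ∀ i < s.reg b, p.Safe V (forState p.eval r s i)

/-- The running time, up to the bit length of the numbers, for the constants `ρ`. -/
def time (ρ : ℕ → ℕ) : LoopProg → ℕ
  | .assign _ e => 1 + 2 * e.weight ^ 2
  | .store a e => 1 + 2 * a.weight ^ 2 + 2 * e.weight ^ 2
  | .seq p q => p.time ρ + q.time ρ
  | .ite b p q => 1 + 2 * b.weight ^ 2 + p.time ρ + q.time ρ
  | .loop _ b p => ρ b * (p.time ρ + 100) + 100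

theorem eval_reg {p : LoopProg} {x : ℕ} (h : p.writes x = false) (s : State) :
    (p.eval s).reg x = s.reg x := by
  induction p generalizing s with
  | assign r e =>
    simp only [writes, beq_eq_false_iff_ne] at h
    simp [eval, State.set_reg, h.symm]
  | store a e => rfl
  | seq p q ihp ihq =>
    simp only [writes, Bool.or_eq_false_iff] at h
    simp only [eval]
    rw [ihq h.2, ihp h.1]
  | ite b p q ihp ihq =>
    simp only [writes, Bool.or_eq_false_iff] at h
    simp only [eval]
    split_ifs
    · exact ihp h.1 s
    · exact ihq h.2 s
  | loop r b p ih =>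
    simp only [writes, Bool.or_eq_false_iff, beq_eq_false_iff_ne] at h
    refine forState_induction (I := fun _ σ => σ.reg x = s.reg x) ?_ ?_
    · simp [State.set_reg, h.1.symm]
    · intro i _ σ _ hσ
      rw [State.set_reg, if_neg h.1.symm, ih h.2, hσ]

theorem writes_of_ok {D : Set ℕ} {p : LoopProg} (h : p.Ok D) {x : ℕ} (hx : x < 20 ∨ 40 ≤ x) :
    p.writes x = false := by
  induction p with
  | assign r e =>
    have := h.1
    have := h.2.1
    simp only [writes, beq_eq_false_iff_ne]
    omega
  | store a e => rfl
  | seq p q ihp ihq => simp [writes, ihp h.1, ihq h.2]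
  | ite b p q ihp ihq => simp [writes, ihp h.2.1, ihq h.2.2]
  | loop r b p ih =>
    have := h.1
    have := h.2.1
    simp only [writes, ih h.2.2.2.2, Bool.or_false, beq_eq_false_iff_ne]
    omega

variable {D : Set ℕ} {V : ℕ} {s : State}

theorem forState_bdd {f : State → State} {r : ℕ} (h : Bdd D V s) {n : ℕ} (hn : n ≤ V)
    (hf : ∀ i < n, Bdd D V (forState f r s i) → Bdd D V (f (forState f r s i))) :
    ∀ i ≤ n, Bdd D V (forState f r s i) := by
  intro i
  induction i with
  | zero => exact fun _ => h.set (Nat.zero_le _)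
  | succ i ih => exact fun hi => (hf i hi (ih (by omega))).set (by omega)

theorem forState_reg {f : State → State} {r : ℕ} (i : ℕ) : (forState f r s i).reg r = i := by
  cases i <;> simp [forState, State.set_reg]

theorem forState_reg_of_ne {p : LoopProg} {r x : ℕ} (hx : p.writes x = false) (hxr : x ≠ r)
    (i : ℕ) : (forState p.eval r s i).reg x = s.reg x := by
  induction i with
  | zero => simp [forState, State.set_reg, hxr]
  | succ i ih => rw [forState, State.set_reg, if_neg hxr, eval_reg hx, ih]

theorem Safe.bdd {p : LoopProg} (hok : p.Ok D) (h : Bdd D V s) (hs : p.Safe V s) :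
    Bdd D V (p.eval s) := by
  induction p generalizing s with
  | assign r e => exact h.set hs
  | store a e => exact h.put hs
  | seq p q ihp ihq => exact ihq hok.2 (ihp hok.1 h hs.1) hs.2
  | ite b p q ihp ihq =>
    simp only [Safe] at hs
    simp only [eval]
    split_ifs at hs ⊢
    · exact ihp hok.2.1 h hs
    · exact ihq hok.2.2 h hs
  | loop r b p ih =>
    have hb := hok.2.2.1
    exact forState_bdd h (h.reg b (by omega)) (fun i hi hb => ih hok.2.2.2.2 hb (hs i hi)) _ le_rfl

theorem Tame.safe {p : LoopProg} (ht : p.Tame) (hok : p.Ok D) (h : Bdd D V s) (hV : 3 ≤ V) :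
    p.Safe V s := by
  induction p generalizing s with
  | assign r e => exact Term.Tame.val_le ht hok.2.2 h hV
  | store a e => exact Term.Tame.val_le ht hok.2 h hV
  | seq p q ihp ihq =>
    have h1 := ihp ht.1 hok.1 h
    exact ⟨h1, ihq ht.2 hok.2 (h1.bdd hok.1 h)⟩
  | ite b p q ihp ihq =>
    simp only [Safe]
    split_ifs
    · exact ihp ht.1 hok.2.1 h
    · exact ihq ht.2 hok.2.2 h
  | loop r b p ih =>
    have hb := hok.2.2.1
    intro i hi
    exact ih ht hok.2.2.2.2 (forState_bdd h (h.reg b (by omega))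
      (fun i _ hb => (ih ht hok.2.2.2.2 hb).bdd hok.2.2.2.2 hb) i hi.le)

/-- The bound of a loop is a constant register and the body does not write the counter, so the
compiled while loop makes exactly `s.reg b` rounds and passes through the states `forState`. -/
theorem exec {p : LoopProg} (hok : p.Ok D) (h : Bdd D V s) (hV : 1 ≤ V) (hs : p.Safe V s)
    {ρ : ℕ → ℕ} (hρ : ∀ r < 20, s.reg r = ρ r) :
    ∃ t ≤ p.time ρ * Nat.size V, Exec p.compile s (p.eval s) t := by
  have hS : 1 ≤ Nat.size V := Nat.size_pos.2 hV
  set S := Nat.size V with hSdef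
  induction p generalizing s with
  | assign r e =>
    refine ⟨_, ?_, Exec.assign r e s⟩
    have := (Term.size_and_cost_le hok.2.2 h hV).2
    rw [← hSdef] at this
    simp only [time]
    nlinarith
  | store a e =>
    refine ⟨_, ?_, Exec.store a e s⟩
    have h1 := (Term.size_and_cost_le hok.1 h hV).2
    have h2 := (Term.size_and_cost_le hok.2 h hV).2
    rw [← hSdef] at h1 h2
    simp only [time]
    nlinarith
  | seq p q ihp ihq =>
    obtain ⟨t1, h1, e1⟩ := ihp hok.1 h hs.1 hρ
    obtain ⟨t2, h2, e2⟩ := ihq hok.2 (hs.1.bdd hok.1 h) hs.2 (fun r hr => by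
      rw [eval_reg (writes_of_ok hok.1 (Or.inl hr)), hρ r hr])
    refine ⟨_, ?_, Exec.seq e1 e2⟩
    simp only [time, add_mul]
    omega
  | ite b p q ihp ihq =>
    have h0 := (Term.size_and_cost_le hok.1 h hV).2
    rw [← hSdef] at h0
    simp only [Safe] at hs
    simp only [eval, time, add_mul]
    split_ifs at hs ⊢ with hb
    · obtain ⟨t1, h1, e1⟩ := ihp hok.2.1 h hs hρ
      exact ⟨_, by omega, Exec.ite_true hb e1⟩
    · obtain ⟨t1, h1, e1⟩ := ihq hok.2.2 h hs hρ
      exact ⟨_, by omega, Exec.ite_false (by simpa using hb) e1⟩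
  | loop r b p ih =>
    obtain ⟨hr1, hr2, hb, hwr, hokp⟩ := hok
    have hwb : p.writes b = false := writes_of_ok hokp (Or.inl hb)
    have hn : s.reg b ≤ V := h.reg b (by omega)
    have hbdd := forState_bdd (f := p.eval) (r := r) h hn
      (fun i hi hb => Safe.bdd hokp hb (hs i hi))
    have hregb : ∀ i, (forState p.eval r s i).reg b = s.reg b := fun i =>
      forState_reg_of_ne hwb (by omega) i
    -- The loop test has weight `3`, and `18 = 2 * 3 ^ 2`.
    have htest : ∀ i ≤ s.reg b,
        (Term.sub (.reg b) (.reg r)).cost (forState p.eval r s i) ≤ 18 * S := by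
      intro i hi
      have := (Term.size_and_cost_le (e := .sub (.reg b) (.reg r)) (D := D)
        ⟨(by omega : b < 40), hr2⟩ (hbdd i hi) hV).2
      rw [← hSdef] at this
      simpa [Term.weight] using this
    have hval : ∀ i, (Term.sub (.reg b) (.reg r)).val (forState p.eval r s i) = s.reg b - i := by
      intro i
      simp only [Term.val]
      rw [hregb, forState_reg]
    -- Here `m` rounds remain. The `100` per round pays for the test and for incrementing the
    -- counter, and `19 * S` for the last test, which fails.
    have hloop : ∀ m i, i + m = s.reg b → ∃ t ≤ m * ((p.time ρ + 100) * S) + 19 * S,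
        Exec (.while (.sub (.reg b) (.reg r)) (.seq p.compile
          (.assign r (.add (.reg r) (.lit 1))))) (forState p.eval r s i)
          (forState p.eval r s (s.reg b)) t := by
      intro m
      induction m with
      | zero =>
        intro i hi
        obtain rfl : i = s.reg b := by omega
        refine ⟨_, ?_, Exec.while_false (by rw [hval]; omega)⟩
        have := htest _ le_rfl
        omega
      | succ m ihm =>
        intro i hi
        obtain ⟨t1, h1, e1⟩ := ih hokp (hbdd i (by omega)) (hs i (by omega)) (fun x hx => by
          rw [forState_reg_of_ne (writes_of_ok hokp (Or.inl hx)) (by omega), hρ x hx])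
        have hb' := Safe.bdd hokp (hbdd i (by omega)) (hs i (by omega))
        have e2 := Exec.assign r (.add (.reg r) (.lit 1)) (p.eval (forState p.eval r s i))
        have h2 := (Term.size_and_cost_le (e := .add (.reg r) (.lit 1)) (D := D)
          ⟨hr2, trivial⟩ hb' hV).2
        rw [← hSdef] at h2
        simp only [Term.weight, Nat.size_one] at h2
        have e3 : (⟨Function.update (p.eval (forState p.eval r s i)).reg r
            ((Term.add (.reg r) (.lit 1)).val (p.eval (forState p.eval r s i))),
            (p.eval (forState p.eval r s i)).mem⟩ : State) = forState p.eval r s (i + 1) := by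
          have : (p.eval (forState p.eval r s i)).reg r = i := by
            rw [eval_reg hwr, forState_reg]
          simp only [Term.val, this]
          rfl
        rw [e3] at e2
        obtain ⟨t3, h3, e4⟩ := ihm (i + 1) (by omega)
        refine ⟨_, ?_, Exec.while_true (by rw [hval]; omega) (Exec.seq e1 e2) e4⟩
        have := htest i (by omega)
        rw [add_mul m, one_mul, add_mul (p.time ρ)]
        rw [add_mul (p.time ρ)] at h3
        omega
    obtain ⟨t, ht, e⟩ := hloop (s.reg b) 0 (by omega)
    refine ⟨_, ?_, Exec.seq (Exec.assign r (.lit 0) s) e⟩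
    simp only [time, Term.cost, Nat.size_zero]
    rw [← hρ b hb, add_mul, mul_assoc]
    omega

end LoopProg


/-! ### Simulation of a program in a part of the memory -/

section Relocation

/-- The address of the simulated memory cell with the address `e`. -/
def relocAddr (e : Term) : Term :=
  .add (.mul (.lit 2) (.add (.mul e (.reg 7)) (.reg 10))) (.lit 1)

/-- The expression, with registers shifted by `40` and memory relocated. -/
def Term.reloc : Term → Term
  | .lit c => .lit c
  | .reg r => .reg (r + 40)
  | .load e => .load (relocAddr e.reloc)
  | .add a b => .add a.reloc b.reloc
  | .sub a b => .sub a.reloc b.reloc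
  | .mul a b => .mul a.reloc b.reloc
  | .div a b => .div a.reloc b.reloc

/-- The program, with registers shifted by `40` and memory relocated. -/
def Program.reloc : Program → Program
  | .assign r e => .assign (r + 40) e.reloc
  | .store a e => .store (relocAddr a.reloc) e.reloc
  | .seq P Q => .seq P.reloc Q.reloc
  | .ite b P Q => .ite b.reloc P.reloc Q.reloc
  | .while b P => .while b.reloc P.reloc

/-- A bound for the registers that the program writes. -/
def Program.regBound : Program → ℕ
  | .assign r _ => r + 1
  | .store _ _ => 0
  | .seq P Q => max P.regBound Q.regBound
  | .ite _ P Q => max P.regBound Q.regBound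
  | .while _ P => P.regBound

/-- The state `σ` contains the state `s`, relocated with the constants `M` and `J`. -/
structure Sim (M J : ℕ) (s σ : State) : Prop where
  reg : ∀ r, σ.reg (r + 40) = s.reg r
  mem : ∀ a, σ.mem (2 * (a * M + J) + 1) = s.mem a
  factor : σ.reg 7 = M
  offset : σ.reg 10 = J

/-- The two states agree outside of the relocated part. -/
structure SameOutside (M J : ℕ) (σ σ' : State) : Prop where
  reg : ∀ r < 40, σ'.reg r = σ.reg r
  mem : ∀ b, (∀ a, b ≠ 2 * (a * M + J) + 1) → σ'.mem b = σ.mem b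

theorem SameOutside.trans {M J : ℕ} {σ₁ σ₂ σ₃ : State} (h : SameOutside M J σ₁ σ₂)
    (h' : SameOutside M J σ₂ σ₃) : SameOutside M J σ₁ σ₃ :=
  ⟨fun r hr => (h'.reg r hr).trans (h.reg r hr), fun b hb => (h'.mem b hb).trans (h.mem b hb)⟩

theorem SameOutside.refl (M J : ℕ) (σ : State) : SameOutside M J σ σ :=
  ⟨fun _ _ => rfl, fun _ _ => rfl⟩

variable {M J : ℕ} {s σ : State}

theorem relocAddr_val (e : Term) (h7 : σ.reg 7 = M) (h10 : σ.reg 10 = J) :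
    (relocAddr e).val σ = 2 * (e.val σ * M + J) + 1 := by
  simp [relocAddr, Term.val, h7, h10]

theorem relocAddr_cost_le (e : Term) (h7 : σ.reg 7 = M) (h10 : σ.reg 10 = J) :
    (relocAddr e).cost σ ≤
      e.cost σ + 30 * (Nat.size M + Nat.size J + 1) * (1 + Nat.size (e.val σ)) := by
  simp only [relocAddr, Term.val, Term.cost, h7, h10]
  have h1 := size_mul_le (e.val σ) M
  have h2 := size_add_le (e.val σ * M) J
  have h3 := size_mul_le 2 (e.val σ * M + J)
  have h4 := size_add_le (2 * (e.val σ * M + J)) 1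
  have h5 : Nat.size 2 = 2 := by decide
  have h6 : Nat.size 1 = 1 := by decide
  rw [h5] at h3 ⊢
  rw [h6] at h4 ⊢
  nlinarith [Nat.zero_le (Nat.size M * Nat.size (e.val σ)),
    Nat.zero_le (Nat.size J * Nat.size (e.val σ))]

theorem Sim.val (h : Sim M J s σ) (e : Term) : e.reloc.val σ = e.val s := by
  induction e with
  | lit c => rfl
  | reg r => exact h.reg r
  | load e ih =>
    simp only [Term.reloc, Term.val]
    rw [relocAddr_val _ h.factor h.offset, ih, h.mem]
  | add a b iha ihb => simp [Term.reloc, Term.val, iha, ihb]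
  | sub a b iha ihb => simp [Term.reloc, Term.val, iha, ihb]
  | mul a b iha ihb => simp [Term.reloc, Term.val, iha, ihb]
  | div a b iha ihb => simp [Term.reloc, Term.val, iha, ihb]

/-- The second summand on the left is a reserve that suffices to turn the value into a relocated
address. Carrying it through the induction lets `load` finance its address computation from the cost
of the inner expression, so the slowdown stays a factor. -/
theorem Sim.cost (h : Sim M J s σ) (e : Term) :
    e.reloc.cost σ + 30 * (Nat.size M + Nat.size J + 1) * (1 + Nat.size (e.val s)) ≤
      31 * (Nat.size M + Nat.size J + 1) * e.cost s := by
  have key : ∀ x W : ℕ, (1 + x) + 30 * (W + 1) * (1 + x) ≤ 31 * (W + 1) * (1 + x) := by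
    intro x W
    nlinarith [Nat.zero_le (W * x)]
  induction e with
  | lit c => exact key _ _
  | reg r =>
    simp only [Term.reloc, Term.cost, Term.val, h.reg]
    exact key _ _
  | load e ih =>
    have h1 := relocAddr_cost_le e.reloc h.factor h.offset
    have h2 := h.val (.load e)
    simp only [Term.reloc] at h2
    rw [h.val] at h1
    simp only [Term.reloc, Term.cost]
    rw [h2]
    have := key (Nat.size ((Term.load e).val s)) (Nat.size M + Nat.size J)
    nlinarith
  | add a b iha ihb =>
    have h2 := h.val (.add a b)
    simp only [Term.reloc] at h2
    simp only [Term.reloc, Term.cost]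
    rw [h2]
    have := key (Nat.size ((Term.add a b).val s)) (Nat.size M + Nat.size J)
    nlinarith
  | sub a b iha ihb =>
    have h2 := h.val (.sub a b)
    simp only [Term.reloc] at h2
    simp only [Term.reloc, Term.cost]
    rw [h2]
    have := key (Nat.size ((Term.sub a b).val s)) (Nat.size M + Nat.size J)
    nlinarith
  | mul a b iha ihb =>
    have h2 := h.val (.mul a b)
    simp only [Term.reloc] at h2
    simp only [Term.reloc, Term.cost]
    rw [h2]
    have := key (Nat.size ((Term.mul a b).val s)) (Nat.size M + Nat.size J)
    nlinarith
  | div a b iha ihb =>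
    have h2 := h.val (.div a b)
    simp only [Term.reloc] at h2
    simp only [Term.reloc, Term.cost]
    rw [h2]
    have := key (Nat.size ((Term.div a b).val s)) (Nat.size M + Nat.size J)
    nlinarith

theorem Sim.cost_le (h : Sim M J s σ) (e : Term) :
    e.reloc.cost σ ≤ 31 * (Nat.size M + Nat.size J + 1) * e.cost s :=
  (Nat.le_add_right _ _).trans (h.cost e)

/-- The relocated program simulates the program. -/
theorem exec_reloc (hM : 0 < M) {P : Program} {s' : State} {t : ℕ} (he : Exec P s s' t)
    (h : Sim M J s σ) : ∃ σ', ∃ t' ≤ 31 * (Nat.size M + Nat.size J + 1) * t,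
      Exec P.reloc σ σ' t' ∧ Sim M J s' σ' ∧ SameOutside M J σ σ' := by
  induction he generalizing σ with
  | assign r e s =>
    refine ⟨_, _, ?_, Exec.assign _ _ _, ⟨?_, h.mem, ?_, ?_⟩, ⟨?_, fun _ _ => rfl⟩⟩
    · have := h.cost_le e
      nlinarith [Nat.zero_le (Nat.size M), Nat.zero_le (Nat.size J)]
    · intro x
      simp only [h.val, Function.update_apply, add_left_inj, h.reg]
    · simp [Function.update_apply, h.factor]
    · simp [Function.update_apply, h.offset]
    · intro x hx
      simp only [Function.update_apply]
      rw [if_neg (by omega)]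
  | store a e s =>
    have ha : (relocAddr a.reloc).val σ = 2 * (a.val s * M + J) + 1 := by
      rw [relocAddr_val _ h.factor h.offset, h.val]
    refine ⟨_, _, ?_, Exec.store _ _ _, ⟨h.reg, ?_, h.factor, h.offset⟩, ⟨fun _ _ => rfl, ?_⟩⟩
    · have h1 := h.cost_le e
      have h2 := h.cost a
      have h3 := relocAddr_cost_le a.reloc h.factor h.offset
      rw [h.val] at h3
      nlinarith [Nat.zero_le (Nat.size M), Nat.zero_le (Nat.size J)]
    · intro x
      simp only [ha, h.val, Function.update_apply, h.mem]
      have : 2 * (x * M + J) + 1 = 2 * (a.val s * M + J) + 1 ↔ x = a.val s := by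
        constructor
        · intro hx
          have : x * M = a.val s * M := by omega
          exact Nat.eq_of_mul_eq_mul_right hM this
        · rintro rfl; rfl
      simp only [this]
    · intro b hb
      simp only [ha, Function.update_apply]
      rw [if_neg (hb _)]
  | seq _ _ ih1 ih2 =>
    obtain ⟨σ1, t1, h1, e1, s1, f1⟩ := ih1 h
    obtain ⟨σ2, t2, h2, e2, s2, f2⟩ := ih2 s1
    exact ⟨σ2, _, by rw [mul_add]; omega, Exec.seq e1 e2, s2, f1.trans f2⟩
  | @ite_true b _ _ _ _ _ hb _ ih =>
    obtain ⟨σ1, t1, h1, e1, s1, f1⟩ := ih h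
    refine ⟨σ1, _, ?_, Exec.ite_true (by rwa [h.val]) e1, s1, f1⟩
    have := h.cost_le b
    nlinarith [Nat.zero_le (Nat.size M), Nat.zero_le (Nat.size J)]
  | @ite_false b _ _ _ _ _ hb _ ih =>
    obtain ⟨σ1, t1, h1, e1, s1, f1⟩ := ih h
    refine ⟨σ1, _, ?_, Exec.ite_false (by rwa [h.val]) e1, s1, f1⟩
    have := h.cost_le b
    nlinarith [Nat.zero_le (Nat.size M), Nat.zero_le (Nat.size J)]
  | @while_true b _ _ _ _ _ _ hb _ _ ih1 ih2 =>
    obtain ⟨σ1, t1, h1, e1, s1, f1⟩ := ih1 h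
    obtain ⟨σ2, t2, h2, e2, s2, f2⟩ := ih2 s1
    refine ⟨σ2, _, ?_, Exec.while_true (by rwa [h.val]) e1 e2, s2, f1.trans f2⟩
    have := h.cost_le b
    nlinarith [Nat.zero_le (Nat.size M), Nat.zero_le (Nat.size J)]
  | @while_false b _ _ hb =>
    refine ⟨σ, _, ?_, Exec.while_false (by rwa [h.val]), h, SameOutside.refl _ _ _⟩
    have := h.cost_le b
    nlinarith [Nat.zero_le (Nat.size M), Nat.zero_le (Nat.size J)]

/-- Registers beyond the bound stay zero in every simulation; resetting finitely many registers
between two runs is enough. -/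
theorem Exec.reg_of_regBound_le {P : Program} {s' : State} {t : ℕ} (he : Exec P s s' t) {r : ℕ}
    (hr : P.regBound ≤ r) : s'.reg r = s.reg r := by
  induction he with
  | assign x e s =>
    simp only [Program.regBound] at hr
    simp only [Function.update_apply]
    rw [if_neg (by omega)]
  | store => rfl
  | seq _ _ ih1 ih2 =>
    simp only [Program.regBound, max_le_iff] at hr
    rw [ih2 hr.2, ih1 hr.1]
  | ite_true _ _ ih =>
    simp only [Program.regBound, max_le_iff] at hr
    exact ih hr.1
  | ite_false _ _ ih =>
    simp only [Program.regBound, max_le_iff] at hr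
    exact ih hr.2
  | while_true _ _ _ ih1 ih2 => rw [ih2 hr, ih1 hr]
  | while_false => rfl

theorem Term.size_val_le_cost (e : Term) (s : State) : Nat.size (e.val s) ≤ e.cost s := by
  cases e <;> simp only [Term.cost, Term.val] <;> omega

/-- Whatever is written is charged its bit length. This is the only control over the size of the
answer of the simulated program. -/
theorem Exec.size_reg_le {P : Program} {s' : State} {t : ℕ} (he : Exec P s s' t) (r : ℕ) :
    Nat.size (s'.reg r) ≤ Nat.size (s.reg r) + t := by
  have : Nat.size (s'.reg r) ≤ max (Nat.size (s.reg r)) t := by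
    induction he with
    | assign x e s =>
      simp only [Function.update_apply]
      have := e.size_val_le_cost s
      split_ifs <;> omega
    | store => exact le_max_left _ _
    | seq _ _ ih1 ih2 => omega
    | ite_true _ _ ih => omega
    | ite_false _ _ ih => omega
    | while_true _ _ _ ih1 ih2 => omega
    | while_false => exact le_max_left _ _
  omega

/-- A program that resets the registers from `40` to `39 + n`. -/
def resetProg : ℕ → Program
  | 0 => .assign 40 (.lit 0)
  | n + 1 => .seq (resetProg n) (.assign (40 + n) (.lit 0))

theorem exec_resetProg (n : ℕ) (s : State) : ∃ s', ∃ t ≤ 2 * (n + 1),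
    Exec (resetProg n) s s' t ∧ s'.mem = s.mem ∧ (∀ r < 40, s'.reg r = s.reg r) ∧
      (∀ r, 40 ≤ r → r < 40 + n → s'.reg r = 0) ∧
      (∀ r, s.reg r = 0 → s'.reg r = 0) := by
  induction n with
  | zero =>
    refine ⟨_, _, ?_, Exec.assign _ _ _, rfl, ?_, ?_, ?_⟩
    · simp [Term.cost]
    · intro r hr
      simp only [Function.update_apply]
      rw [if_neg (by omega)]
    · intro r h1 h2
      omega
    · intro r hr
      simp [Function.update_apply, hr, Term.val]
  | succ n ih =>
    obtain ⟨s', t, ht, e, h1, h2, h3, h4⟩ := ih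
    refine ⟨_, _, ?_, Exec.seq e (Exec.assign _ _ _), h1, ?_, ?_, ?_⟩
    · simp [Term.cost]; omega
    · intro r hr
      simp only [Function.update_apply]
      rw [if_neg (by omega), h2 r hr]
    · intro r hr hr'
      simp only [Function.update_apply, Term.val]
      split_ifs with h
      · rfl
      · exact h3 r hr (by omega)
    · intro r hr
      simp [Function.update_apply, h4 r hr, Term.val]

end Relocation


/-! ### Expressions for tests, digits and clauses -/

namespace Term

/-- Negation of truth values. -/
def not (e : Term) : Term := .sub (.lit 1) e

/-- The truth value of a number. -/
def bool (e : Term) : Term := not (not e)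

/-- Equality test. -/
def eq (a b : Term) : Term := .sub (.lit 1) (.add (.sub a b) (.sub b a))

/-- Comparison. -/
def le (a b : Term) : Term := .sub (.lit 1) (.sub a b)

/-- Minimum. -/
def cap (a e : Term) : Term := .sub a (.sub a e)

/-- Remainder. -/
def mod (a b : Term) : Term := .sub a (.mul b (.div a b))

/-- Power with a constant exponent. -/
def pow (a : Term) : ℕ → Term
  | 0 => .lit 1
  | j + 1 => .mul (pow a j) a

/-- Sum over `j < n`. -/
def sumRange (f : ℕ → Term) : ℕ → Term
  | 0 => .lit 0
  | n + 1 => .add (sumRange f n) (f n)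

/-- Product over `j < n`. -/
def prodRange (f : ℕ → Term) : ℕ → Term
  | 0 => .lit 1
  | n + 1 => .mul (prodRange f n) (f n)

/-- The address of the entry `e` of the array number `c`. -/
def arr (c : ℕ) (e : Term) : Term :=
  .mul (.lit 2) (.add (.add (.mul (.lit 4) e) (.lit c)) (.reg 0))

/-- The digit at position `j` to the base in register `2`. -/
def digit (e : Term) (j : ℕ) : Term := mod (.div e (pow (.reg 2) j)) (.reg 2)

/-- Test whether one clause is contained in another. -/
def subclause (k : ℕ) (a b : Term) : Term :=
  prodRange (fun j => bool (.add (not (digit a j)) (eq (digit a j) (digit b j)))) k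

/-- The size of a clause. -/
def clauseCard (k : ℕ) (a : Term) : Term := sumRange (fun j => bool (digit a j)) k

section Values

variable (s : State) (a b e : Term)

@[simp] theorem val_not : (not e).val s = if e.val s = 0 then 1 else 0 := by
  simp only [not, val]
  split_ifs <;> omega

@[simp] theorem val_bool : (bool e).val s = if e.val s = 0 then 0 else 1 := by
  simp only [bool, val_not]
  split_ifs <;> simp_all

@[simp] theorem val_eq : (eq a b).val s = if a.val s = b.val s then 1 else 0 := by
  simp only [eq, val]
  split_ifs <;> omega

@[simp] theorem val_le : (le a b).val s = if a.val s ≤ b.val s then 1 else 0 := by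
  simp only [le, val]
  split_ifs <;> omega

-- The minimum is written as a subtraction from `a`, so that it is tame whenever `a` is, for
-- arbitrary `e`.
@[simp] theorem val_cap : (cap a e).val s = min (a.val s) (e.val s) := by
  simp only [cap, val]
  omega

@[simp] theorem val_mod : (mod a b).val s = a.val s % b.val s := by
  simp only [mod, val]
  exact (Nat.mod_eq_sub _ _).symm

@[simp] theorem val_pow (j : ℕ) : (pow a j).val s = a.val s ^ j := by
  induction j with
  | zero => rfl
  | succ j ih => simp [pow, val, ih, pow_succ]

@[simp] theorem val_sumRange (f : ℕ → Term) (n : ℕ) :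
    (sumRange f n).val s = ∑ j ∈ range n, (f j).val s := by
  induction n with
  | zero => rfl
  | succ n ih => simp [sumRange, val, ih, sum_range_succ]

@[simp] theorem val_prodRange (f : ℕ → Term) (n : ℕ) :
    (prodRange f n).val s = ∏ j ∈ range n, (f j).val s := by
  induction n with
  | zero => rfl
  | succ n ih => simp [prodRange, val, ih, prod_range_succ]

@[simp] theorem val_digit (j : ℕ) : (digit e j).val s = dig (s.reg 2) (e.val s) j := by
  simp [digit, val, dig]

theorem val_subclause (k : ℕ) : (subclause k a b).val s =
    if dec (s.reg 2) k (a.val s) ⊆ dec (s.reg 2) k (b.val s) then 1 else 0 := by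
  simp only [subclause, val_prodRange, val_bool, val, val_not, val_eq, val_digit, dec_subset_iff]
  split_ifs with h
  · refine prod_eq_one fun j hj => ?_
    rcases h j (mem_range.1 hj) with h | h <;> simp [h]
  · push Not at h
    obtain ⟨j, hj, h1, h2⟩ := h
    exact prod_eq_zero (mem_range.2 hj) (by simp [h1, h2])

theorem val_clauseCard (k : ℕ) :
    (clauseCard k a).val s = (dec (s.reg 2) k (a.val s)).card := by
  simp only [clauseCard, val_sumRange, val_bool, val_digit, card_dec, ne_eq, ite_not]

end Values

section Checks

variable {D : Set ℕ} {a b e : Term}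

@[simp] theorem ok_lit (c : ℕ) : (lit c).Ok D := trivial

@[simp] theorem ok_reg (r : ℕ) : (reg r).Ok D ↔ r < 40 := Iff.rfl

@[simp] theorem ok_add : (add a b).Ok D ↔ a.Ok D ∧ b.Ok D := Iff.rfl

@[simp] theorem ok_sub : (sub a b).Ok D ↔ a.Ok D ∧ b.Ok D := Iff.rfl

@[simp] theorem ok_mul : (mul a b).Ok D ↔ a.Ok D ∧ b.Ok D := Iff.rfl

@[simp] theorem ok_div : (div a b).Ok D ↔ a.Ok D ∧ b.Ok D := Iff.rfl

@[simp] theorem ok_not : (not e).Ok D ↔ e.Ok D := by simp [not]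

@[simp] theorem ok_bool : (bool e).Ok D ↔ e.Ok D := by simp [bool]

@[simp] theorem ok_eq : (eq a b).Ok D ↔ a.Ok D ∧ b.Ok D := by simp [eq]; tauto

@[simp] theorem ok_le : (le a b).Ok D ↔ a.Ok D ∧ b.Ok D := by simp [le]

@[simp] theorem ok_cap : (cap a e).Ok D ↔ a.Ok D ∧ e.Ok D := by simp [cap]

@[simp] theorem ok_mod : (mod a b).Ok D ↔ a.Ok D ∧ b.Ok D := by simp [mod]; tauto

@[simp] theorem ok_arr (c : ℕ) : (arr c e).Ok D ↔ e.Ok D := by simp [arr]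

theorem ok_pow (h : a.Ok D) (j : ℕ) : (pow a j).Ok D := by
  induction j with
  | zero => trivial
  | succ j ih => exact ⟨ih, h⟩

theorem ok_sumRange {f : ℕ → Term} (h : ∀ j, (f j).Ok D) (n : ℕ) : (sumRange f n).Ok D := by
  induction n with
  | zero => trivial
  | succ n ih => exact ⟨ih, h n⟩

theorem ok_prodRange {f : ℕ → Term} (h : ∀ j, (f j).Ok D) (n : ℕ) : (prodRange f n).Ok D := by
  induction n with
  | zero => trivial
  | succ n ih => exact ⟨ih, h n⟩

theorem ok_digit (h : e.Ok D) (j : ℕ) : (digit e j).Ok D := by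
  simp [digit, h, ok_pow]

theorem ok_subclause (k : ℕ) (ha : a.Ok D) (hb : b.Ok D) : (subclause k a b).Ok D :=
  ok_prodRange (fun j => by simp [ok_digit, ha, hb]) k

theorem ok_clauseCard (k : ℕ) (ha : a.Ok D) : (clauseCard k a).Ok D :=
  ok_sumRange (fun j => by simp [ok_digit, ha]) k

/-- Arrays live at even addresses. The odd cells belong to the simulated program, and nothing bounds
their contents. -/
theorem ok_load_arr (hD : ∀ n, 2 * n ∈ D) (c : ℕ) (he : e.Ok D) : (load (arr c e)).Ok D :=
  ⟨by simpa using he, fun s => by simp only [arr, val]; exact hD _⟩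

end Checks

end Term

/-! ### The program that computes a leaf of the tree -/

namespace LoopProg

/-- Conditional execution. -/
def when (b : Term) (p : LoopProg) : LoopProg := .ite b p (.assign 39 (.lit 0))

/-- Copy the array `0` to the array `1`. -/
def copyProg : LoopProg :=
  .loop 20 3 (.store (.arr 1 (.reg 20)) (.load (.arr 0 (.reg 20))))

/-- Test whether the clause in register `21` shows that the one in register `20` is not minimal. -/
def minTest (k : ℕ) : Term :=
  .mul (.load (.arr 1 (.reg 21))) (.mul (.subclause k (.reg 21) (.reg 20))
    (.not (.eq (.reg 21) (.reg 20))))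

/-- Compute the minimal clauses of the array `1` in the array `2`. -/
def minProg (k : ℕ) : LoopProg :=
  .loop 20 3 (.seq (.assign 22 (.load (.arr 1 (.reg 20))))
    (.seq (.loop 21 3 (when (minTest k) (.assign 22 (.lit 0))))
      (.store (.arr 2 (.reg 20)) (.reg 22))))

/-- The heart of the sunflower described by register `23`. -/
def heartTerm : Term := .mod (.reg 23) (.reg 3)

/-- The size of the clauses of the sunflower described by register `23`. -/
def sizeTerm (k : ℕ) : Term := .div (.div (.reg 23) (.reg 3)) (.lit (k + 1))

/-- The size of the petals of the sunflower described by register `23`. -/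
def petalTerm (k : ℕ) : Term := .mod (.div (.reg 23) (.reg 3)) (.lit (k + 1))

/-- Test whether the clause in register `20` belongs to the sunflower described by register `23`. -/
def starTest (k : ℕ) : Term :=
  .mul (.load (.arr 2 (.reg 20))) (.mul (.eq (.clauseCard k (.reg 20)) (sizeTerm k))
    (.subclause k heartTerm (.reg 20)))

/-- The threshold for the sunflower described by register `23`. -/
def thresholdTerm (k : ℕ) (θ : ℕ → ℕ) : Term :=
  .sumRange (fun j => .mul (.eq (petalTerm k) (.lit j)) (.lit (θ j))) (k + 1)

/-- Test whether register `23` describes the first sunflower; the number of its clauses is in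
register `22`. -/
def flowerTest (k : ℕ) (θ : ℕ → ℕ) : Term :=
  .mul (.eq (.reg 24) (.lit 0)) (.mul (.le (.lit 1) (petalTerm k))
    (.mul (.le (.lit 1) (.clauseCard k heartTerm))
      (.mul (.eq (.add (.clauseCard k heartTerm) (petalTerm k)) (sizeTerm k))
        (.le (thresholdTerm k θ) (.reg 22)))))

/-- Search for the first sunflower, and write one plus its description to register `24`. -/
def pickProg (k : ℕ) (θ : ℕ → ℕ) : LoopProg :=
  .seq (.assign 24 (.lit 0)) (.loop 23 9 (.seq (.assign 22 (.lit 0))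
    (.seq (.loop 20 3 (when (starTest k) (.assign 22 (.cap (.reg 3) (.add (.reg 22) (.lit 1))))))
      (when (flowerTest k θ) (.assign 24 (.cap (.reg 9) (.add (.reg 23) (.lit 1))))))))

/-- Add the petals. -/
def petalsProg (k : ℕ) : LoopProg :=
  .loop 20 3 (when (starTest k) (.store (.arr 1 (.sub (.reg 20) heartTerm)) (.lit 1)))

/-- Take the branch that is described by the path in register `8`. -/
def branchProg (k : ℕ) : LoopProg :=
  when (.reg 24) (.seq (.assign 23 (.sub (.reg 24) (.lit 1)))
    (.seq (.assign 25 (.div (.reg 25) (.lit 2)))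
      (.ite (.mod (.div (.reg 8) (.reg 25)) (.lit 2)) (petalsProg k)
        (.store (.arr 1 heartTerm) (.lit 1)))))

/-- Compute the leaf of the branching tree for the path in register `8`. -/
def replayProg (k : ℕ) (θ : ℕ → ℕ) : LoopProg :=
  .seq copyProg (.seq (.assign 25 (.reg 4))
    (.seq (.loop 26 3 (.seq (minProg k) (.seq (pickProg k θ) (branchProg k)))) (minProg k)))

variable {D : Set ℕ}

theorem replayProg_ok (hD : ∀ n, 2 * n ∈ D) (k : ℕ) (θ : ℕ → ℕ) : (replayProg k θ).Ok D := by
  have h := fun c e he => Term.ok_load_arr (e := e) hD c he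
  have h1 : ∀ c r, r < 40 → (Term.load (.arr c (.reg r))).Ok D := fun c r hr => h c _ hr
  have h2 : heartTerm.Ok D := by simp [heartTerm]
  have h3 : (starTest k).Ok D := by
    simp [starTest, h1, Term.ok_subclause, Term.ok_clauseCard, h2, sizeTerm]
  have h4 : (thresholdTerm k θ).Ok D := Term.ok_sumRange (fun _ => by simp [petalTerm]) _
  have h5 : (minTest k).Ok D := by simp [minTest, h1, Term.ok_subclause]
  have h6 : (flowerTest k θ).Ok D := by
    simp [flowerTest, Term.ok_clauseCard, h2, sizeTerm, petalTerm, h4]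
  simp [replayProg, copyProg, minProg, pickProg, branchProg, petalsProg, when, Ok, writes, h1, h2,
    h3, h5, h6]

theorem replayProg_tame (k : ℕ) (θ : ℕ → ℕ) : (replayProg k θ).Tame := by
  simp [replayProg, copyProg, minProg, pickProg, branchProg, petalsProg, when, Tame, Term.Tame,
    Term.cap]

end LoopProg

/-- The address of the entry `i` of the array number `c`. -/
def arrAddr (L c i : ℕ) : ℕ := 2 * (4 * i + c + L)

/-- Four arrays are interleaved modulo `4`: the formula, the current family, its minimal clauses,
and the powers of two. The offset `L` keeps them clear of the input. -/
theorem arrAddr_inj {L c c' i i' : ℕ} (hc : c < 4) (hc' : c' < 4) :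
    arrAddr L c i = arrAddr L c' i' ↔ c = c' ∧ i = i' := by
  unfold arrAddr
  omega

theorem Term.val_arr (s : State) (c : ℕ) (e : Term) :
    (Term.arr c e).val s = arrAddr (s.reg 0) c (e.val s) := by
  simp [Term.arr, Term.val, arrAddr]

/-- The array number `c` is the indicator function of `F` on `{0, ..., R - 1}`. -/
def HasSet (L c R : ℕ) (F : Finset ℕ) (m : ℕ → ℕ) : Prop :=
  ∀ i < R, m (arrAddr L c i) = if i ∈ F then 1 else 0

/-- The memory changes at most in the array number `c`. -/
def OnlyArr (L c : ℕ) (m m' : ℕ → ℕ) : Prop := ∀ a, (∀ i, a ≠ arrAddr L c i) → m' a = m a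

theorem OnlyArr.refl (L c : ℕ) (m : ℕ → ℕ) : OnlyArr L c m m := fun _ _ => rfl

theorem OnlyArr.trans {L c : ℕ} {m₁ m₂ m₃ : ℕ → ℕ} (h : OnlyArr L c m₁ m₂)
    (h' : OnlyArr L c m₂ m₃) : OnlyArr L c m₁ m₃ :=
  fun a ha => (h' a ha).trans (h a ha)

theorem OnlyArr.put {L c i : ℕ} {s : State} {v : ℕ} :
    OnlyArr L c s.mem (s.put (arrAddr L c i) v).mem :=
  fun a ha => by rw [State.put_mem, if_neg (ha i)]

theorem OnlyArr.apply {L c c' : ℕ} {m m' : ℕ → ℕ} (h : OnlyArr L c m m') (hc : c < 4) (hc' : c' < 4)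
    (hne : c' ≠ c) (i : ℕ) : m' (arrAddr L c' i) = m (arrAddr L c' i) :=
  h _ fun _ hj => hne ((arrAddr_inj hc' hc).1 hj).1

theorem OnlyArr.hasSet {L c c' R : ℕ} {m m' : ℕ → ℕ} {F : Finset ℕ} (h : OnlyArr L c m m')
    (hc : c < 4) (hc' : c' < 4) (hne : c' ≠ c) (hs : HasSet L c' R F m) : HasSet L c' R F m' :=
  fun i hi => (h.apply hc hc' hne i).trans (hs i hi)

namespace LoopProg

variable {D : Set ℕ} {s : State} {L B k : ℕ} {F : Finset ℕ}

theorem eval_when (b : Term) (p : LoopProg) (s : State) :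
    (when b p).eval s = if b.val s ≠ 0 then p.eval s else s.set 39 0 := rfl

theorem eval_copyProg (hL : s.reg 0 = L) {R : ℕ} (hR : s.reg 3 = R) (h : HasSet L 0 R F s.mem) :
    HasSet L 1 R F (copyProg.eval s).mem ∧ OnlyArr L 1 s.mem (copyProg.eval s).mem := by
  have key : (∀ j < R, (copyProg.eval s).mem (arrAddr L 1 j) = s.mem (arrAddr L 0 j)) ∧
      OnlyArr L 1 s.mem (copyProg.eval s).mem := by
    rw [← hR]
    refine (forState_induction (I := fun i σ => σ.reg 0 = L ∧
      (∀ j < i, σ.mem (arrAddr L 1 j) = s.mem (arrAddr L 0 j)) ∧ OnlyArr L 1 s.mem σ.mem)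
      ?_ ?_).2
    · exact ⟨by simp [State.set_reg, hL], by simp, OnlyArr.refl _ _ _⟩
    · rintro i hi σ hσ ⟨h1, h2, h3⟩
      simp only [eval, Term.val_arr, Term.val, hσ, h1]
      refine ⟨by simp [State.set_reg, h1], fun j hj => ?_, h3.trans OnlyArr.put⟩
      rw [State.set_mem, State.put_mem]
      simp only [arrAddr_inj (L := L) (show 1 < 4 by omega) (show 1 < 4 by omega), true_and]
      split_ifs with hji
      · rw [hji]
        exact h3.apply (by omega) (by omega) (by omega) _
      · exact h2 j (by omega)
  exact ⟨fun i hi => (key.1 i hi).trans (h i hi), key.2⟩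

theorem eval_minProg (hL : s.reg 0 = L) (hB : s.reg 2 = B) (hR : s.reg 3 = B ^ k)
    (hF : ∀ C ∈ F, C < B ^ k) (h : HasSet L 1 (B ^ k) F s.mem) :
    HasSet L 2 (B ^ k) (minIds B k F) ((minProg k).eval s).mem ∧
      OnlyArr L 2 s.mem ((minProg k).eval s).mem := by
  -- Register `22` starts as the indicator of `C ∈ F` and is erased when another member of `F`
  -- inside `C` shows up.
  have inner : ∀ C < B ^ k, ∀ σ : State, σ.reg 0 = L → σ.reg 2 = B → σ.reg 3 = B ^ k →
      σ.reg 20 = C → HasSet L 1 (B ^ k) F σ.mem → σ.reg 22 = (if C ∈ F then 1 else 0) →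
      ((loop 21 3 (when (minTest k) (.assign 22 (.lit 0)))).eval σ).mem = σ.mem ∧
      ((loop 21 3 (when (minTest k) (.assign 22 (.lit 0)))).eval σ).reg 22 =
        if C ∈ minIds B k F then 1 else 0 := by
    intro C hC σ h0 h2 h3 h20 h1 h22
    have := forState_induction (f := (when (minTest k) (.assign 22 (.lit 0))).eval) (r := 21)
      (s := σ) (n := B ^ k)
      (I := fun i τ => τ.reg 0 = L ∧ τ.reg 2 = B ∧ τ.reg 20 = C ∧ τ.mem = σ.mem ∧
        τ.reg 22 = if C ∈ F ∧ ∀ E < i, E ∈ F → dec B k E ⊆ dec B k C → E = C then 1 else 0)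
      (by simp [State.set_reg, h0, h2, h20, h22])
      (by
        rintro i hi τ hτ ⟨i0, i2, i20, im, i22⟩
        have hval : (minTest k).val τ =
            if i ∈ F ∧ dec B k i ⊆ dec B k C ∧ i ≠ C then 1 else 0 := by
          simp only [minTest, Term.val, Term.val_arr, Term.val_subclause, Term.val_not,
            Term.val_eq, hτ, i0, i2, i20, im, h1 i hi]
          split_ifs <;> simp_all
        rw [eval_when, hval]
        by_cases hc : i ∈ F ∧ dec B k i ⊆ dec B k C ∧ i ≠ C
        · rw [if_pos (by simp [hc])]
          refine ⟨by simp [eval, State.set_reg, i0], by simp [eval, State.set_reg, i2],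
            by simp [eval, State.set_reg, i20], im, ?_⟩
          rw [if_neg]
          · simp [eval, State.set_reg, Term.val]
          · rintro ⟨-, h⟩
            exact hc.2.2 (h i (by omega) hc.1 hc.2.1)
        · rw [if_neg (by simp [hc])]
          refine ⟨by simp [State.set_reg, i0], by simp [State.set_reg, i2],
            by simp [State.set_reg, i20], im, ?_⟩
          simp only [State.set_reg]
          norm_num
          rw [i22]
          congr 1
          simp only [eq_iff_iff, and_congr_right_iff]
          intro _
          constructor
          · intro h E hE hEF hEC
            obtain hE | rfl := Nat.lt_or_eq_of_le hE
            · exact h E hE hEF hEC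
            · by_contra hne
              exact hc ⟨hEF, hEC, hne⟩
          · intro h E hE
            exact h E (by omega))
    simp only [eval, h3]
    refine ⟨this.2.2.2.1, this.2.2.2.2.trans ?_⟩
    congr 1
    rw [mem_minIds, eq_iff_iff]
    refine and_congr_right fun _ => ⟨fun h E hE => h E (hF E hE) hE, fun h E _ hE => h E hE⟩
  have key : (∀ j < B ^ k, ((minProg k).eval s).mem (arrAddr L 2 j) =
      if j ∈ minIds B k F then 1 else 0) ∧ OnlyArr L 2 s.mem ((minProg k).eval s).mem := by
    have := forState_induction (f := (LoopProg.seq (.assign 22 (.load (.arr 1 (.reg 20))))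
      (.seq (.loop 21 3 (when (minTest k) (.assign 22 (.lit 0))))
      (.store (.arr 2 (.reg 20)) (.reg 22)))).eval) (r := 20) (s := s) (n := B ^ k)
      (I := fun i σ => σ.reg 0 = L ∧ σ.reg 2 = B ∧ σ.reg 3 = B ^ k ∧
        (∀ j < i, σ.mem (arrAddr L 2 j) = if j ∈ minIds B k F then 1 else 0) ∧
        OnlyArr L 2 s.mem σ.mem)
      ⟨by simp [State.set_reg, hL], by simp [State.set_reg, hB], by simp [State.set_reg, hR],
        by simp, OnlyArr.refl _ _ _⟩
      (by
        rintro i hi σ hσ ⟨i0, i2, i3, im, io⟩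
        have hs1 : HasSet L 1 (B ^ k) F σ.mem := io.hasSet (by omega) (by omega) (by omega) h
        obtain ⟨j1, j2⟩ := inner i hi (σ.set 22 ((Term.load (.arr 1 (.reg 20))).val σ))
          (by simp [State.set_reg, i0]) (by simp [State.set_reg, i2])
          (by simp [State.set_reg, i3]) (by simp [State.set_reg, hσ]) hs1
          (by simp [State.set_reg, Term.val, Term.val_arr, i0, hσ, hs1 i hi])
        have hreg : ∀ x, x ≠ 21 → x ≠ 22 → x ≠ 39 →
            ((loop 21 3 (when (minTest k) (.assign 22 (.lit 0)))).eval
              (σ.set 22 ((Term.load (.arr 1 (.reg 20))).val σ))).reg x = σ.reg x := by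
          intro x h1 h2 h3
          rw [eval_reg (by simp [writes, when]; omega), State.set_reg, if_neg h2]
        have e1 : (LoopProg.seq (.assign 22 (.load (.arr 1 (.reg 20))))
            (.seq (.loop 21 3 (when (minTest k) (.assign 22 (.lit 0))))
            (.store (.arr 2 (.reg 20)) (.reg 22)))).eval σ =
            ((loop 21 3 (when (minTest k) (.assign 22 (.lit 0)))).eval
              (σ.set 22 ((Term.load (.arr 1 (.reg 20))).val σ))).put (arrAddr L 2 i)
              (if i ∈ minIds B k F then 1 else 0) := by
          conv_lhs => rw [eval, eval, eval, eval, Term.val_arr]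
          simp only [Term.val]
          simp only [Term.val] at j2 hreg
          rw [j2, hreg 0 (by omega) (by omega) (by omega),
            hreg 20 (by omega) (by omega) (by omega), i0, hσ]
        rw [e1]
        refine ⟨?_, ?_, ?_, ?_, ?_⟩
        · rw [State.set_reg, if_neg (by omega), State.put_reg,
            hreg 0 (by omega) (by omega) (by omega), i0]
        · rw [State.set_reg, if_neg (by omega), State.put_reg,
            hreg 2 (by omega) (by omega) (by omega), i2]
        · rw [State.set_reg, if_neg (by omega), State.put_reg,
            hreg 3 (by omega) (by omega) (by omega), i3]
        · intro j hj
          rw [State.set_mem, State.put_mem, j1]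
          simp only [arrAddr_inj (L := L) (show 2 < 4 by omega) (show 2 < 4 by omega), true_and]
          split_ifs with hji <;> simp_all
          all_goals
            have := im j (by omega)
            simp_all
        · rw [State.set_mem]
          refine io.trans ?_
          have := OnlyArr.put (L := L) (c := 2) (i := i)
            (s := (loop 21 3 (when (minTest k) (.assign 22 (.lit 0)))).eval
              (σ.set 22 ((Term.load (.arr 1 (.reg 20))).val σ)))
            (v := if i ∈ minIds B k F then 1 else 0)
          rwa [j1] at this)
    have e : (minProg k).eval s = forState (LoopProg.seq (.assign 22 (.load (.arr 1 (.reg 20))))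
      (.seq (.loop 21 3 (when (minTest k) (.assign 22 (.lit 0))))
      (.store (.arr 2 (.reg 20)) (.reg 22)))).eval 20 s (B ^ k) := by
      rw [← hR]; rfl
    rw [e]
    exact this.2.2.2
  exact key

end LoopProg


namespace LoopProg

variable {s : State} {L B k : ℕ} {F : Finset ℕ} {θ : ℕ → ℕ}

theorem val_heartTerm {z : ℕ} (hR : s.reg 3 = B ^ k) (hz : s.reg 23 = z) :
    heartTerm.val s = z % B ^ k := by
  simp [heartTerm, Term.val, hR, hz]

theorem val_sizeTerm {z : ℕ} (hR : s.reg 3 = B ^ k) (hz : s.reg 23 = z) :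
    (sizeTerm k).val s = z / B ^ k / (k + 1) := by
  simp [sizeTerm, Term.val, hR, hz]

theorem val_petalTerm {z : ℕ} (hR : s.reg 3 = B ^ k) (hz : s.reg 23 = z) :
    (petalTerm k).val s = z / B ^ k % (k + 1) := by
  simp [petalTerm, Term.val, hR, hz]

theorem val_thresholdTerm {z : ℕ} (hR : s.reg 3 = B ^ k) (hz : s.reg 23 = z) :
    (thresholdTerm k θ).val s = θ (z / B ^ k % (k + 1)) := by
  simp only [thresholdTerm, Term.val_sumRange, Term.val, Term.val_eq, val_petalTerm hR hz]
  rw [sum_eq_single (z / B ^ k % (k + 1))]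
  · simp
  · intro j _ hj
    rw [if_neg (Ne.symm hj), zero_mul]
  · intro h
    exact absurd (mem_range.2 (Nat.mod_lt _ (Nat.succ_pos k))) h

theorem val_starTest {z C : ℕ} (hL : s.reg 0 = L) (hB : s.reg 2 = B) (hR : s.reg 3 = B ^ k)
    (hz : s.reg 23 = z) (hC : s.reg 20 = C) (hCR : C < B ^ k)
    (h : HasSet L 2 (B ^ k) (minIds B k F) s.mem) :
    (starTest k).val s = if C ∈ star B k F (z / B ^ k / (k + 1)) (z % B ^ k) then 1 else 0 := by
  simp only [starTest, Term.val, Term.val_arr, Term.val_eq, Term.val_subclause,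
    Term.val_clauseCard, val_heartTerm hR hz, val_sizeTerm hR hz, hL, hB, hC, h C hCR, mem_star]
  split_ifs <;> simp_all

theorem ite_one_mul_ite_one (p q : Prop) [Decidable p] [Decidable q] :
    ((if p then 1 else 0) * if q then 1 else 0) = if p ∧ q then 1 else 0 := by
  split_ifs <;> simp_all

/-- The condition on register `24` lets only the first sunflower be recorded; since one plus its
description is stored, zero is free to mean that none has been found. -/
theorem val_flowerTest {z c : ℕ} (hB : s.reg 2 = B) (hR : s.reg 3 = B ^ k)
    (hz : s.reg 23 = z) (hc : s.reg 22 = c)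
    (hcard : c = (star B k F (z / B ^ k / (k + 1)) (z % B ^ k)).card) :
    (flowerTest k θ).val s = if s.reg 24 = 0 ∧ IsFlower B k θ F z then 1 else 0 := by
  simp only [flowerTest, Term.val, Term.val_eq, Term.val_le, Term.val_clauseCard,
    val_heartTerm hR hz, val_sizeTerm hR hz, val_petalTerm hR hz, val_thresholdTerm hR hz, hB,
    hc, hcard, ite_one_mul_ite_one]
  exact ite_one_mul_ite_one _ _

theorem card_filter_range_succ (p : ℕ → Prop) [DecidablePred p] (i : ℕ) :
    ((range (i + 1)).filter p).card = ((range i).filter p).card + if p i then 1 else 0 := by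
  rw [range_add_one, filter_insert]
  split_ifs
  · rw [card_insert_of_notMem (by simp)]
  · rfl

theorem eval_countLoop {z : ℕ} (hL : s.reg 0 = L) (hB : s.reg 2 = B) (hR : s.reg 3 = B ^ k)
    (hz : s.reg 23 = z) (h22 : s.reg 22 = 0) (hF : ∀ C ∈ F, C < B ^ k)
    (h : HasSet L 2 (B ^ k) (minIds B k F) s.mem) :
    ((loop 20 3 (when (starTest k)
      (.assign 22 (.cap (.reg 3) (.add (.reg 22) (.lit 1)))))).eval s).mem = s.mem ∧
    ((loop 20 3 (when (starTest k)
      (.assign 22 (.cap (.reg 3) (.add (.reg 22) (.lit 1)))))).eval s).reg 22 =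
      (star B k F (z / B ^ k / (k + 1)) (z % B ^ k)).card := by
  set S := star B k F (z / B ^ k / (k + 1)) (z % B ^ k) with hS
  have := forState_induction (f := (when (starTest k)
      (.assign 22 (.cap (.reg 3) (.add (.reg 22) (.lit 1))))).eval) (r := 20) (s := s)
    (n := B ^ k)
    (I := fun i σ => σ.reg 0 = L ∧ σ.reg 2 = B ∧ σ.reg 3 = B ^ k ∧ σ.reg 23 = z ∧
      σ.mem = s.mem ∧ σ.reg 22 = ((range i).filter fun C => C ∈ S).card)
    (by simp [State.set_reg, hL, hB, hR, hz, h22])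
    (by
      rintro i hi σ hσ ⟨i0, i2, i3, iz, im, i22⟩
      have hval : (starTest k).val σ = if i ∈ S then 1 else 0 :=
        val_starTest i0 i2 i3 iz hσ hi (by rwa [im])
      -- The count stays below the number of candidates, so the cap at `B ^ k` never changes it.
      have hle : ((range i).filter fun C => C ∈ S).card ≤ i :=
        (card_filter_le _ _).trans (by simp)
      rw [eval_when, hval, card_filter_range_succ]
      by_cases hc : i ∈ S
      · simp only [hc, if_true]
        simp [eval, State.set_reg, i0, i2, i3, iz, im, i22, Term.val]
        omega
      · simp [hc, State.set_reg, i0, i2, i3, iz, im, i22])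
  simp only [eval, hR]
  refine ⟨this.2.2.2.2.1, this.2.2.2.2.2.trans ?_⟩
  congr 1
  ext C
  rw [mem_filter, mem_range]
  exact ⟨fun h => h.2, fun h => ⟨hF C (star_subset h), h⟩⟩

theorem eval_pickProg (hL : s.reg 0 = L) (hB : s.reg 2 = B) (hR : s.reg 3 = B ^ k)
    (hZ : s.reg 9 = (k + 1) ^ 2 * B ^ k) (hF : ∀ C ∈ F, C < B ^ k)
    (h : HasSet L 2 (B ^ k) (minIds B k F) s.mem) :
    ((pickProg k θ).eval s).mem = s.mem ∧
      ((pickProg k θ).eval s).reg 24 = (pick B k θ F).elim 0 fun z => z + 1 := by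
  have := forState_induction (f := (LoopProg.seq (.assign 22 (.lit 0))
    (.seq (.loop 20 3 (when (starTest k) (.assign 22 (.cap (.reg 3) (.add (.reg 22) (.lit 1))))))
      (when (flowerTest k θ) (.assign 24 (.cap (.reg 9) (.add (.reg 23) (.lit 1))))))).eval)
    (r := 23) (s := s.set 24 0) (n := (k + 1) ^ 2 * B ^ k)
    (I := fun i σ => σ.reg 0 = L ∧ σ.reg 2 = B ∧ σ.reg 3 = B ^ k ∧
      σ.reg 9 = (k + 1) ^ 2 * B ^ k ∧ σ.mem = s.mem ∧ σ.reg 24 =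
        ((List.range i).find? fun z => IsFlower B k θ F z).elim 0 fun z => z + 1)
    (by simp [State.set_reg, hL, hB, hR, hZ])
    (by
      rintro i hi σ hσ ⟨i0, i2, i3, i9, im, i24⟩
      obtain ⟨c1, c2⟩ := eval_countLoop (L := L) (B := B) (s := σ.set 22 0) (z := i) (F := F)
        (by simp [State.set_reg, i0]) (by simp [State.set_reg, i2]) (by simp [State.set_reg, i3])
        (by simp [State.set_reg, hσ]) (by simp [State.set_reg]) hF (by rwa [State.set_mem, im])
      set τ := (loop 20 3 (when (starTest k)
        (.assign 22 (.cap (.reg 3) (.add (.reg 22) (.lit 1)))))).eval (σ.set 22 0) with hτ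
      have hreg : ∀ x, x ≠ 20 → x ≠ 22 → x ≠ 39 → τ.reg x = σ.reg x := by
        intro x h1 h2 h3
        rw [hτ, eval_reg (by simp [writes, when]; omega), State.set_reg, if_neg h2]
      have hval : (flowerTest k θ).val τ =
          if τ.reg 24 = 0 ∧ IsFlower B k θ F i then 1 else 0 :=
        val_flowerTest (by rw [hreg 2 (by omega) (by omega) (by omega), i2])
          (by rw [hreg 3 (by omega) (by omega) (by omega), i3])
          (by rw [hreg 23 (by omega) (by omega) (by omega), hσ]) c2 rfl
      have h0 := hreg 0 (by omega) (by omega) (by omega)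
      have h2 := hreg 2 (by omega) (by omega) (by omega)
      have h3 := hreg 3 (by omega) (by omega) (by omega)
      have h9 := hreg 9 (by omega) (by omega) (by omega)
      have h23 := hreg 23 (by omega) (by omega) (by omega)
      have h24 := hreg 24 (by omega) (by omega) (by omega)
      have hev : (LoopProg.seq (.assign 22 (.lit 0))
        (.seq (.loop 20 3 (when (starTest k)
          (.assign 22 (.cap (.reg 3) (.add (.reg 22) (.lit 1))))))
          (when (flowerTest k θ) (.assign 24 (.cap (.reg 9) (.add (.reg 23) (.lit 1))))))).eval σ =
          (when (flowerTest k θ)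
            (.assign 24 (.cap (.reg 9) (.add (.reg 23) (.lit 1))))).eval τ := rfl
      rw [hev, eval_when, hval, List.range_succ, List.find?_append]
      rw [State.set_mem] at c1
      cases hfind : (List.range i).find? fun z => decide (IsFlower B k θ F z) with
      | some z =>
        rw [hfind] at i24
        simp only [Option.elim_some] at i24
        simp [State.set_reg, h0, h2, h3, h9, h24, i0, i2, i3, i9, i24, c1, im]
      | none =>
        rw [hfind] at i24
        simp only [Option.elim_none] at i24
        by_cases hfl : IsFlower B k θ F i
        · have : τ.reg 24 = 0 ∧ IsFlower B k θ F i := ⟨by rw [h24, i24], hfl⟩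
          rw [if_pos this, if_pos one_ne_zero]
          simp [hfl, eval, State.set_reg, h0, h2, h3, h9, i0, i2, i3, i9, c1, im, Term.val, h23, hσ]
          omega
        · have : ¬ (τ.reg 24 = 0 ∧ IsFlower B k θ F i) := fun h => hfl h.2
          simp [hfl, State.set_reg, h0, h2, h3, h9, h24, i0, i2, i3, i9, i24, c1, im])
  have e : (pickProg k θ).eval s = forState (LoopProg.seq (.assign 22 (.lit 0))
    (.seq (.loop 20 3 (when (starTest k) (.assign 22 (.cap (.reg 3) (.add (.reg 22) (.lit 1))))))
      (when (flowerTest k θ) (.assign 24 (.cap (.reg 9) (.add (.reg 23) (.lit 1))))))).eval 23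
      (s.set 24 0) ((k + 1) ^ 2 * B ^ k) := by
    rw [← hZ]; rfl
  rw [e]
  exact ⟨this.2.2.2.2.1, this.2.2.2.2.2⟩

theorem hasSet_put {m : State} {R i c : ℕ} {G : Finset ℕ} (hc : c < 4) (h : HasSet L c R G m.mem) :
    HasSet L c R (insert i G) (m.put (arrAddr L c i) 1).mem := by
  intro j hj
  rw [State.put_mem]
  simp only [arrAddr_inj (L := L) hc hc, true_and,
    mem_insert]
  split_ifs with h1 h2 h2
  · rfl
  · exact absurd (Or.inl h1) h2
  · rw [h j hj, if_pos (by tauto)]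
  · rw [h j hj, if_neg (by tauto)]

/-- The petals go to array `1` while the star is read from array `2`, which still describes the
family before the step; the writes do not disturb the test. -/
theorem eval_petalsProg {z : ℕ} (hL : s.reg 0 = L) (hB : s.reg 2 = B) (hR : s.reg 3 = B ^ k)
    (hz : s.reg 23 = z) (hF : ∀ C ∈ F, C < B ^ k) (h1 : HasSet L 1 (B ^ k) F s.mem)
    (h2 : HasSet L 2 (B ^ k) (minIds B k F) s.mem) :
    HasSet L 1 (B ^ k) (petalStep B k F z) ((petalsProg k).eval s).mem ∧
      OnlyArr L 1 s.mem ((petalsProg k).eval s).mem := by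
  set S := star B k F (z / B ^ k / (k + 1)) (z % B ^ k) with hS
  have := forState_induction (f := (when (starTest k)
      (.store (.arr 1 (.sub (.reg 20) heartTerm)) (.lit 1))).eval) (r := 20) (s := s)
    (n := B ^ k)
    (I := fun i σ => σ.reg 0 = L ∧ σ.reg 2 = B ∧ σ.reg 3 = B ^ k ∧ σ.reg 23 = z ∧
      HasSet L 1 (B ^ k) (F ∪ ((range i).filter fun C => C ∈ S).image fun C => C - z % B ^ k)
        σ.mem ∧ OnlyArr L 1 s.mem σ.mem)
    ⟨by simp [State.set_reg, hL], by simp [State.set_reg, hB], by simp [State.set_reg, hR],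
      by simp [State.set_reg, hz], by simpa using h1, OnlyArr.refl _ _ _⟩
    (by
      rintro i hi σ hσ ⟨i0, i2, i3, iz, is, io⟩
      have hval : (starTest k).val σ = if i ∈ S then 1 else 0 :=
        val_starTest i0 i2 i3 iz hσ hi (io.hasSet (by omega) (by omega) (by omega) h2)
      rw [eval_when, hval, range_add_one, filter_insert]
      by_cases hc : i ∈ S
      · rw [if_pos (by simp [hc]), if_pos hc, image_insert, union_insert]
        have e1 : (LoopProg.store (.arr 1 (.sub (.reg 20) heartTerm)) (.lit 1)).eval σ =
            σ.put (arrAddr L 1 (i - z % B ^ k)) 1 := by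
          simp [eval, Term.val_arr, Term.val, i0, hσ, val_heartTerm i3 iz]
        rw [e1]
        exact ⟨by simp [State.set_reg, i0], by simp [State.set_reg, i2],
          by simp [State.set_reg, i3], by simp [State.set_reg, iz], hasSet_put (by omega) is,
          io.trans OnlyArr.put⟩
      · rw [if_neg (by simp [hc]), if_neg hc]
        exact ⟨by simp [State.set_reg, i0], by simp [State.set_reg, i2],
          by simp [State.set_reg, i3], by simp [State.set_reg, iz], is, io⟩)
  have e : (petalsProg k).eval s = forState (when (starTest k)
      (.store (.arr 1 (.sub (.reg 20) heartTerm)) (.lit 1))).eval 20 s (B ^ k) := by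
    rw [← hR]; rfl
  rw [e]
  refine ⟨?_, this.2.2.2.2.2⟩
  have hset : ((range (B ^ k)).filter fun C => C ∈ S) = S := by
    ext C
    rw [mem_filter, mem_range]
    exact ⟨fun h => h.2, fun h => ⟨hF C (star_subset h), h⟩⟩
  rw [hset] at this
  exact this.2.2.2.2.1

theorem eval_branchProg {w q : ℕ} (hL : s.reg 0 = L) (hB : s.reg 2 = B) (hR : s.reg 3 = B ^ k)
    (hw : s.reg 8 = w) (hq : s.reg 25 = q)
    (h24 : s.reg 24 = (pick B k θ F).elim 0 fun z => z + 1) (hF : ∀ C ∈ F, C < B ^ k)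
    (h1 : HasSet L 1 (B ^ k) F s.mem) (h2 : HasSet L 2 (B ^ k) (minIds B k F) s.mem) :
    HasSet L 1 (B ^ k) (stepW B k θ w (F, q)).1 ((branchProg k).eval s).mem ∧
      ((branchProg k).eval s).reg 25 = (stepW B k θ w (F, q)).2 ∧
      OnlyArr L 1 s.mem ((branchProg k).eval s).mem := by
  rw [branchProg, eval_when, stepW]
  cases hp : pick B k θ F with
  | none =>
    rw [hp] at h24
    simp only [Option.elim_none] at h24
    rw [if_neg (by simp [Term.val, h24])]
    exact ⟨h1, by simp [State.set_reg, hq], OnlyArr.refl _ _ _⟩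
  | some z =>
    rw [hp] at h24
    simp only [Option.elim_some] at h24
    rw [if_pos (by simp [Term.val, h24])]
    set τ := (s.set 23 z).set 25 (q / 2) with hτ
    have e1 : ∀ p, (LoopProg.seq (.assign 23 (.sub (.reg 24) (.lit 1)))
        (.seq (.assign 25 (.div (.reg 25) (.lit 2))) p)).eval s = p.eval τ := by
      intro p
      simp [eval, Term.val, h24, State.set_reg, hq, hτ]
    rw [e1, eval]
    have hval : (Term.mod (.div (.reg 8) (.reg 25)) (.lit 2)).val τ = w / (q / 2) % 2 := by
      simp [Term.val, hτ, State.set_reg, hw]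
    have t0 : τ.reg 0 = L := by simp [hτ, State.set_reg, hL]
    have t2 : τ.reg 2 = B := by simp [hτ, State.set_reg, hB]
    have t3 : τ.reg 3 = B ^ k := by simp [hτ, State.set_reg, hR]
    have tz : τ.reg 23 = z := by simp [hτ, State.set_reg]
    have tq : τ.reg 25 = q / 2 := by simp [hτ, State.set_reg]
    have tm : τ.mem = s.mem := rfl
    rw [hval]
    by_cases hb : w / (q / 2) % 2 = 1
    · rw [if_pos (by simp [hb])]
      simp only [hb, if_true]
      obtain ⟨p1, p2⟩ := eval_petalsProg t0 t2 t3 tz hF (by rwa [tm]) (by rwa [tm])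
      exact ⟨p1, by rw [eval_reg (by rfl), tq], p2⟩
    · rw [if_neg (by omega)]
      simp only [hb, if_false]
      have e2 : (LoopProg.store (.arr 1 heartTerm) (.lit 1)).eval τ =
          τ.put (arrAddr L 1 (z % B ^ k)) 1 := by
        simp [eval, Term.val_arr, Term.val, t0, val_heartTerm t3 tz]
      rw [e2]
      exact ⟨hasSet_put (m := τ) (by omega) h1, tq, OnlyArr.put⟩

/-- The memory changes at most in the arrays `1` and `2`. -/
def OnlyWork (L : ℕ) (m m' : ℕ → ℕ) : Prop :=
  ∀ a, (∀ i, a ≠ arrAddr L 1 i) → (∀ i, a ≠ arrAddr L 2 i) → m' a = m a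

theorem stepW_lt {w : ℕ} {p : Finset ℕ × ℕ} (hB : 0 < B) (hp : ∀ C ∈ p.1, C < B ^ k) :
    ∀ C ∈ (stepW B k θ w p).1, C < B ^ k := by
  rw [stepW]
  split
  · exact hp
  · split_ifs
    · exact petalStep_lt hp _
    · exact heartStep_lt hB hp _

/-- The replay program computes the leaf, its minimal clauses and its weight. -/
theorem eval_replayProg {w : ℕ} (hB0 : 0 < B) (hL : s.reg 0 = L) (hB : s.reg 2 = B)
    (hR : s.reg 3 = B ^ k) (hQ : s.reg 4 = 2 ^ B ^ k) (hZ : s.reg 9 = (k + 1) ^ 2 * B ^ k)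
    (hw : s.reg 8 = w) (hF : ∀ C ∈ F, C < B ^ k) (h0 : HasSet L 0 (B ^ k) F s.mem) :
    HasSet L 2 (B ^ k) (minIds B k (replay B k θ F w).1) ((replayProg k θ).eval s).mem ∧
      ((replayProg k θ).eval s).reg 25 = (replay B k θ F w).2 ∧
      OnlyWork L s.mem ((replayProg k θ).eval s).mem := by
  have hok := replayProg_ok (D := Set.univ) (fun _ => trivial) k θ
  obtain ⟨c1, c2⟩ := eval_copyProg hL hR h0
  have ccon : ∀ x < 20, (copyProg.eval s).reg x = s.reg x := fun x hx =>
    eval_reg (writes_of_ok hok.1 (Or.inl hx)) s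
  set σ₀ := (copyProg.eval s).set 25 (2 ^ B ^ k) with hσ₀
  -- The number of rounds is always `B ^ k`; after a leaf has been reached the search finds no
  -- sunflower and the rounds leave the family and the weight unchanged.
  have := forState_induction
    (f := (LoopProg.seq (minProg k) (.seq (pickProg k θ) (branchProg k))).eval)
    (r := 26) (s := σ₀) (n := B ^ k)
    (I := fun i σ => (∀ x < 20, σ.reg x = s.reg x) ∧
      HasSet L 1 (B ^ k) ((stepW B k θ w)^[i] (F, 2 ^ B ^ k)).1 σ.mem ∧
      σ.reg 25 = ((stepW B k θ w)^[i] (F, 2 ^ B ^ k)).2 ∧ OnlyWork L s.mem σ.mem ∧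
      ∀ C ∈ ((stepW B k θ w)^[i] (F, 2 ^ B ^ k)).1, C < B ^ k)
    (by
      refine ⟨fun x hx => ?_, c1, ?_, fun a h1 _ => c2 a h1, hF⟩
      · rw [State.set_reg, if_neg (by omega), hσ₀, State.set_reg, if_neg (by omega), ccon x hx]
      · simp [hσ₀, State.set_reg])
    (by
      rintro i hi σ hσ ⟨i1, i2, i3, i4, i5⟩
      set p := (stepW B k θ w)^[i] (F, 2 ^ B ^ k) with hp
      obtain ⟨m1, m2⟩ := eval_minProg (by rw [i1 0 (by omega), hL]) (by rw [i1 2 (by omega), hB])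
        (by rw [i1 3 (by omega), hR]) i5 i2
      set τ := (minProg k).eval σ with hτ
      have hτreg : ∀ x, x ≠ 20 → x ≠ 21 → x ≠ 22 → x ≠ 39 → τ.reg x = σ.reg x := by
        intro x h1 h2 h3 h4
        rw [hτ, eval_reg (by simp [minProg, writes, when]; omega)]
      have t20 : ∀ x < 20, τ.reg x = s.reg x := fun x hx => by
        rw [hτreg x (by omega) (by omega) (by omega) (by omega), i1 x hx]
      obtain ⟨p1, p2⟩ := eval_pickProg (θ := θ) (F := p.1) (by rw [t20 0 (by omega), hL])
        (by rw [t20 2 (by omega), hB]) (by rw [t20 3 (by omega), hR])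
        (by rw [t20 9 (by omega), hZ]) i5 m1
      set υ := (pickProg k θ).eval τ with hυ
      have hυreg : ∀ x, x ≠ 20 → x ≠ 22 → x ≠ 23 → x ≠ 24 → x ≠ 39 → υ.reg x = τ.reg x := by
        intro x h1 h2 h3 h4 h5
        rw [hυ, eval_reg (by simp [pickProg, writes, when]; omega)]
      have u20 : ∀ x < 20, υ.reg x = s.reg x := fun x hx => by
        rw [hυreg x (by omega) (by omega) (by omega) (by omega) (by omega), t20 x hx]
      have u25 : υ.reg 25 = p.2 := by
        rw [hυreg 25 (by omega) (by omega) (by omega) (by omega) (by omega),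
          hτreg 25 (by omega) (by omega) (by omega) (by omega), i3]
      obtain ⟨b1, b2, b3⟩ := eval_branchProg (θ := θ) (F := p.1) (w := w) (q := p.2)
        (by rw [u20 0 (by omega), hL]) (by rw [u20 2 (by omega), hB])
        (by rw [u20 3 (by omega), hR]) (by rw [u20 8 (by omega), hw]) u25 p2 i5
        (by rw [p1]; exact m2.hasSet (by omega) (by omega) (by omega) i2) (by rwa [p1])
      have hev : (LoopProg.seq (minProg k) (.seq (pickProg k θ) (branchProg k))).eval σ =
          (branchProg k).eval υ := rfl
      rw [hev, Function.iterate_succ_apply', ← hp]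
      have hstep : stepW B k θ w (p.1, p.2) = stepW B k θ w p := rfl
      rw [hstep] at b1 b2
      refine ⟨fun x hx => ?_, b1, ?_, ?_, stepW_lt hB0 i5⟩
      · rw [State.set_reg, if_neg (by omega),
          eval_reg (writes_of_ok hok.2.2.1.2.2.2.2.2.2 (Or.inl hx)), u20 x hx]
      · rw [State.set_reg, if_neg (by omega), b2]
      · intro a ha1 ha2
        rw [State.set_mem, b3 a ha1, p1, m2 a ha2, i4 a ha1 ha2])
  obtain ⟨i1, i2, i3, i4, i5⟩ := this
  set σ := forState (LoopProg.seq (minProg k) (.seq (pickProg k θ) (branchProg k))).eval 26 σ₀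
    (B ^ k) with hσ
  have e : (replayProg k θ).eval s = (minProg k).eval σ := by
    have : (copyProg.eval s).reg 4 = 2 ^ B ^ k := by rw [ccon 4 (by omega), hQ]
    have h3 : σ₀.reg 3 = B ^ k := by
      rw [hσ₀, State.set_reg, if_neg (by omega), ccon 3 (by omega), hR]
    rw [hσ, ← h3, hσ₀, ← this]
    rfl
  obtain ⟨m1, m2⟩ := eval_minProg (by rw [i1 0 (by omega), hL]) (by rw [i1 2 (by omega), hB])
    (by rw [i1 3 (by omega), hR]) i5 i2
  rw [e]
  refine ⟨m1, ?_, fun a h1 h2 => ?_⟩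
  · rw [eval_reg (by simp [minProg, writes, when]), i3]; rfl
  · rw [m2 a h2, i4 a h1 h2]

end LoopProg


/-! ### The coordinates and the program that writes them -/

/-- The digit `d` is not a true literal of the half `side` under the partial assignment `x`. -/
def LitFalse (h side x d : ℕ) : Prop :=
  (d - 1) / 2 / h = side → x / 2 ^ ((d - 1) / 2 % h) % 2 ≠ (d - 1) % 2

instance (h side x d : ℕ) : Decidable (LitFalse h side x d) := by unfold LitFalse; infer_instance

/-- The partial assignment `x` for the half `side` falsifies that part of the clause. -/
def Fails (B k h side x C : ℕ) : Prop := ∀ y ∈ dec B k C, LitFalse h side x y.2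

instance (B k h side x C : ℕ) : Decidable (Fails B k h side x C) := by
  unfold Fails; infer_instance

/-- The coordinate of the point number `i` for the clause `C`. -/
def cellVal (B k h i C : ℕ) : ℕ :=
  if i / 2 ^ h = 0 then if Fails B k h (i / 2 ^ h) (i % 2 ^ h) C then 0 else 1
  else if Fails B k h (i / 2 ^ h) (i % 2 ^ h) C then 3 else 2

/-- The coordinates of the point number `i`. -/
def pointRow (B k h : ℕ) (F : Finset ℕ) (i : ℕ) : List ℕ :=
  (((List.range (B ^ k)).filter fun C => C ∈ minIds B k F).map (cellVal B k h i)) ++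
    (List.range h).map fun v => 1 + i % 2 ^ h / 2 ^ v % 2

/-- The address of the relocated memory cell `a`. -/
def relocIdx (M J a : ℕ) : ℕ := 2 * (a * M + J) + 1

theorem relocIdx_inj {M J a b : ℕ} (hM : 0 < M) : relocIdx M J a = relocIdx M J b ↔ a = b := by
  unfold relocIdx
  constructor
  · intro h
    exact Nat.eq_of_mul_eq_mul_right hM (by omega)
  · rintro rfl; rfl

/-- Even against odd addresses: the arrays and the simulated memory never interfere. -/
theorem arrAddr_ne_relocIdx (L c i M J a : ℕ) : arrAddr L c i ≠ relocIdx M J a := by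
  unfold arrAddr relocIdx
  omega

namespace LoopProg

/-- The number of the point in register `27`, without the half. -/
def halfTerm : Term := .mod (.reg 27) (.reg 5)

/-- The half of the point in register `27`. -/
def sideTerm : Term := .div (.reg 27) (.reg 5)

/-- Test whether the point in register `27` falsifies its part of the clause in register `20`. -/
def failTerm (k : ℕ) : Term :=
  .prodRange (fun j => .bool (.add (.eq (.digit (.reg 20) j) (.lit 0))
    (.add (.not (.eq (.div (.div (.sub (.digit (.reg 20) j) (.lit 1)) (.lit 2)) (.reg 1)) sideTerm))
      (.not (.eq (.mod (.div halfTerm (.load (.arr 3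
        (.mod (.div (.sub (.digit (.reg 20) j) (.lit 1)) (.lit 2)) (.reg 1))))) (.lit 2))
        (.mod (.sub (.digit (.reg 20) j) (.lit 1)) (.lit 2))))))) k

/-- The coordinate of the point in register `27` for the clause in register `20`. -/
def cellTerm (k : ℕ) : Term :=
  .sub (.lit 3) (.add (.mul (.not sideTerm) (.add (.lit 2) (failTerm k)))
    (.mul sideTerm (.not (failTerm k))))

/-- The coordinate of the point in register `27` for the bit in register `28`. -/
def bitTerm : Term :=
  .sub (.lit 2) (.not (.mod (.div halfTerm (.load (.arr 3 (.reg 28)))) (.lit 2)))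

/-- Append a coordinate to the point in register `27`. -/
def emitProg (e : Term) : LoopProg :=
  .seq (.store (relocAddr (.add (.add (.lit 2) (.mul (.reg 27) (.reg 6))) (.reg 29))) e)
    (.assign 29 (.cap (.reg 6) (.add (.reg 29) (.lit 1))))

/-- Write the coordinates of the point in register `27`. -/
def rowProg (k : ℕ) : LoopProg :=
  .seq (.assign 29 (.lit 0)) (.seq
    (.loop 20 3 (when (.load (.arr 2 (.reg 20))) (emitProg (cellTerm k))))
    (.loop 28 1 (emitProg bitTerm)))

/-- Write the instance. -/
def buildProg (k : ℕ) : LoopProg :=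
  .seq (.store (relocAddr (.lit 0)) (.reg 12)) (.seq (.store (relocAddr (.lit 1)) (.reg 6))
    (.loop 27 12 (rowProg k)))

theorem buildProg_ok {D : Set ℕ} (hD : ∀ n, 2 * n ∈ D) (k : ℕ) : (buildProg k).Ok D := by
  have h := fun c e he => Term.ok_load_arr (e := e) hD c he
  have h1 : ∀ c r, r < 40 → (Term.load (.arr c (.reg r))).Ok D := fun c r hr => h c _ hr
  have h2 : (failTerm k).Ok D := by
    refine Term.ok_prodRange (fun j => ?_) k
    have : ∀ j, (Term.load (.arr 3 (.mod (.div (.sub (.digit (.reg 20) j) (.lit 1)) (.lit 2))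
        (.reg 1)))).Ok D := fun j => h _ _ (by simp [Term.ok_digit])
    simp [Term.ok_digit, sideTerm, halfTerm, this]
  have h3 : (cellTerm k).Ok D := by simp [cellTerm, h2, sideTerm]
  have h4 : bitTerm.Ok D := by simp [bitTerm, halfTerm, h1]
  simp [buildProg, rowProg, emitProg, when, Ok, writes, h1, h3, h4, relocAddr]

theorem buildProg_tame (k : ℕ) : (buildProg k).Tame := by
  simp [buildProg, rowProg, emitProg, when, Tame, Term.Tame, Term.cap, cellTerm, bitTerm]

variable {s : State} {L B k h i M J d : ℕ} {F : Finset ℕ}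

theorem val_halfTerm (h5 : s.reg 5 = 2 ^ h) (hi : s.reg 27 = i) :
    halfTerm.val s = i % 2 ^ h := by
  simp [halfTerm, Term.val, h5, hi]

theorem val_sideTerm (h5 : s.reg 5 = 2 ^ h) (hi : s.reg 27 = i) :
    sideTerm.val s = i / 2 ^ h := by
  simp [sideTerm, Term.val, h5, hi]

/-- Expressions have fixed size, so the power of two that isolates a bit is looked up in array `3`
instead of being computed. -/
theorem val_failTerm {C : ℕ} (hL : s.reg 0 = L) (h1 : s.reg 1 = h) (hB : s.reg 2 = B)
    (h5 : s.reg 5 = 2 ^ h) (hi : s.reg 27 = i) (hC : s.reg 20 = C) (hh : 0 < h)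
    (hpow : ∀ v < h, s.mem (arrAddr L 3 v) = 2 ^ v) :
    (failTerm k).val s = if Fails B k h (i / 2 ^ h) (i % 2 ^ h) C then 1 else 0 := by
  have key : ∀ j, (Term.bool (.add (.eq (.digit (.reg 20) j) (.lit 0))
    (.add (.not (.eq (.div (.div (.sub (.digit (.reg 20) j) (.lit 1)) (.lit 2)) (.reg 1)) sideTerm))
      (.not (.eq (.mod (.div halfTerm (.load (.arr 3
        (.mod (.div (.sub (.digit (.reg 20) j) (.lit 1)) (.lit 2)) (.reg 1))))) (.lit 2))
        (.mod (.sub (.digit (.reg 20) j) (.lit 1)) (.lit 2))))))).val s =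
      if dig B C j = 0 ∨ LitFalse h (i / 2 ^ h) (i % 2 ^ h) (dig B C j) then 1 else 0 := by
    intro j
    have hp := hpow ((dig B C j - 1) / 2 % h) (Nat.mod_lt _ hh)
    simp only [Term.val_bool, Term.val, Term.val_eq, Term.val_not, Term.val_mod, Term.val_arr,
      Term.val_digit, val_sideTerm h5 hi, val_halfTerm h5 hi, hL, h1, hB, hC, hp, LitFalse]
    by_cases c1 : dig B C j = 0 <;> by_cases c2 : (dig B C j - 1) / 2 / h = i / 2 ^ h <;>
      by_cases c3 : i % 2 ^ h / 2 ^ ((dig B C j - 1) / 2 % h) % 2 = (dig B C j - 1) % 2 <;>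
      simp [c1, c2, c3]
  simp only [failTerm, Term.val_prodRange, key]
  split_ifs with hf
  · refine prod_eq_one fun j hj => if_pos ?_
    by_cases h0 : dig B C j = 0
    · exact Or.inl h0
    · exact Or.inr (hf (j, dig B C j) (mem_dec.2 ⟨mem_range.1 hj, h0, rfl⟩))
  · rw [Fails] at hf
    push Not at hf
    obtain ⟨y, hy, hy2⟩ := hf
    rw [mem_dec] at hy
    refine prod_eq_zero (mem_range.2 hy.1) (if_neg ?_)
    rw [hy.2.2]
    rintro (h0 | h0)
    · exact hy.2.1 h0
    · exact hy2 h0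

theorem val_cellTerm {C : ℕ} (hL : s.reg 0 = L) (h1 : s.reg 1 = h) (hB : s.reg 2 = B)
    (h5 : s.reg 5 = 2 ^ h) (hi : s.reg 27 = i) (hC : s.reg 20 = C) (hh : 0 < h)
    (hi2 : i < 2 ^ (h + 1)) (hpow : ∀ v < h, s.mem (arrAddr L 3 v) = 2 ^ v) :
    (cellTerm k).val s = cellVal B k h i C := by
  have hside : i / 2 ^ h < 2 := Nat.div_lt_of_lt_mul (by rw [pow_succ] at hi2; linarith)
  simp only [cellTerm, Term.val, Term.val_not, val_sideTerm h5 hi,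
    val_failTerm (k := k) hL h1 hB h5 hi hC hh hpow, cellVal]
  generalize i / 2 ^ h = x at hside
  obtain rfl | rfl : x = 0 ∨ x = 1 := by omega
  · by_cases hf : Fails B k h 0 (i % 2 ^ h) C <;> simp [hf]
  · by_cases hf : Fails B k h 1 (i % 2 ^ h) C <;> simp [hf]

theorem val_bitTerm {v : ℕ} (hL : s.reg 0 = L) (h5 : s.reg 5 = 2 ^ h) (hi : s.reg 27 = i)
    (hv : s.reg 28 = v) (hvh : v < h) (hpow : ∀ v < h, s.mem (arrAddr L 3 v) = 2 ^ v) :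
    bitTerm.val s = 1 + i % 2 ^ h / 2 ^ v % 2 := by
  simp only [bitTerm, Term.val, Term.val_not, Term.val_mod, Term.val_arr, val_halfTerm h5 hi, hL,
    hv, hpow v hvh]
  have := Nat.mod_lt (i % 2 ^ h / 2 ^ v) (show 0 < 2 by omega)
  split_ifs <;> omega

/-- The state `σ` arises from `s` by writing the first coordinates `l` of the point `i`. -/
structure RowInv (M J d i : ℕ) (s : State) (l : List ℕ) (σ : State) : Prop where
  reg : ∀ x < 20, σ.reg x = s.reg x
  point : σ.reg 27 = i
  col : σ.reg 29 = l.length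
  cell : ∀ a, σ.mem (relocIdx M J a) = if 2 + i * d ≤ a ∧ a < 2 + i * d + l.length then
    l.getD (a - (2 + i * d)) 0 else s.mem (relocIdx M J a)
  other : ∀ b, (∀ a, b ≠ relocIdx M J a) → σ.mem b = s.mem b

theorem RowInv.set {l : List ℕ} {σ : State} (h : RowInv M J d i s l σ) {x v : ℕ} (hx : 20 ≤ x)
    (h27 : x ≠ 27) (h29 : x ≠ 29) : RowInv M J d i s l (σ.set x v) := by
  refine ⟨fun y hy => ?_, ?_, ?_, h.cell, h.other⟩
  · rw [State.set_reg, if_neg (by omega), h.reg y hy]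
  · rw [State.set_reg, if_neg (by omega), h.point]
  · rw [State.set_reg, if_neg (by omega), h.col]

theorem RowInv.emit {l : List ℕ} {σ : State} (h : RowInv M J d i s l σ) (hM : 0 < M)
    (h6 : s.reg 6 = d) (h7 : s.reg 7 = M) (h10 : s.reg 10 = J) {e : Term} {v : ℕ}
    (he : e.val σ = v) (hl : l.length < d) :
    RowInv M J d i s (l ++ [v]) ((emitProg e).eval σ) := by
  have haddr : (relocAddr (.add (.add (.lit 2) (.mul (.reg 27) (.reg 6))) (.reg 29))).val σ =
      relocIdx M J (2 + i * d + l.length) := by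
    rw [relocAddr_val _ (by rw [h.reg 7 (by omega), h7]) (by rw [h.reg 10 (by omega), h10])]
    simp [Term.val, h.point, h.col, h.reg 6 (by omega), h6, relocIdx]
  have e1 : (emitProg e).eval σ =
      (σ.put (relocIdx M J (2 + i * d + l.length)) v).set 29 (l.length + 1) := by
    simp only [emitProg, eval, haddr, he]
    congr 1
    simp only [Term.val_cap, Term.val, State.put_reg, h.col, h.reg 6 (by omega), h6]
    omega
  rw [e1]
  refine ⟨fun y hy => ?_, ?_, ?_, fun a => ?_, fun b hb => ?_⟩
  · rw [State.set_reg, if_neg (by omega)]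
    exact h.reg y hy
  · rw [State.set_reg, if_neg (by omega)]
    exact h.point
  · simp [State.set_reg]
  · rw [State.set_mem, State.put_mem]
    simp only [relocIdx_inj hM, h.cell, List.length_append, List.length_singleton]
    by_cases h1 : a = 2 + i * d + l.length
    · rw [if_pos h1, if_pos (by omega), List.getD_append_right _ _ _ _ (by omega)]
      have : a - (2 + i * d) - l.length = 0 := by omega
      simp [this]
    · rw [if_neg h1]
      by_cases h2 : 2 + i * d ≤ a ∧ a < 2 + i * d + l.length
      · rw [if_pos h2, if_pos (by omega), List.getD_append _ _ _ _ (by omega)]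
      · rw [if_neg h2, if_neg (by omega)]
  · rw [State.set_mem, State.put_mem, if_neg (hb _), h.other b hb]

theorem eval_rowProg (hM : 0 < M) (hh : 0 < h) (hL : s.reg 0 = L) (h1 : s.reg 1 = h)
    (hB : s.reg 2 = B) (h3 : s.reg 3 = B ^ k) (h5 : s.reg 5 = 2 ^ h) (h6 : s.reg 6 = d)
    (h7 : s.reg 7 = M) (h10 : s.reg 10 = J) (hi : s.reg 27 = i) (hi2 : i < 2 ^ (h + 1))
    (hset : HasSet L 2 (B ^ k) (minIds B k F) s.mem)
    (hpow : ∀ v < h, s.mem (arrAddr L 3 v) = 2 ^ v)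
    (hlen : (pointRow B k h F i).length ≤ d) :
    RowInv M J d i s (pointRow B k h F i) ((rowProg k).eval s) := by
  set l1 := fun n => ((List.range n).filter fun C => C ∈ minIds B k F).map (cellVal B k h i)
    with hl1
  set l2 := fun n => (List.range n).map fun v => 1 + i % 2 ^ h / 2 ^ v % 2 with hl2
  have hrow : pointRow B k h F i = l1 (B ^ k) ++ l2 h := rfl
  rw [hrow, List.length_append] at hlen
  have hl1le : ∀ n ≤ B ^ k, (l1 n).length ≤ (l1 (B ^ k)).length := by
    intro n hn
    simp only [hl1, List.length_map]
    refine List.Sublist.length_le (List.Sublist.filter _ ?_)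
    exact List.range_sublist.2 hn
  have i0 : RowInv M J d i s [] (s.set 29 0) :=
    ⟨fun x hx => by rw [State.set_reg, if_neg (by omega)],
      by rw [State.set_reg, if_neg (by omega), hi], by simp [State.set_reg],
      fun a => by rw [if_neg (by simp)]; rfl, fun _ _ => rfl⟩
  have hmem : ∀ {l σ}, RowInv M J d i s l σ → ∀ c j, σ.mem (arrAddr L c j) = s.mem (arrAddr L c j) :=
    fun hσ c j => hσ.other _ fun a => arrAddr_ne_relocIdx _ _ _ _ _ _
  have r1 := forState_induction
    (f := (when (.load (.arr 2 (.reg 20))) (emitProg (cellTerm k))).eval) (r := 20)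
    (s := s.set 29 0) (n := B ^ k) (I := fun n σ => RowInv M J d i s (l1 n) σ)
    (by simpa [hl1] using i0.set (x := 20) (v := 0) (by omega) (by omega) (by omega))
    (by
      intro n hn σ hσ hI
      have hval : (Term.load (.arr 2 (.reg 20))).val σ = if n ∈ minIds B k F then 1 else 0 := by
        simp only [Term.val, Term.val_arr, hI.reg 0 (by omega), hL, hσ, hmem hI, hset n hn]
      rw [eval_when, hval]
      have hl1s : l1 (n + 1) = l1 n ++ if n ∈ minIds B k F then [cellVal B k h i n] else [] := by
        simp only [hl1, List.range_succ, List.filter_append, List.map_append]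
        congr 1
        split_ifs with hc <;> simp [hc]
      by_cases hc : n ∈ minIds B k F
      · rw [if_pos (by simp [hc]), hl1s, if_pos hc]
        refine RowInv.set (hI.emit hM h6 h7 h10 ?_ ?_) (by omega) (by omega) (by omega)
        · exact val_cellTerm (by rw [hI.reg 0 (by omega), hL]) (by rw [hI.reg 1 (by omega), h1])
            (by rw [hI.reg 2 (by omega), hB]) (by rw [hI.reg 5 (by omega), h5]) hI.point hσ hh hi2
            (fun v hv => by rw [hmem hI, hpow v hv])
        · have := hl1le (n + 1) (by omega)
          rw [hl1s, if_pos hc, List.length_append, List.length_singleton] at this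
          omega
      · rw [if_neg (by simp [hc]), hl1s, if_neg hc, List.append_nil]
        exact (hI.set (by omega) (by omega) (by omega)).set (by omega) (by omega) (by omega))
  set τ := forState (when (.load (.arr 2 (.reg 20))) (emitProg (cellTerm k))).eval 20
    (s.set 29 0) (B ^ k) with hτ
  have r2 := forState_induction (f := (emitProg bitTerm).eval) (r := 28) (s := τ) (n := h)
    (I := fun n σ => RowInv M J d i s (l1 (B ^ k) ++ l2 n) σ)
    (by simpa [hl2] using r1.set (x := 28) (v := 0) (by omega) (by omega) (by omega))
    (by
      intro n hn σ hσ hI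
      have hl2s : l2 (n + 1) = l2 n ++ [1 + i % 2 ^ h / 2 ^ n % 2] := by
        simp [hl2, List.range_succ]
      rw [hl2s, ← List.append_assoc]
      refine RowInv.set (hI.emit hM h6 h7 h10 ?_ ?_) (by omega) (by omega) (by omega)
      · exact val_bitTerm (by rw [hI.reg 0 (by omega), hL]) (by rw [hI.reg 5 (by omega), h5])
          hI.point hσ hn (fun v hv => by rw [hmem hI, hpow v hv])
      · simp only [hl2, List.length_append, List.length_map, List.length_range] at hlen ⊢
        omega)
  have e : (rowProg k).eval s = forState (emitProg bitTerm).eval 28 τ h := by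
    have e1 : ((loop 20 3 (when (.load (.arr 2 (.reg 20))) (emitProg (cellTerm k)))).eval
        (s.set 29 0)) = τ := by
      rw [hτ, ← h3]; rfl
    have e2 : τ.reg 1 = h := by rw [r1.reg 1 (by omega), h1]
    simp only [rowProg, eval, Term.val] at e1 ⊢
    rw [e1, e2]
  rw [e, hrow]
  exact r2

/-- The input that describes the points with the given coordinates. -/
def tableInput (N d : ℕ) (row : ℕ → List ℕ) (a : ℕ) : ℕ :=
  if a = 0 then N else if a = 1 then d else
    if a - 2 < N * d then (row ((a - 2) / d)).getD ((a - 2) % d) 0 else 0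

/-- Rows may be shorter than `d`. Their zero padding is not written but found, which is why the
relocated cells have to be fresh (`hzero`). -/
theorem eval_buildProg (hM : 0 < M) (hh : 0 < h) (hL : s.reg 0 = L) (h1 : s.reg 1 = h)
    (hB : s.reg 2 = B) (h3 : s.reg 3 = B ^ k) (h5 : s.reg 5 = 2 ^ h) (h6 : s.reg 6 = d)
    (h7 : s.reg 7 = M) (h10 : s.reg 10 = J) (h12 : s.reg 12 = 2 ^ (h + 1))
    (hset : HasSet L 2 (B ^ k) (minIds B k F) s.mem)
    (hpow : ∀ v < h, s.mem (arrAddr L 3 v) = 2 ^ v)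
    (hlen : ∀ i, (pointRow B k h F i).length ≤ d) (hzero : ∀ a, s.mem (relocIdx M J a) = 0) :
    (∀ a, ((buildProg k).eval s).mem (relocIdx M J a) =
      tableInput (2 ^ (h + 1)) d (pointRow B k h F) a) ∧
    ∀ b, (∀ a, b ≠ relocIdx M J a) → ((buildProg k).eval s).mem b = s.mem b := by
  have hd : 0 < d := by
    have := hlen 0
    simp only [pointRow, List.length_append, List.length_map, List.length_range] at this
    omega
  have hok := buildProg_ok (D := Set.univ) (fun _ => trivial) k
  set s1 := (s.put (relocIdx M J 0) (2 ^ (h + 1))).put (relocIdx M J 1) d with hs1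
  have e1 : ∀ p, (LoopProg.seq (.store (relocAddr (.lit 0)) (.reg 12))
      (.seq (.store (relocAddr (.lit 1)) (.reg 6)) p)).eval s = p.eval s1 := by
    intro p
    simp [eval, relocAddr_val _ h7 h10, Term.val, h12, h6, hs1, relocIdx,
      relocAddr_val (σ := s.put (2 * J + 1) (2 ^ (h + 1))) _ h7 h10]
  have := forState_induction (f := (rowProg k).eval) (r := 27) (s := s1) (n := 2 ^ (h + 1))
    (I := fun n σ => (∀ x < 20, σ.reg x = s.reg x) ∧
      (∀ a, σ.mem (relocIdx M J a) = if a = 0 then 2 ^ (h + 1) else if a = 1 then d else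
        if a - 2 < n * d then (pointRow B k h F ((a - 2) / d)).getD ((a - 2) % d) 0 else 0) ∧
      ∀ b, (∀ a, b ≠ relocIdx M J a) → σ.mem b = s.mem b)
    (by
      refine ⟨fun x hx => by rw [State.set_reg, if_neg (by omega)]; rfl, fun a => ?_,
        fun b hb => ?_⟩
      · rw [State.set_mem, hs1, State.put_mem, State.put_mem]
        simp only [relocIdx_inj hM, hzero]
        split_ifs <;> omega
      · rw [State.set_mem, hs1, State.put_mem, State.put_mem, if_neg (hb _), if_neg (hb _)])
    (by
      rintro n hn σ hσ ⟨j1, j2, j3⟩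
      have hmem : ∀ c j, σ.mem (arrAddr L c j) = s.mem (arrAddr L c j) :=
        fun c j => j3 _ fun a => arrAddr_ne_relocIdx _ _ _ _ _ _
      have hr := eval_rowProg (s := σ) (d := d) (F := F) hM hh (by rw [j1 0 (by omega), hL])
        (by rw [j1 1 (by omega), h1]) (by rw [j1 2 (by omega), hB])
        (by rw [j1 3 (by omega), h3]) (by rw [j1 5 (by omega), h5])
        (by rw [j1 6 (by omega), h6]) (by rw [j1 7 (by omega), h7])
        (by rw [j1 10 (by omega), h10]) hσ hn (fun j hj => by rw [hmem, hset j hj])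
        (fun v hv => by rw [hmem, hpow v hv]) (hlen n)
      refine ⟨fun x hx => ?_, fun a => ?_, fun b hb => ?_⟩
      · rw [State.set_reg, if_neg (by omega), hr.reg x hx, j1 x hx]
      · rw [State.set_mem, hr.cell, j2]
        have hlen' := hlen n
        by_cases a0 : a = 0
        · simp [a0]
        by_cases a1 : a = 1
        · simp [a1]
          omega
        simp only [a0, a1, if_false, add_mul, one_mul]
        by_cases c1 : a - 2 < n * d
        · rw [if_neg (by omega), if_pos c1, if_pos (by omega)]
        · by_cases c2 : a - 2 < n * d + d
          · have hdiv : (a - 2) / d = n := by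
              refine Nat.div_eq_of_lt_le (by omega) (by rw [add_mul, one_mul]; omega)
            have hmod : (a - 2) % d = a - (2 + n * d) := by
              have := Nat.div_add_mod (a - 2) d
              rw [hdiv, mul_comm] at this
              omega
            rw [if_neg c1, if_pos c2, hdiv, hmod]
            split_ifs with c3
            · rfl
            · rw [List.getD_eq_default _ _ (by omega)]
          · rw [if_neg (by omega), if_neg c1, if_neg c2]
      · rw [State.set_mem, hr.other b hb, j3 b hb])
  have e : (buildProg k).eval s = forState (rowProg k).eval 27 s1 (2 ^ (h + 1)) := by
    rw [buildProg, e1, eval]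
    congr 1
  rw [e]
  exact ⟨this.2.1, this.2.2⟩

end LoopProg


/-! ### The columns of the point set -/

section Rows

variable {B k h : ℕ} {F : Finset ℕ}

theorem length_pointRow (i : ℕ) (hF : ∀ C ∈ F, C < B ^ k) :
    (pointRow B k h F i).length = (minIds B k F).card + h := by
  simp only [pointRow, List.length_append, List.length_map, List.length_range]
  congr 1
  have h1 : ((List.range (B ^ k)).filter fun C => decide (C ∈ minIds B k F)).Nodup :=
    List.nodup_range.filter _
  rw [← List.toFinset_card_of_nodup h1]
  congr 1
  ext C
  simp only [List.mem_toFinset, List.mem_filter, List.mem_range, decide_eq_true_eq]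
  exact ⟨fun h => h.2, fun h => ⟨hF C (filter_subset _ _ h), h⟩⟩

/-- The type of a column is the same for all points, so distances can be estimated column by column.
The last case is the padding, where `getD` returns its default. -/
theorem pointRow_cases (B k h : ℕ) (F : Finset ℕ) (t : ℕ) :
    (∃ C ∈ minIds B k F, ∀ i, (pointRow B k h F i).getD t 0 = cellVal B k h i C) ∨
    (∃ v < h, ∀ i, (pointRow B k h F i).getD t 0 = 1 + i % 2 ^ h / 2 ^ v % 2) ∨
    ∀ i, (pointRow B k h F i).getD t 0 = 0 := by
  set l := (List.range (B ^ k)).filter fun C => decide (C ∈ minIds B k F) with hl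
  have hrow : ∀ i, pointRow B k h F i = l.map (cellVal B k h i) ++
      (List.range h).map fun v => 1 + i % 2 ^ h / 2 ^ v % 2 := fun i => rfl
  by_cases h1 : t < l.length
  · left
    refine ⟨l[t], ?_, fun i => ?_⟩
    · have hmem : l[t] ∈ l := List.getElem_mem h1
      simpa using (List.mem_filter.1 hmem).2
    · rw [hrow, List.getD_append _ _ _ _ (by simpa using h1), List.getD_eq_getElem _ _ (by simpa),
        List.getElem_map]
  · right
    by_cases h2 : t - l.length < h
    · left
      refine ⟨t - l.length, h2, fun i => ?_⟩
      rw [hrow, List.getD_append_right _ _ _ _ (by simpa using h1), List.length_map,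
        List.getD_eq_getElem _ _ (by simpa), List.getElem_map, List.getElem_range]
    · right
      intro i
      refine List.getD_eq_default _ _ ?_
      rw [hrow]
      simp only [List.length_append, List.length_map, List.length_range]
      omega

theorem exists_cell_index (hF : ∀ C ∈ F, C < B ^ k) {C : ℕ} (hC : C ∈ minIds B k F) :
    ∃ t < (minIds B k F).card + h, ∀ i, (pointRow B k h F i).getD t 0 = cellVal B k h i C := by
  set l := (List.range (B ^ k)).filter fun C => decide (C ∈ minIds B k F) with hl
  have hrow : ∀ i, pointRow B k h F i = l.map (cellVal B k h i) ++
      (List.range h).map fun v => 1 + i % 2 ^ h / 2 ^ v % 2 := fun i => rfl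
  have hmem : C ∈ l := by
    rw [hl, List.mem_filter]
    exact ⟨List.mem_range.2 (hF C (filter_subset _ _ hC)), by simpa using hC⟩
  obtain ⟨t, ht, rfl⟩ := List.getElem_of_mem hmem
  refine ⟨t, ?_, fun i => ?_⟩
  · rw [← length_pointRow 0 hF, hrow, List.length_append, List.length_map]
    omega
  · rw [hrow, List.getD_append _ _ _ _ (by simpa using ht), List.getD_eq_getElem _ _ (by simpa),
      List.getElem_map]

theorem exists_bit_index (hF : ∀ C ∈ F, C < B ^ k) {v : ℕ} (hv : v < h) :
    ∃ t < (minIds B k F).card + h,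
      ∀ i, (pointRow B k h F i).getD t 0 = 1 + i % 2 ^ h / 2 ^ v % 2 := by
  set l := (List.range (B ^ k)).filter fun C => decide (C ∈ minIds B k F) with hl
  have hrow : ∀ i, pointRow B k h F i = l.map (cellVal B k h i) ++
      (List.range h).map fun v => 1 + i % 2 ^ h / 2 ^ v % 2 := fun i => rfl
  refine ⟨l.length + v, ?_, fun i => ?_⟩
  · rw [← length_pointRow 0 hF, hrow, List.length_append, List.length_map, List.length_map,
      List.length_range]
    omega
  · rw [hrow, List.getD_append_right _ _ _ _ (by simp), List.length_map,
      List.getD_eq_getElem _ _ (by simpa), List.getElem_map, List.getElem_range]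
    simp

theorem cellVal_left {i : ℕ} (hi : i < 2 ^ h) (C : ℕ) :
    cellVal B k h i C = if Fails B k h 0 i C then 0 else 1 := by
  simp [cellVal, Nat.div_eq_of_lt hi, Nat.mod_eq_of_lt hi]

theorem cellVal_right {i : ℕ} (hi : i < 2 ^ h) (C : ℕ) :
    cellVal B k h (2 ^ h + i) C = if Fails B k h 1 i C then 3 else 2 := by
  have h1 : (2 ^ h + i) / 2 ^ h = 1 := by
    rw [Nat.add_div_left _ (by positivity), Nat.div_eq_of_lt hi]
  simp [cellVal, h1, Nat.mod_eq_of_lt hi]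

end Rows

/-! ### Completeness and soundness of the instance -/

section Geometry

/-- The points of the instance. -/
def instPoints (B k h : ℕ) (F : Finset ℕ) (d : ℕ) (i : Fin (2 ^ (h + 1))) (t : Fin d) : ℕ :=
  (pointRow B k h F i).getD t 0

variable {B k h d : ℕ} {F : Finset ℕ}

theorem linftyDist_le {n : ℕ} {p : Fin n → Fin d → ℕ} {i j : Fin n} {r : ℕ}
    (hp : ∀ t, p i t ≤ p j t + r ∧ p j t ≤ p i t + r) : linftyDist p i j ≤ r := by
  refine (dist_pi_le_iff (by positivity)).2 fun t => ?_
  rw [Real.dist_eq, abs_sub_le_iff]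
  have h1 : (p i t : ℝ) ≤ p j t + r := by exact_mod_cast (hp t).1
  have h2 : (p j t : ℝ) ≤ p i t + r := by exact_mod_cast (hp t).2
  constructor <;> linarith

theorem le_linftyDist {n : ℕ} {p : Fin n → Fin d → ℕ} {i j : Fin n} {r : ℕ} {t : Fin d}
    (hp : p i t + r ≤ p j t) : (r : ℝ) ≤ linftyDist p i j := by
  refine le_trans ?_ (dist_le_pi_dist (fun t => (p i t : ℝ)) (fun t => (p j t : ℝ)) t)
  rw [Real.dist_eq, abs_sub_comm]
  refine le_trans ?_ (le_abs_self _)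
  have h1 : (p i t : ℝ) + r ≤ p j t := by exact_mod_cast hp
  linarith

theorem linftyDist_comm {n : ℕ} (p : Fin n → Fin d → ℕ) (i j : Fin n) :
    linftyDist p i j = linftyDist p j i := dist_comm _ _

theorem cellVal_le (i C : ℕ) : cellVal B k h i C ≤ 3 := by
  unfold cellVal
  split_ifs <;> omega

theorem cellVal_same {i j : ℕ} (hij : i / 2 ^ h = j / 2 ^ h) (C : ℕ) :
    cellVal B k h i C ≤ cellVal B k h j C + 1 := by
  unfold cellVal
  rw [hij]
  split_ifs <;> omega

/-- All coordinates are at most `3`, and `0 < h` makes the number of points at least `4`. -/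
theorem instPoints_le (hh : 0 < h) (i : Fin (2 ^ (h + 1))) (t : Fin d) :
    instPoints B k h F d i t ≤ 2 ^ (h + 1) := by
  have h4 : 2 ^ 2 ≤ 2 ^ (h + 1) := Nat.pow_le_pow_right (by omega) (by omega)
  unfold instPoints
  rcases pointRow_cases B k h F t with ⟨C, -, hc⟩ | ⟨v, -, hc⟩ | hc
  · rw [hc]
    have := cellVal_le (B := B) (k := k) (h := h) i C
    omega
  · rw [hc]
    omega
  · rw [hc]
    omega

/-- Within one half a clause column takes two neighbouring values, and bit columns take the values
`1` and `2` only. -/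
theorem dist_same_le {i j : Fin (2 ^ (h + 1))} (hij : (i : ℕ) / 2 ^ h = j / 2 ^ h) :
    linftyDist (instPoints B k h F d) i j ≤ 1 := by
  have := linftyDist_le (p := instPoints B k h F d) (i := i) (j := j) (r := 1) (fun t => ?_)
  · simpa using this
  unfold instPoints
  rcases pointRow_cases B k h F t with ⟨C, -, hc⟩ | ⟨v, -, hc⟩ | hc
  · rw [hc, hc]
    exact ⟨cellVal_same hij C, cellVal_same hij.symm C⟩
  · rw [hc, hc]
    omega
  · rw [hc, hc]
    omega

theorem dist_le_three (i j : Fin (2 ^ (h + 1))) :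
    linftyDist (instPoints B k h F d) i j ≤ 3 := by
  have := linftyDist_le (p := instPoints B k h F d) (i := i) (j := j) (r := 3) (fun t => ?_)
  · simpa using this
  unfold instPoints
  rcases pointRow_cases B k h F t with ⟨C, -, hc⟩ | ⟨v, -, hc⟩ | hc
  · rw [hc, hc]
    have := cellVal_le (B := B) (k := k) (h := h) i C
    have := cellVal_le (B := B) (k := k) (h := h) j C
    omega
  · rw [hc, hc]
    omega
  · rw [hc, hc]
    omega

theorem exists_bit_ne {x y : ℕ} (hx : x < 2 ^ h) (hy : y < 2 ^ h) (hne : x ≠ y) :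
    ∃ v < h, x / 2 ^ v % 2 ≠ y / 2 ^ v % 2 := by
  by_contra hcon
  push Not at hcon
  exact hne (eq_of_dig_eq hx hy hcon)

/-- Two half assignments differ in some bit, and this bit has a column of its own. -/
theorem one_le_dist_same (hF : ∀ C ∈ F, C < B ^ k) (hd : (minIds B k F).card + h ≤ d)
    {i j : Fin (2 ^ (h + 1))} (hij : (i : ℕ) / 2 ^ h = j / 2 ^ h) (hne : i ≠ j) :
    1 ≤ linftyDist (instPoints B k h F d) i j := by
  have hpos : 0 < 2 ^ h := by positivity
  have hmod : (i : ℕ) % 2 ^ h ≠ j % 2 ^ h := by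
    intro hm
    refine hne (Fin.ext ?_)
    rw [← Nat.div_add_mod (i : ℕ) (2 ^ h), ← Nat.div_add_mod (j : ℕ) (2 ^ h), hij, hm]
  obtain ⟨v, hv, hvne⟩ := exists_bit_ne (Nat.mod_lt _ hpos) (Nat.mod_lt _ hpos) hmod
  obtain ⟨t, ht, hrow⟩ := exists_bit_index (h := h) hF hv
  have e : ∀ i, instPoints B k h F d i ⟨t, by omega⟩ = 1 + (i : ℕ) % 2 ^ h / 2 ^ v % 2 :=
    fun i => hrow i
  rcases Nat.lt_or_ge ((i : ℕ) % 2 ^ h / 2 ^ v % 2) ((j : ℕ) % 2 ^ h / 2 ^ v % 2) with hlt | hge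
  · have := le_linftyDist (p := instPoints B k h F d) (i := i) (j := j) (r := 1)
      (t := ⟨t, by omega⟩) (by rw [e, e]; omega)
    simpa using this
  · rw [linftyDist_comm]
    have := le_linftyDist (p := instPoints B k h F d) (i := j) (j := i) (r := 1)
      (t := ⟨t, by omega⟩) (by rw [e, e]; omega)
    simpa using this

/-- The point of the left half. -/
def leftPoint (h : ℕ) (x : ℕ) (hx : x < 2 ^ h) : Fin (2 ^ (h + 1)) :=
  ⟨x, by rw [pow_succ]; omega⟩

/-- The point of the right half. -/
def rightPoint (h : ℕ) (y : ℕ) (hy : y < 2 ^ h) : Fin (2 ^ (h + 1)) :=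
  ⟨2 ^ h + y, by rw [pow_succ]; omega⟩

theorem point_cases (i : Fin (2 ^ (h + 1))) :
    (∃ x hx, i = leftPoint h x hx) ∨ ∃ y hy, i = rightPoint h y hy := by
  have hi := i.2
  have h2 : 2 ^ (h + 1) = 2 ^ h + 2 ^ h := by rw [pow_succ]; omega
  rcases Nat.lt_or_ge (i : ℕ) (2 ^ h) with hlt | hge
  · exact Or.inl ⟨i, hlt, rfl⟩
  · refine Or.inr ⟨i - 2 ^ h, by omega, Fin.ext ?_⟩
    simp only [rightPoint]
    omega

theorem leftPoint_side {x : ℕ} (hx : x < 2 ^ h) : (leftPoint h x hx : ℕ) / 2 ^ h = 0 :=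
  Nat.div_eq_of_lt hx

theorem rightPoint_side {y : ℕ} (hy : y < 2 ^ h) : (rightPoint h y hy : ℕ) / 2 ^ h = 1 := by
  simp only [rightPoint]
  rw [Nat.add_div_left _ (by positivity), Nat.div_eq_of_lt hy]

theorem dist_cross_eq (hF : ∀ C ∈ F, C < B ^ k) (hd : (minIds B k F).card + h ≤ d)
    {x y : ℕ} (hx : x < 2 ^ h) (hy : y < 2 ^ h)
    (hC : ∃ C ∈ minIds B k F, Fails B k h 0 x C ∧ Fails B k h 1 y C) :
    linftyDist (instPoints B k h F d) (leftPoint h x hx) (rightPoint h y hy) = 3 := by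
  refine le_antisymm (dist_le_three _ _) ?_
  obtain ⟨C, hC, h0, h1⟩ := hC
  obtain ⟨t, ht, hrow⟩ := exists_cell_index (h := h) hF hC
  have := le_linftyDist (p := instPoints B k h F d) (i := leftPoint h x hx)
    (j := rightPoint h y hy) (r := 3) (t := ⟨t, by omega⟩) (by
      simp only [instPoints, hrow, leftPoint, rightPoint]
      rw [cellVal_left hx, cellVal_right hy, if_pos h0, if_pos h1])
  simpa using this

/-- In a clause column the difference `3` requires the values `0` and `3`, that is, both half
assignments fail on that clause. The other columns contribute at most `1`. -/
theorem dist_cross_le {x y : ℕ} (hx : x < 2 ^ h) (hy : y < 2 ^ h)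
    (hC : ∀ C ∈ minIds B k F, ¬ (Fails B k h 0 x C ∧ Fails B k h 1 y C)) :
    linftyDist (instPoints B k h F d) (leftPoint h x hx) (rightPoint h y hy) ≤ 2 := by
  have := linftyDist_le (p := instPoints B k h F d) (i := leftPoint h x hx)
    (j := rightPoint h y hy) (r := 2) (fun t => ?_)
  · simpa using this
  simp only [instPoints, leftPoint, rightPoint]
  rcases pointRow_cases B k h F t with ⟨C, hm, hc⟩ | ⟨v, -, hc⟩ | hc
  · rw [hc, hc, cellVal_left hx, cellVal_right hy]
    have := hC C hm
    split_ifs <;> first | omega | tauto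
  · rw [hc, hc]
    omega
  · rw [hc, hc]
    omega

/-- A clause column has values at most `1` on the left and at least `2` on the right. Such a column
exists because a nonempty family has a minimal clause. -/
theorem instPoints_injective (hF : ∀ C ∈ F, C < B ^ k) (hd : (minIds B k F).card + h ≤ d)
    (hne : F.Nonempty) : Function.Injective (instPoints B k h F d) := by
  intro i j hij
  by_contra hne'
  by_cases hs : (i : ℕ) / 2 ^ h = j / 2 ^ h
  · have := one_le_dist_same hF hd hs hne'
    rw [linftyDist, hij, dist_self] at this
    linarith
  · obtain ⟨C₀, hC₀⟩ := hne
    obtain ⟨C, hC, -⟩ := exists_minIds_subset hF hC₀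
    obtain ⟨t, ht, hrow⟩ := exists_cell_index (h := h) hF hC
    have h1 := congrFun hij ⟨t, by omega⟩
    simp only [instPoints, hrow] at h1
    rcases point_cases i with ⟨x, hx, rfl⟩ | ⟨y, hy, rfl⟩
    · rcases point_cases j with ⟨x', hx', rfl⟩ | ⟨y', hy', rfl⟩
      · exact hs (by rw [leftPoint_side, leftPoint_side])
      · simp only [leftPoint, rightPoint] at h1
        rw [cellVal_left hx, cellVal_right hy'] at h1
        split_ifs at h1 <;> omega
    · rcases point_cases j with ⟨x', hx', rfl⟩ | ⟨y', hy', rfl⟩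
      · simp only [leftPoint, rightPoint] at h1
        rw [cellVal_left hx', cellVal_right hy] at h1
        split_ifs at h1 <;> omega
      · exact hs (by rw [rightPoint_side, rightPoint_side])

/-- If every assignment falsifies a clause, then the instance is an ultrametric. -/
theorem hasUltrametricFit_of_unsat (hF : ∀ C ∈ F, C < B ^ k)
    (hd : (minIds B k F).card + h ≤ d) (hne : F.Nonempty)
    (hunsat : ∀ x < 2 ^ h, ∀ y < 2 ^ h,
      ∃ C ∈ minIds B k F, Fails B k h 0 x C ∧ Fails B k h 1 y C) :
    HasUltrametricFit (linftyDist (instPoints B k h F d)) 1 := by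
  have hinj : Function.Injective
      (fun (i : Fin (2 ^ (h + 1))) (t : Fin d) => (instPoints B k h F d i t : ℝ)) := by
    intro i j hij
    refine instPoints_injective hF hd hne (funext fun t => ?_)
    have h1 : (instPoints B k h F d i t : ℝ) = instPoints B k h F d j t := congrFun hij t
    exact_mod_cast h1
  have hcross : ∀ i j : Fin (2 ^ (h + 1)), (i : ℕ) / 2 ^ h ≠ j / 2 ^ h →
      linftyDist (instPoints B k h F d) i j = 3 := by
    intro i j hs
    rcases point_cases i with ⟨x, hx, rfl⟩ | ⟨y, hy, rfl⟩
    · rcases point_cases j with ⟨x', hx', rfl⟩ | ⟨y', hy', rfl⟩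
      · exact absurd (by rw [leftPoint_side, leftPoint_side]) hs
      · exact dist_cross_eq hF hd hx hy' (hunsat x hx y' hy')
    · rcases point_cases j with ⟨x', hx', rfl⟩ | ⟨y', hy', rfl⟩
      · rw [linftyDist_comm]
        exact dist_cross_eq hF hd hx' hy (hunsat x' hx' y hy)
      · exact absurd (by rw [rightPoint_side, rightPoint_side]) hs
  -- The metric of the points is its own ultrametric: distance `3` across, `1` inside each half.
  refine ⟨MetricSpace.induced _ hinj inferInstance, ?_, fun u v => ⟨le_rfl, ?_⟩⟩
  · refine @IsUltrametricDist.mk _ (MetricSpace.induced _ hinj inferInstance).toDist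
      fun i j l => ?_
    change linftyDist (instPoints B k h F d) i l ≤
      max (linftyDist (instPoints B k h F d) i j) (linftyDist (instPoints B k h F d) j l)
    by_cases h1 : (i : ℕ) / 2 ^ h = j / 2 ^ h
    · by_cases h2 : (j : ℕ) / 2 ^ h = l / 2 ^ h
      · by_cases h3 : i = j
        · rw [h3]; exact le_max_right _ _
        · exact (dist_same_le (h1.trans h2)).trans
            ((one_le_dist_same hF hd h1 h3).trans (le_max_left _ _))
      · rw [hcross j l h2]
        exact (dist_le_three _ _).trans (le_max_right _ _)
    · rw [hcross i j h1]
      exact (dist_le_three _ _).trans (le_max_left _ _)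
  · rw [one_mul]
    exact le_rfl

/-- If some but not all assignments falsify a clause, then the distortion is large. -/
theorem le_distortion_of_sat (hF : ∀ C ∈ F, C < B ^ k) (hd : (minIds B k F).card + h ≤ d)
    (hsat : ∃ x < 2 ^ h, ∃ y < 2 ^ h, ∀ C ∈ minIds B k F,
      ¬ (Fails B k h 0 x C ∧ Fails B k h 1 y C))
    (hunsat : ∃ x < 2 ^ h, ∃ y < 2 ^ h,
      ∃ C ∈ minIds B k F, Fails B k h 0 x C ∧ Fails B k h 1 y C) {α : ℝ}
    (hfit : HasUltrametricFit (linftyDist (instPoints B k h F d)) α) : 3 / 2 ≤ α := by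
  obtain ⟨Δ, hΔ, hfit⟩ := hfit
  obtain ⟨x, hx, y, hy, hxy⟩ := hsat
  obtain ⟨x', hx', y', hy', hxy'⟩ := hunsat
  by_contra hα
  push Not at hα
  have hsmall : ∀ u v, linftyDist (instPoints B k h F d) u v ≤ 2 → Δ.dist u v < 3 := by
    intro u v huv
    have h1 := (hfit u v).2
    have h0 : 0 ≤ linftyDist (instPoints B k h F d) u v := dist_nonneg
    -- Nothing is known about the sign of `α`.
    rcases le_total α 0 with hα0 | hα0
    · linarith [mul_nonpos_of_nonpos_of_nonneg hα0 h0]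
    · linarith [mul_le_mul_of_nonneg_left huv hα0]
  have hmax := hΔ.dist_triangle_max
  have h1 := hsmall _ _ (dist_cross_le (d := d) hx hy hxy)
  have h2 := hsmall (leftPoint h x' hx') (leftPoint h x hx) ((dist_same_le
    (by rw [leftPoint_side, leftPoint_side])).trans (by norm_num))
  have h3 := hsmall (rightPoint h y hy) (rightPoint h y' hy') ((dist_same_le
    (by rw [rightPoint_side, rightPoint_side])).trans (by norm_num))
  have h4 := (hfit (leftPoint h x' hx') (rightPoint h y' hy')).1
  rw [dist_cross_eq hF hd hx' hy' hxy'] at h4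
  -- The falsified pair is joined by a chain through the satisfied pair, and all three links are
  -- shorter than `3`.
  have h5 := hmax (leftPoint h x' hx') (leftPoint h x hx) (rightPoint h y' hy')
  have h6 := hmax (leftPoint h x hx) (rightPoint h y hy) (rightPoint h y' hy')
  have h7 := max_lt h2 (lt_of_le_of_lt h6 (max_lt h1 h3))
  exact absurd (lt_of_le_of_lt (h4.trans h5) h7) (lt_irrefl _)

end Geometry

/-! ### Assignments and their two halves -/

section Assignments

variable {B k h : ℕ} {F : Finset ℕ}

/-- The literal `d` is true under the assignment `a`. -/
def LitTrue (a : ℕ → ℕ) (d : ℕ) : Prop := a ((d - 1) / 2) = (d - 1) % 2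

/-- Digits are at most `4 * h`, so variables are below `2 * h`; variable `v` is bit `v % h` of the
half `v / h`. A clause is falsified exactly when both halves fail on their parts. -/
theorem satIds_iff_halves (hh : 0 < h) (hB : B = 4 * h + 1) :
    (∃ a : ℕ → ℕ, (∀ v, a v < 2) ∧ SatIds B k (LitTrue a) F) ↔
      ∃ x < 2 ^ h, ∃ y < 2 ^ h, ∀ C ∈ F, ¬ (Fails B k h 0 x C ∧ Fails B k h 1 y C) := by
  have hlit : ∀ C, ∀ z ∈ dec B k C, (z.2 - 1) / 2 / h < 2 := by
    intro C z hz
    rw [mem_dec] at hz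
    have := dig_lt (B := B) (by omega) C z.1
    refine Nat.div_lt_of_lt_mul ?_
    omega
  constructor
  · rintro ⟨a, ha, hsat⟩
    have hlow : ∀ v < h, a v < 2 := fun v _ => ha v
    have hhigh : ∀ v < h, a (h + v) < 2 := fun v _ => ha _
    refine ⟨enc 2 h a, enc_lt hlow, enc 2 h fun v => a (h + v), enc_lt hhigh, ?_⟩
    rintro C hC ⟨f0, f1⟩
    obtain ⟨z, hz, ht⟩ := hsat C hC
    rw [LitTrue] at ht
    have hv := hlit C z hz
    have hmod := Nat.mod_lt ((z.2 - 1) / 2) hh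
    have hdm := Nat.div_add_mod ((z.2 - 1) / 2) h
    have h01 : ∀ q < 2, q = 0 ∨ q = 1 := fun q hq => by omega
    obtain h0 | h0 := h01 _ hv
    · refine f0 z hz h0 ?_
      have := dig_enc hlow hmod
      rw [dig] at this
      rw [this, ← ht]
      rw [h0, mul_zero, zero_add] at hdm
      rw [hdm]
    · refine f1 z hz h0 ?_
      have := dig_enc (f := fun v => a (h + v)) hhigh hmod
      rw [dig] at this
      rw [this, ← ht]
      rw [h0, mul_one] at hdm
      simp only [hdm]
  · rintro ⟨x, -, y, -, hxy⟩
    refine ⟨fun v => if v / h = 0 then x / 2 ^ (v % h) % 2 else y / 2 ^ (v % h) % 2,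
      fun v => ?_, fun C hC => ?_⟩
    · simp only
      split_ifs <;> exact Nat.mod_lt _ (by omega)
    · by_contra hcon
      push Not at hcon
      refine hxy C hC ⟨fun z hz h0 => ?_, fun z hz h0 => ?_⟩
      · have := hcon z hz
        rw [LitTrue] at this
        simpa [h0] using this
      · have := hcon z hz
        rw [LitTrue] at this
        simpa [h0] using this

theorem dec_unit (hh : 0 < h) (hk : 0 < k) (hB : B = 4 * h + 1) :
    dec B k (4 * h) = {(0, 4 * h)} := by
  ext z
  rw [mem_dec, mem_singleton, Prod.ext_iff]
  have h0 : dig B (4 * h) 0 = 4 * h := by rw [dig_zero, Nat.mod_eq_of_lt (by omega)]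
  have hs : ∀ j, dig B (4 * h) (j + 1) = 0 := by
    intro j
    rw [dig_succ, Nat.div_eq_of_lt (by omega)]
    simp [dig]
  constructor
  · rintro ⟨h1, h2, h3⟩
    rcases hz : z.1 with _ | j
    · rw [hz, h0] at h3
      exact ⟨rfl, h3.symm⟩
    · rw [hz, hs] at h3
      omega
  · rintro ⟨h1, h2⟩
    simp only at h1 h2
    rw [h1, h2, h0]
    omega

/-- A family with the unit clause number `4 * h` is falsified by some assignment. -/
theorem exists_fails (hF : ∀ C ∈ F, C < B ^ k) (hh : 0 < h) (hk : 0 < k) (hB : B = 4 * h + 1)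
    (hunit : 4 * h ∈ F) : ∃ x < 2 ^ h, ∃ y < 2 ^ h,
      ∃ C ∈ minIds B k F, Fails B k h 0 x C ∧ Fails B k h 1 y C := by
  obtain ⟨C, hC, hsub⟩ := exists_minIds_subset hF hunit
  rw [dec_unit hh hk hB] at hsub
  -- The digit `4 * h` is the positive literal of variable `2 * h - 1`, so the zero assignment
  -- falsifies the unit clause and every clause contained in it, even the empty one.
  have hf : ∀ side, Fails B k h side 0 C := by
    intro side z hz _
    have := mem_singleton.1 (hsub hz)
    rw [this]
    simp only [Nat.zero_div, Nat.zero_mod]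
    omega
  exact ⟨0, by positivity, 0, by positivity, C, hC, hf 0, hf 1⟩

end Assignments

/-! ### The input format of the point set -/

section Encoding

theorem getD_encodePoints {N d : ℕ} (p : Fin N → Fin d → ℕ) (row : ℕ → List ℕ)
    (hp : ∀ i t, p i t = (row i).getD t 0) (a : ℕ) :
    (encodePoints p).getD a 0 = LoopProg.tableInput N d row a := by
  have hlist : (List.ofFn p).flatMap List.ofFn = List.ofFn fun x : Fin (N * d) =>
      (row ((x : ℕ) / d)).getD ((x : ℕ) % d) 0 := by
    rw [List.ofFn_mul, List.flatMap_def, List.map_ofFn]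
    congr 1
    refine congrArg _ (funext fun i => ?_)
    simp only [Function.comp]
    congr 1
    funext t
    have hd : 0 < d := by have := t.2; omega
    rw [hp, mul_comm, Nat.mul_add_div hd, Nat.div_eq_of_lt t.2, add_zero, Nat.mul_add_mod,
      Nat.mod_eq_of_lt t.2]
  rw [encodePoints, hlist, LoopProg.tableInput]
  rcases a with _ | _ | a
  · rfl
  · rfl
  · rw [if_neg (by omega), if_neg (by omega)]
    simp only [List.getD_cons_succ]
    split_ifs with hlt
    · rw [List.getD_eq_getElem _ _ (by simpa using hlt), List.getElem_ofFn]
      rfl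
    · rw [List.getD_eq_default _ _ (by simpa using hlt)]

theorem length_encodePoints {N d : ℕ} (p : Fin N → Fin d → ℕ) :
    (encodePoints p).length = 2 + N * d := by
  simp [encodePoints, List.length_flatMap, Function.comp_def]
  omega

end Encoding


/-! ### Preprocessing: powers of two and parsing -/

/-- The program runs from `s` to `s'` in time `T`, up to the bit length of the bound `V`. -/
def Runs (D : Set ℕ) (V : ℕ) (P : Program) (s : State) (T : ℕ) (s' : State) : Prop :=
  ∃ t ≤ T * Nat.size V, Exec P s s' t ∧ Bdd D V s'

section Runs

variable {D : Set ℕ} {V : ℕ} {P Q : Program} {s s₁ s₂ : State} {T T₁ T₂ : ℕ}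

theorem Runs.seq (h₁ : Runs D V P s T₁ s₁) (h₂ : Runs D V Q s₁ T₂ s₂) :
    Runs D V (.seq P Q) s (T₁ + T₂) s₂ := by
  obtain ⟨t₁, l₁, e₁, -⟩ := h₁
  obtain ⟨t₂, l₂, e₂, b₂⟩ := h₂
  exact ⟨_, by rw [add_mul]; omega, Exec.seq e₁ e₂, b₂⟩

theorem Runs.mono (h : Runs D V P s T₁ s₁) (hT : T₁ ≤ T₂) : Runs D V P s T₂ s₁ := by
  obtain ⟨t₁, l₁, e₁, b₁⟩ := h
  exact ⟨t₁, l₁.trans (Nat.mul_le_mul_right _ hT), e₁, b₁⟩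

theorem Runs.bdd (h : Runs D V P s T s₁) : Bdd D V s₁ := by
  obtain ⟨_, _, _, b⟩ := h
  exact b

theorem runs_assign (r : ℕ) {e : Term} {v : ℕ} (hok : e.Ok D) (h : Bdd D V s) (hV : 1 ≤ V)
    (hv : e.val s = v) (hle : v ≤ V) :
    Runs D V (.assign r e) s (1 + 2 * e.weight ^ 2) (s.set r v) := by
  subst hv
  refine ⟨_, ?_, Exec.assign r e s, h.set hle⟩
  have h1 := (Term.size_and_cost_le hok h hV).2
  have h2 : 1 ≤ Nat.size V := Nat.size_pos.2 hV
  rw [add_mul, one_mul]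
  omega

theorem runs_loopProg {p : LoopProg} (hok : p.Ok D) (h : Bdd D V s) (hV : 1 ≤ V)
    (hs : p.Safe V s) : Runs D V p.compile s (p.time s.reg) (p.eval s) := by
  obtain ⟨t, h1, h2⟩ := LoopProg.exec hok h hV hs (ρ := s.reg) (fun _ _ => rfl)
  exact ⟨t, h1, h2, hs.bdd hok h⟩

end Runs

namespace LoopProg

/-- The nesting depth of the loops. -/
def depth : LoopProg → ℕ
  | .assign _ _ => 0
  | .store _ _ => 0
  | .seq p q => max p.depth q.depth
  | .ite _ p q => max p.depth q.depth
  | .loop _ _ p => p.depth + 1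

/-- All loop bounds are at most `X`. -/
def BoundsLe (ρ : ℕ → ℕ) (X : ℕ) : LoopProg → Prop
  | .assign _ _ => True
  | .store _ _ => True
  | .seq p q => p.BoundsLe ρ X ∧ q.BoundsLe ρ X
  | .ite _ p q => p.BoundsLe ρ X ∧ q.BoundsLe ρ X
  | .loop _ b p => ρ b ≤ X ∧ p.BoundsLe ρ X

/-- Nested loops multiply their bounds. For a fixed program this is a constant, namely the time with
all bounds `1`, times a power of the largest bound. -/
theorem time_le {ρ : ℕ → ℕ} {X : ℕ} (hX : 1 ≤ X) {p : LoopProg} (h : p.BoundsLe ρ X) :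
    p.time ρ ≤ p.time (fun _ => 1) * X ^ p.depth := by
  induction p with
  | assign r e => simp [time, depth]
  | store a e => simp [time, depth]
  | seq p q ihp ihq =>
    have h1 := ihp h.1
    have h2 := ihq h.2
    have h3 : X ^ p.depth ≤ X ^ max p.depth q.depth := Nat.pow_le_pow_right hX (le_max_left _ _)
    have h4 : X ^ q.depth ≤ X ^ max p.depth q.depth := Nat.pow_le_pow_right hX (le_max_right _ _)
    simp only [time, depth, add_mul]
    exact add_le_add (h1.trans (Nat.mul_le_mul_left _ h3)) (h2.trans (Nat.mul_le_mul_left _ h4))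
  | ite b p q ihp ihq =>
    have h1 := ihp h.1
    have h2 := ihq h.2
    have h3 : X ^ p.depth ≤ X ^ max p.depth q.depth := Nat.pow_le_pow_right hX (le_max_left _ _)
    have h4 : X ^ q.depth ≤ X ^ max p.depth q.depth := Nat.pow_le_pow_right hX (le_max_right _ _)
    have h5 : 1 ≤ X ^ max p.depth q.depth := Nat.pow_pos hX
    simp only [time, depth, add_mul]
    refine add_le_add (add_le_add (add_le_add ?_ ?_) (h1.trans (Nat.mul_le_mul_left _ h3)))
      (h2.trans (Nat.mul_le_mul_left _ h4))
    · omega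
    · exact Nat.le_mul_of_pos_right _ h5
  | loop r b p ih =>
    have h1 := ih h.2
    have h2 : 1 ≤ X ^ p.depth := Nat.pow_pos hX
    have h3 : 1 ≤ X ^ (p.depth + 1) := Nat.pow_pos hX
    simp only [time, depth, one_mul]
    calc _ ≤ X * (p.time (fun _ => 1) * X ^ p.depth + 100 * X ^ p.depth) +
          100 * X ^ (p.depth + 1) := by
          gcongr
          · exact h.1
          · omega
          · omega
      _ = _ := by rw [pow_succ]; ring

/-- Double register `31` as often as the constant register `3` says. -/
def powerProg : LoopProg :=
  .seq (.assign 31 (.lit 1)) (.loop 32 3 (.assign 31 (.add (.reg 31) (.reg 31))))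

/-- Compute a table of powers of two in the array `3`. -/
def tableProg : LoopProg :=
  .seq (.assign 31 (.lit 1)) (.loop 28 1 (.seq (.store (.arr 3 (.reg 28)) (.reg 31))
    (.assign 31 (.add (.reg 31) (.reg 31)))))

/-- The number of the clause that is encoded from the address in register `30` on. -/
def idTerm (k : ℕ) : Term :=
  .sumRange (fun j => .mul (.mul (.not (.le (.load (.reg 30)) (.lit j)))
    (.add (.load (.add (.add (.reg 30) (.lit 1)) (.lit j))) (.lit 1))) (.pow (.reg 2) j)) k

/-- Read the formula, and write the clauses to the array `0`. -/
def parseProg (k : ℕ) : LoopProg :=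
  .seq (.assign 30 (.lit 2)) (.seq (.loop 33 13 (.seq (.store (.arr 0 (idTerm k)) (.lit 1))
    (.assign 30 (.cap (.reg 0) (.add (.add (.reg 30) (.load (.reg 30))) (.lit 1))))))
    (.store (.arr 0 (.mul (.lit 4) (.reg 1))) (.lit 1)))

theorem powerProg_ok : powerProg.Ok Set.univ := by
  simp [powerProg, Ok, writes]

theorem tableProg_ok : tableProg.Ok Set.univ := by
  simp [tableProg, Ok, writes]

theorem ok_load_univ {e : Term} : (Term.load e).Ok Set.univ ↔ e.Ok Set.univ :=
  ⟨fun h => h.1, fun h => ⟨h, fun _ => trivial⟩⟩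

theorem parseProg_ok (k : ℕ) : (parseProg k).Ok Set.univ := by
  have : (idTerm k).Ok Set.univ :=
    Term.ok_sumRange (fun j => by simp [ok_load_univ, Term.ok_pow]) k
  simp [parseProg, Ok, writes, this, ok_load_univ]

theorem parseProg_tame (k : ℕ) : (parseProg k).Tame := by
  simp [parseProg, Tame, Term.Tame, Term.cap]

variable {s : State} {V R L h : ℕ}

/-- Doubling is not tame, so safety has to come from the actual values, which never exceed `2 ^ R`.
-/
theorem powerProg_spec (hR : s.reg 3 = R) (hV : 2 ^ R ≤ V) :
    powerProg.Safe V s ∧ (powerProg.eval s).mem = s.mem ∧ (powerProg.eval s).reg 31 = 2 ^ R := by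
  have key : ∀ i, (forState (LoopProg.assign 31 (.add (.reg 31) (.reg 31))).eval 32
      (s.set 31 1) i).mem = s.mem ∧
      (forState (LoopProg.assign 31 (.add (.reg 31) (.reg 31))).eval 32
        (s.set 31 1) i).reg 31 = 2 ^ i := by
    intro i
    refine forState_induction (I := fun i σ => σ.mem = s.mem ∧ σ.reg 31 = 2 ^ i) ?_ ?_
    · simp [State.set_reg]
    · rintro i - σ - ⟨h1, h2⟩
      simp [eval, State.set_reg, h1, h2, Term.val, pow_succ]
      omega
  have h3 : (s.set 31 1).reg 3 = R := by simp [State.set_reg, hR]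
  refine ⟨⟨?_, ?_⟩, ?_⟩
  · exact le_trans Nat.one_le_two_pow hV
  · intro i hi
    simp only [eval, Term.val] at hi ⊢
    rw [h3] at hi
    change State.reg _ 31 + State.reg _ 31 ≤ V
    refine le_trans (le_of_eq (congrArg₂ (· + ·) (key i).2 (key i).2)) ?_
    calc 2 ^ i + 2 ^ i = 2 ^ (i + 1) := by rw [pow_succ]; ring
      _ ≤ 2 ^ R := Nat.pow_le_pow_right (by omega) hi
      _ ≤ V := hV
  · simp only [powerProg, eval, Term.val]
    rw [h3]
    exact key R

theorem tableProg_spec (hL : s.reg 0 = L) (h1 : s.reg 1 = h) (hV : 2 ^ h ≤ V) :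
    tableProg.Safe V s ∧ OnlyArr L 3 s.mem (tableProg.eval s).mem ∧
      (tableProg.eval s).reg 31 = 2 ^ h ∧
      ∀ v < h, (tableProg.eval s).mem (arrAddr L 3 v) = 2 ^ v := by
  have key : ∀ i, (forState (LoopProg.seq (.store (.arr 3 (.reg 28)) (.reg 31))
      (.assign 31 (.add (.reg 31) (.reg 31)))).eval 28 (s.set 31 1) i).reg 0 = L ∧
      OnlyArr L 3 s.mem (forState (LoopProg.seq (.store (.arr 3 (.reg 28)) (.reg 31))
      (.assign 31 (.add (.reg 31) (.reg 31)))).eval 28 (s.set 31 1) i).mem ∧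
      (forState (LoopProg.seq (.store (.arr 3 (.reg 28)) (.reg 31))
      (.assign 31 (.add (.reg 31) (.reg 31)))).eval 28 (s.set 31 1) i).reg 31 = 2 ^ i ∧
      ∀ v < i, (forState (LoopProg.seq (.store (.arr 3 (.reg 28)) (.reg 31))
      (.assign 31 (.add (.reg 31) (.reg 31)))).eval 28 (s.set 31 1) i).mem
        (arrAddr L 3 v) = 2 ^ v := by
    intro i
    refine forState_induction (I := fun i σ => σ.reg 0 = L ∧ OnlyArr L 3 s.mem σ.mem ∧
      σ.reg 31 = 2 ^ i ∧ ∀ v < i, σ.mem (arrAddr L 3 v) = 2 ^ v) ?_ ?_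
    · exact ⟨by simp [State.set_reg, hL], OnlyArr.refl _ _ _, by simp [State.set_reg], by simp⟩
    · rintro i - σ hσ ⟨i0, i1, i2, i3⟩
      have e : (LoopProg.seq (.store (.arr 3 (.reg 28)) (.reg 31))
          (.assign 31 (.add (.reg 31) (.reg 31)))).eval σ =
          (σ.put (arrAddr L 3 i) (2 ^ i)).set 31 (2 ^ i + 2 ^ i) := by
        simp [eval, Term.val_arr, Term.val, i0, hσ, i2]
      rw [e]
      refine ⟨by simp [State.set_reg, i0], i1.trans OnlyArr.put, ?_, fun v hv => ?_⟩
      · simp [State.set_reg, pow_succ]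
        omega
      · rw [State.set_mem, State.set_mem, State.put_mem]
        simp only [arrAddr_inj (L := L) (show 3 < 4 by omega) (show 3 < 4 by omega), true_and]
        split_ifs with hvi
        · rw [hvi]
        · exact i3 v (by omega)
  have h3 : (s.set 31 1).reg 1 = h := by simp [State.set_reg, h1]
  refine ⟨⟨?_, ?_⟩, ?_⟩
  · exact le_trans Nat.one_le_two_pow hV
  · intro i hi
    simp only [eval, Term.val] at hi
    rw [h3] at hi
    have h2 : 2 ^ (i + 1) ≤ V := (Nat.pow_le_pow_right (by omega) hi).trans hV
    obtain ⟨-, -, k2, -⟩ := key i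
    rw [pow_succ] at h2
    constructor
    · change State.reg _ 31 ≤ V
      refine le_trans (le_of_eq k2) ?_
      omega
    · change State.reg _ 31 + State.reg _ 31 ≤ V
      refine le_trans (le_of_eq (congrArg₂ (· + ·) k2 k2)) ?_
      omega
  · simp only [tableProg, eval, Term.val]
    rw [h3]
    exact (key h).2

/-- The number of a clause, given as the list of the codes of its literals. -/
def clauseId (B k : ℕ) (c : List ℕ) : ℕ :=
  enc B k fun j => if j < c.length then c.getD j 0 + 1 else 0

/-- The input cells of the clauses. -/
def flatClauses (cs : List (List ℕ)) : List ℕ := cs.flatMap fun c => c.length :: c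

theorem getD_flatClauses {cs : List (List ℕ)} {i : ℕ} (hi : i < cs.length) :
    (flatClauses cs).getD (flatClauses (cs.take i)).length 0 = cs[i].length ∧
      ∀ j < cs[i].length,
        (flatClauses cs).getD ((flatClauses (cs.take i)).length + 1 + j) 0 = cs[i].getD j 0 := by
  have hsplit : flatClauses cs = flatClauses (cs.take i) ++
      (cs[i].length :: (cs[i] ++ flatClauses (cs.drop (i + 1)))) := by
    have h1 : cs = cs.take i ++ cs[i] :: cs.drop (i + 1) := by
      rw [← List.drop_eq_getElem_cons hi, List.take_append_drop]
    calc flatClauses cs = flatClauses (cs.take i ++ cs[i] :: cs.drop (i + 1)) := congrArg _ h1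
      _ = _ := by
        rw [flatClauses, List.flatMap_append, List.flatMap_cons]
        rfl
  rw [hsplit]
  refine ⟨?_, fun j hj => ?_⟩
  · rw [List.getD_append_right _ _ _ _ le_rfl]
    simp
  · rw [List.getD_append_right _ _ _ _ (by omega), show
      (flatClauses (cs.take i)).length + 1 + j - (flatClauses (cs.take i)).length = j + 1 by omega,
      List.getD_cons_succ, List.getD_append _ _ _ _ hj]

theorem length_flatClauses_take {cs : List (List ℕ)} {i : ℕ} (hi : i < cs.length) :
    (flatClauses (cs.take (i + 1))).length =
      (flatClauses (cs.take i)).length + cs[i].length + 1 := by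
  rw [List.take_succ_eq_append_getElem hi, flatClauses, flatClauses, List.flatMap_append,
    List.length_append, List.flatMap_cons, List.flatMap_nil, List.append_nil, List.length_cons]
  rfl

theorem length_flatClauses_take_le (cs : List (List ℕ)) (i : ℕ) :
    (flatClauses (cs.take i)).length ≤ (flatClauses cs).length := by
  have h1 : flatClauses cs = flatClauses (cs.take i) ++ flatClauses (cs.drop i) := by
    rw [flatClauses, flatClauses, flatClauses, ← List.flatMap_append, List.take_append_drop]
  rw [h1, List.length_append]
  omega

/-- Array `0` starts at address `2 * L`, behind the input, so the clauses not yet read remain intact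
while others are stored. The last store adds the unit clause of the fresh variable. -/
theorem parseProg_spec {k B n : ℕ} {cs : List (List ℕ)} (hL : s.reg 0 = L) (h1 : s.reg 1 = h)
    (hB : s.reg 2 = B) (hm : s.reg 13 = cs.length) (hlen : L = 2 + (flatClauses cs).length)
    (hinput : ∀ a < L, s.mem a = (n :: cs.length :: flatClauses cs).getD a 0)
    (hzero : ∀ i, s.mem (arrAddr L 0 i) = 0) :
    HasSet L 0 (B ^ k) (insert (4 * h) (cs.map (clauseId B k)).toFinset)
      ((parseProg k).eval s).mem ∧ OnlyArr L 0 s.mem ((parseProg k).eval s).mem := by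
  have := forState_induction (f := (LoopProg.seq (.store (.arr 0 (idTerm k)) (.lit 1))
    (.assign 30 (.cap (.reg 0) (.add (.add (.reg 30) (.load (.reg 30))) (.lit 1))))).eval)
    (r := 33) (s := s.set 30 2) (n := cs.length)
    (I := fun i σ => σ.reg 0 = L ∧ σ.reg 1 = h ∧ σ.reg 2 = B ∧
      σ.reg 30 = 2 + (flatClauses (cs.take i)).length ∧
      HasSet L 0 (B ^ k) ((cs.take i).map (clauseId B k)).toFinset σ.mem ∧
      OnlyArr L 0 s.mem σ.mem)
    ⟨by simp [State.set_reg, hL], by simp [State.set_reg, h1], by simp [State.set_reg, hB],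
      by simp [State.set_reg, flatClauses], fun i _ => by simp [hzero], OnlyArr.refl _ _ _⟩
    (by
      rintro i hi σ hσ ⟨i0, i1, i2, i30, is, io⟩
      obtain ⟨g1, g2⟩ := getD_flatClauses hi
      have hnext := length_flatClauses_take hi
      have hle := length_flatClauses_take_le cs (i + 1)
      have hread : ∀ a < L, σ.mem a = (n :: cs.length :: flatClauses cs).getD a 0 := by
        intro a ha
        rw [io a fun j hj => by rw [hj, arrAddr] at ha; omega, hinput a ha]
      set p := 2 + (flatClauses (cs.take i)).length with hp
      have hc : σ.mem p = cs[i].length := by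
        rw [hread p (by omega), hp, add_comm 2]
        simpa using g1
      have hl : ∀ j < cs[i].length, σ.mem (p + 1 + j) = cs[i].getD j 0 := by
        intro j hj
        rw [hread _ (by omega), show p + 1 + j = (flatClauses (cs.take i)).length + 1 + j + 2 by omega]
        simpa using g2 j hj
      have hid : (idTerm k).val σ = clauseId B k cs[i] := by
        simp only [idTerm, clauseId, enc, Term.val_sumRange, Term.val, Term.val_not, Term.val_le,
          Term.val_pow, i2, i30, hc]
        refine sum_congr rfl fun j _ => ?_
        congr 1
        by_cases hj : j < cs[i].length
        · simp [hj, hl j hj]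
        · simp [hj]
      have e : (LoopProg.seq (.store (.arr 0 (idTerm k)) (.lit 1))
          (.assign 30 (.cap (.reg 0) (.add (.add (.reg 30) (.load (.reg 30))) (.lit 1))))).eval σ =
          (σ.put (arrAddr L 0 (clauseId B k cs[i])) 1).set 30
            (2 + (flatClauses (cs.take (i + 1))).length) := by
        have hne : p ≠ arrAddr L 0 (clauseId B k cs[i]) := by
          rw [arrAddr]; omega
        simp only [eval, Term.val_arr, Term.val, hid, i0, Term.val_cap, State.put_reg, i30,
          State.put_mem, if_neg hne, hc]
        congr 1
        omega
      rw [e]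
      refine ⟨by simp [State.set_reg, i0], by simp [State.set_reg, i1], by simp [State.set_reg, i2],
        by simp [State.set_reg], ?_, io.trans OnlyArr.put⟩
      have hset : ((cs.take (i + 1)).map (clauseId B k)).toFinset =
          insert (clauseId B k cs[i]) ((cs.take i).map (clauseId B k)).toFinset := by
        rw [List.take_succ_eq_append_getElem hi, List.map_append]
        ext x
        rw [List.mem_toFinset, mem_insert, List.mem_toFinset, List.mem_append]
        simp only [List.map_cons, List.map_nil, List.mem_singleton]
        exact or_comm
      rw [hset]
      exact hasSet_put (by omega) is)
  set τ := forState (LoopProg.seq (.store (.arr 0 (idTerm k)) (.lit 1))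
    (.assign 30 (.cap (.reg 0) (.add (.add (.reg 30) (.load (.reg 30))) (.lit 1))))).eval 33
    (s.set 30 2) cs.length with hτ
  obtain ⟨j0, j1, j2, -, js, jo⟩ := this
  have e : (parseProg k).eval s = τ.put (arrAddr L 0 (4 * h)) 1 := by
    have h13 : (s.set 30 2).reg 13 = cs.length := by simp [State.set_reg, hm]
    have h2 : (parseProg k).eval s = (LoopProg.store (.arr 0 (.mul (.lit 4) (.reg 1)))
        (.lit 1)).eval (forState (LoopProg.seq (.store (.arr 0 (idTerm k)) (.lit 1))
          (.assign 30 (.cap (.reg 0) (.add (.add (.reg 30) (.load (.reg 30))) (.lit 1))))).eval 33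
          (s.set 30 2) ((s.set 30 2).reg 13)) := rfl
    rw [h2, h13, ← hτ]
    simp only [eval, Term.val_arr, Term.val, j0, j1]
  rw [e]
  rw [List.take_length] at js
  exact ⟨hasSet_put (by omega) js, jo.trans OnlyArr.put⟩

end LoopProg


/-! ### One round, and the loop over all leaves -/

open LoopProg

/-- One round of the algorithm: compute the leaf for the path in register `8`, write the instance,
run the program on it, record the result, and proceed to the next leaf. -/
def roundProg (k : ℕ) (θ : ℕ → ℕ) (P : Program) : Program :=
  .seq (replayProg k θ).compile (.seq (.assign 10 (.add (.reg 8) (.reg 0)))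
    (.seq (buildProg k).compile (.seq (resetProg (P.regBound + 1)) (.seq (.assign 40 (.reg 14))
      (.seq P.reloc (.seq (.assign 11 (.bool (.add (.reg 11) (.not (.reg 40)))))
        (.assign 8 (.cap (.reg 4) (.add (.reg 8) (.reg 25))))))))))

/-- The constants of the algorithm. -/
structure Consts (k h L d : ℕ) (s : State) : Prop where
  length : s.reg 0 = L
  half : s.reg 1 = h
  base : s.reg 2 = 4 * h + 1
  ids : s.reg 3 = (4 * h + 1) ^ k
  paths : s.reg 4 = 2 ^ (4 * h + 1) ^ k
  side : s.reg 5 = 2 ^ h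
  dim : s.reg 6 = d
  factor : s.reg 7 = 2 ^ (4 * h + 1) ^ k + L
  keys : s.reg 9 = (k + 1) ^ 2 * (4 * h + 1) ^ k
  points : s.reg 12 = 2 ^ (h + 1)
  input : s.reg 14 = 2 + 2 ^ (h + 1) * d

theorem Consts.congr {k h L d : ℕ} {s s' : State} (c : Consts k h L d s)
    (hr : ∀ r < 20, r ≠ 8 → r ≠ 10 → r ≠ 11 → s'.reg r = s.reg r) : Consts k h L d s' := by
  constructor <;> rw [hr _ (by omega) (by omega) (by omega) (by omega)]
  exacts [c.length, c.half, c.base, c.ids, c.paths, c.side, c.dim, c.factor, c.keys, c.points,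
    c.input]

/-- The state before the round for the path `w`. -/
structure Ready (k h L d nr V w : ℕ) (F : Finset ℕ) (s : State) : Prop where
  consts : Consts k h L d s
  path : s.reg 8 = w
  input : HasSet L 0 ((4 * h + 1) ^ k) F s.mem
  powers : ∀ v < h, s.mem (arrAddr L 3 v) = 2 ^ v
  fresh : ∀ w', w ≤ w' → w' < 2 ^ (4 * h + 1) ^ k → ∀ a,
    s.mem (relocIdx (2 ^ (4 * h + 1) ^ k + L) (w' + L) a) = 0
  idle : ∀ r, 40 + nr ≤ r → s.reg r = 0
  bdd : Bdd {a | Even a} V s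

/-- The offset is the residue modulo `M` of half the address, rounded down. Rounds with different
paths therefore use disjoint memory, and nothing has to be erased after a simulation. -/
theorem relocIdx_ne {M J J' : ℕ} (hJ : J < M) (hJ' : J' < M) (hne : J ≠ J') (a a' : ℕ) :
    relocIdx M J a ≠ relocIdx M J' a' := by
  unfold relocIdx
  intro h
  have h1 : (a * M + J) % M = (a' * M + J') % M := by
    congr 1
    omega
  rw [mul_comm a, mul_comm a', Nat.mul_add_mod, Nat.mul_add_mod, Nat.mod_eq_of_lt hJ,
    Nat.mod_eq_of_lt hJ'] at h1
  exact hne h1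

theorem exec_round {k h L d V w q t Tm : ℕ} {θ : ℕ → ℕ} {P : Program} {F F' : Finset ℕ}
    {s s' : State} (hh : 0 < h) (hL : 0 < L) (hV3 : 3 ≤ V)
    (hV1 : 2 ^ (4 * h + 1) ^ k + L ≤ V) (hV2 : 2 + 2 ^ (h + 1) * d ≤ V)
    (htime : ∀ ρ : ℕ → ℕ, ρ 1 = h → ρ 3 = (4 * h + 1) ^ k →
      ρ 9 = (k + 1) ^ 2 * (4 * h + 1) ^ k → ρ 12 = 2 ^ (h + 1) →
      (replayProg k θ).time ρ + (buildProg k).time ρ ≤ Tm)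
    (hs : Ready k h L d (P.regBound + 1) V w F s) (hF : ∀ C ∈ F, C < (4 * h + 1) ^ k)
    (hF' : F' = (replay (4 * h + 1) k θ F w).1) (hq : q = (replay (4 * h + 1) k θ F w).2)
    (hF'lt : ∀ C ∈ F', C < (4 * h + 1) ^ k)
    (hcard : (minIds (4 * h + 1) k F').card + h ≤ d) (hq0 : 0 < q)
    (hwq : w + q ≤ 2 ^ (4 * h + 1) ^ k)
    (hrun : Exec P (State.init (encodePoints (instPoints (4 * h + 1) k h F' d))) s' t) :
    ∃ σ, ∃ t' ≤ (2 * Tm + 4 * P.regBound + 300 + 100 * t) * Nat.size V,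
      Exec (roundProg k θ P) s σ t' ∧ Ready k h L d (P.regBound + 1) V (w + q) F σ ∧
      σ.reg 11 = if s.reg 11 ≠ 0 ∨ s'.reg 0 = 0 then 1 else 0 := by
  have hD : ∀ n, 2 * n ∈ {a : ℕ | Even a} := fun n => even_two_mul n
  have c0 := hs.consts
  -- the leaf
  have okr := replayProg_ok hD k θ
  have r1 := runs_loopProg okr hs.bdd (by omega)
    ((replayProg_tame k θ).safe okr hs.bdd hV3)
  obtain ⟨m1, q1, o1⟩ := eval_replayProg (θ := θ) (by omega) c0.length c0.base c0.ids c0.paths c0.keys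
    hs.path hF hs.input
  rw [← hF'] at m1
  rw [← hq] at q1
  set s1 := (replayProg k θ).eval s with hs1
  have k1 : ∀ x, x < 20 ∨ 40 ≤ x → s1.reg x = s.reg x := fun x hx => eval_reg (writes_of_ok okr hx) s
  have c1 : Consts k h L d s1 := c0.congr fun r hr _ _ _ => k1 r (Or.inl hr)
  -- the offset
  have r2 := runs_assign (s := s1) (V := V) (D := {a : ℕ | Even a}) 10
    (e := .add (.reg 8) (.reg 0)) (v := w + L)
    (by simp) r1.bdd (by omega)
    (by simp [Term.val, k1, hs.path, c0.length]) (by omega)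
  set s2 := s1.set 10 (w + L) with hs2
  have k2 : ∀ x, x ≠ 10 → s2.reg x = s1.reg x := fun x hx => by
    rw [hs2, State.set_reg, if_neg hx]
  have c2 : Consts k h L d s2 := c1.congr fun r hr _ h10 _ => k2 r h10
  have h10 : s2.reg 10 = w + L := by simp [hs2, State.set_reg]
  -- the instance
  have hrel : ∀ w' a, s2.mem (relocIdx (2 ^ (4 * h + 1) ^ k + L) (w' + L) a) =
      s.mem (relocIdx (2 ^ (4 * h + 1) ^ k + L) (w' + L) a) := fun w' a =>
    o1 _ (fun i => (arrAddr_ne_relocIdx _ _ _ _ _ _).symm)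
      (fun i => (arrAddr_ne_relocIdx _ _ _ _ _ _).symm)
  have harr : ∀ c i, c < 4 → c ≠ 1 → c ≠ 2 → s2.mem (arrAddr L c i) = s.mem (arrAddr L c i) := by
    intro c i hc h1 h2
    refine o1 _ (fun j hj => ?_) (fun j hj => ?_)
    · exact h1 ((arrAddr_inj hc (by omega)).1 hj).1
    · exact h2 ((arrAddr_inj hc (by omega)).1 hj).1
  have okb := buildProg_ok hD k
  have r3 := runs_loopProg okb r2.bdd (by omega) ((buildProg_tame k).safe okb r2.bdd hV3)
  obtain ⟨m3, o3⟩ := eval_buildProg (s := s2) (by omega) hh c2.length c2.half c2.base c2.ids c2.side c2.dim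
    c2.factor h10 c2.points m1
    (fun v hv => by rw [harr 3 v (by omega) (by omega) (by omega), hs.powers v hv])
    (fun i => by rw [length_pointRow i hF'lt]; exact hcard)
    (fun a => by rw [hrel w a]; exact hs.fresh w le_rfl (by omega) a)
  set s3 := (buildProg k).eval s2 with hs3
  have k3 : ∀ x, x < 20 ∨ 40 ≤ x → s3.reg x = s2.reg x := fun x hx =>
    eval_reg (writes_of_ok okb hx) s2
  have k3' : s3.reg 25 = q := by
    rw [hs3, eval_reg (by simp [buildProg, rowProg, emitProg, when, writes]) s2, k2 _ (by omega), q1]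
  -- the reset
  obtain ⟨s4, t4, l4, e4, m4, k4, z4, i4⟩ := exec_resetProg (P.regBound + 1) s3
  have z4' : ∀ r, 40 ≤ r → s4.reg r = 0 := by
    intro r hr
    rcases Nat.lt_or_ge r (40 + (P.regBound + 1)) with h1 | h1
    · exact z4 r hr h1
    · refine i4 r ?_
      rw [k3 r (Or.inr hr), k2 r (by omega), k1 r (Or.inr hr), hs.idle r h1]
  have b4 : Bdd {a : ℕ | Even a} V s4 :=
    ⟨fun r hr => by rw [k4 r hr]; exact r3.bdd.reg r hr, fun a ha => by rw [m4]; exact r3.bdd.mem a ha⟩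
  have k4' : ∀ x < 20, x ≠ 10 → s4.reg x = s.reg x := fun x hx h1 => by
    rw [k4 x (by omega), k3 x (Or.inl hx), k2 x h1, k1 x (Or.inl hx)]
  have c4 : Consts k h L d s4 := c0.congr fun r hr _ h1 _ => k4' r hr h1
  have r5 := runs_assign (s := s4) (V := V) (D := {a : ℕ | Even a}) 40 (e := .reg 14)
    (v := 2 + 2 ^ (h + 1) * d) (by simp) b4 (by omega) c4.input hV2
  set s5 := s4.set 40 (2 + 2 ^ (h + 1) * d) with hs5
  have k5 : ∀ x < 40, s5.reg x = s4.reg x := fun x hx => by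
    rw [hs5, State.set_reg, if_neg (by omega)]
  have hsim : Sim (2 ^ (4 * h + 1) ^ k + L) (w + L)
      (State.init (encodePoints (instPoints (4 * h + 1) k h F' d))) s5 := by
    refine ⟨fun r => ?_, fun a => ?_, ?_, ?_⟩
    · simp only [State.init, Function.update_apply, length_encodePoints, hs5, State.set_reg]
      by_cases hr : r = 0
      · simp [hr]
      · rw [if_neg (by omega), if_neg hr, z4' _ (by omega)]
    · have := m3 a
      rw [relocIdx] at this
      simp only [State.init]
      rw [hs5, State.set_mem, m4, this]
      refine (getD_encodePoints _ _ (fun i t => rfl) _).symm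
    · rw [k5 7 (by omega)]; exact c4.factor
    · rw [k5 10 (by omega), k4 10 (by omega), k3 10 (by omega), h10]
  obtain ⟨s6, t6, l6, e6, sim6, out6⟩ := exec_reloc (by omega) hrun hsim
  -- The simulated program may store huge numbers, but only in odd cells and in registers from `40`
  -- on.
  have b6 : Bdd {a : ℕ | Even a} V s6 := by
    refine ⟨fun r hr => by rw [out6.reg r hr]; exact r5.bdd.reg r hr, fun a ha => ?_⟩
    rw [out6.mem a fun b hb => ?_]
    · exact r5.bdd.mem a ha
    · rw [hb] at ha
      exact Nat.not_even_two_mul_add_one _ ha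
  have k6 : ∀ x < 20, x ≠ 10 → s6.reg x = s.reg x := fun x hx h1 => by
    rw [out6.reg x (by omega), k5 x (by omega), k4' x hx h1]
  have h40 : s6.reg 40 = s'.reg 0 := sim6.reg 0
  have e7 := Exec.assign 11 (.bool (.add (.reg 11) (.not (.reg 40)))) s6
  have v7 : (Term.bool (.add (.reg 11) (.not (.reg 40)))).val s6 =
      if s.reg 11 ≠ 0 ∨ s'.reg 0 = 0 then 1 else 0 := by
    simp only [Term.val_bool, Term.val, Term.val_not, h40, k6 11 (by omega) (by omega)]
    by_cases h1 : s.reg 11 = 0 <;> by_cases h2 : s'.reg 0 = 0 <;> simp [h1, h2]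
  rw [v7] at e7
  set v := if s.reg 11 ≠ 0 ∨ s'.reg 0 = 0 then 1 else 0 with hv
  have hv1 : v ≤ 1 := by rw [hv]; split_ifs <;> omega
  have b7 : Bdd {a : ℕ | Even a} V (s6.set 11 v) := b6.set (by omega)
  have r8 := runs_assign (s := s6.set 11 v) (V := V) (D := {a : ℕ | Even a}) 8
    (e := .cap (.reg 4) (.add (.reg 8) (.reg 25))) (v := w + q) (by simp) b7 (by omega)
    (by
      simp only [Term.val_cap, Term.val, State.set_reg]
      norm_num
      rw [k6 4 (by omega) (by omega), k6 8 (by omega) (by omega), c0.paths, hs.path,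
        out6.reg 25 (by omega), k5 25 (by omega), k4 25 (by omega), k3']
      exact Nat.min_eq_right hwq) (by omega)
  obtain ⟨t1, l1, e1, -⟩ := r1
  obtain ⟨t2, l2, e2, -⟩ := r2
  obtain ⟨t3, l3, e3, -⟩ := r3
  obtain ⟨t5, l5, e5, -⟩ := r5
  obtain ⟨t8, l8, e8, b8⟩ := r8
  refine ⟨_, _, ?_, .seq e1 (.seq e2 (.seq e3 (.seq e4 (.seq e5 (.seq e6 (.seq e7 e8)))))),
    ?_, ?_⟩
  · have hS : 1 ≤ Nat.size V := Nat.size_pos.2 (by omega)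
    have a1 : (replayProg k θ).time s.reg ≤ Tm :=
      le_trans (Nat.le_add_right _ _) (htime s.reg c0.half c0.ids c0.keys c0.points)
    have a3 : (buildProg k).time s2.reg ≤ Tm :=
      le_trans (Nat.le_add_left _ _) (htime s2.reg c2.half c2.ids c2.keys c2.points)
    have b1 := l1.trans (Nat.mul_le_mul_right _ a1)
    have b3 := l3.trans (Nat.mul_le_mul_right _ a3)
    -- The slowdown of the simulation is `31` times a sum of three terms, each at most `Nat.size V`.
    have b6' : t6 ≤ 93 * t * Nat.size V := by
      have h1 := Nat.size_le_size hV1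
      have h2 : Nat.size (w + L) ≤ Nat.size V := Nat.size_le_size (by omega)
      calc t6 ≤ 31 * (Nat.size V + Nat.size V + Nat.size V) * t := by
            refine l6.trans (Nat.mul_le_mul_right _ (Nat.mul_le_mul_left _ ?_))
            omega
        _ = _ := by ring
    -- Register `40` may exceed `V`; its length is controlled by the running time of the simulated
    -- program.
    have c7 : (Term.bool (.add (.reg 11) (.not (.reg 40)))).cost s6 ≤ 30 + 3 * Nat.size V + t := by
      have h1 : Nat.size (s6.reg 11) ≤ Nat.size V := Nat.size_le_size (b6.reg 11 (by omega))
      have h2 : Nat.size (s6.reg 40) ≤ Nat.size V + t := by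
        rw [h40]
        refine (hrun.size_reg_le 0).trans (Nat.add_le_add_right (Nat.size_le_size ?_) _)
        simpa [State.init, length_encodePoints] using hV2
      have h3 : ∀ x, Nat.size (1 - x) ≤ 1 := fun x =>
        (Nat.size_le_size (Nat.sub_le 1 x)).trans (by simp)
      have h4 := size_add_le (s6.reg 11) (1 - s6.reg 40)
      have h5 := h3 (s6.reg 40)
      have h6 := h3 (s6.reg 11 + (1 - s6.reg 40))
      have h7 := h3 (1 - (s6.reg 11 + (1 - s6.reg 40)))
      simp only [Term.bool, Term.not, Term.cost, Term.val, Nat.size_one]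
      omega
    simp only [Term.weight, Term.cap] at l2 l5 l8
    norm_num at l2 l5 l8
    have d1 : 1 * t ≤ Nat.size V * t := Nat.mul_le_mul_right _ hS
    have d2 : P.regBound * 1 ≤ P.regBound * Nat.size V := Nat.mul_le_mul_left _ hS
    have e0 : (2 * Tm + 4 * P.regBound + 300 + 100 * t) * Nat.size V =
      2 * (Tm * Nat.size V) + 4 * (P.regBound * Nat.size V) + 300 * Nat.size V +
        100 * (Nat.size V * t) := by ring
    have e1' : 93 * t * Nat.size V = 93 * (Nat.size V * t) := by ring
    rw [e0]
    rw [e1'] at b6'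
    omega
  · have mem6 : ∀ b, (∀ a, b ≠ relocIdx (2 ^ (4 * h + 1) ^ k + L) (w + L) a) →
        s6.mem b = s2.mem b := by
      intro b hb
      rw [out6.mem b hb, hs5, State.set_mem, m4, o3 b hb]
    refine ⟨?_, by simp [State.set_reg], ?_, ?_, ?_, ?_, b8⟩
    · refine c0.congr fun r hr h8 h1 h11 => ?_
      rw [State.set_reg, if_neg h8, State.set_reg, if_neg h11, k6 r hr h1]
    · intro i hi
      rw [State.set_mem, State.set_mem, mem6 _ fun a => arrAddr_ne_relocIdx _ _ _ _ _ _,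
        harr 0 i (by omega) (by omega) (by omega), hs.input i hi]
    · intro i hi
      rw [State.set_mem, State.set_mem, mem6 _ fun a => arrAddr_ne_relocIdx _ _ _ _ _ _,
        harr 3 i (by omega) (by omega) (by omega), hs.powers i hi]
    · intro w' h1 h2 a
      rw [State.set_mem, State.set_mem, mem6 _ (relocIdx_ne (by omega) (by omega) (by omega) a),
        hrel, hs.fresh w' (by omega) h2]
    · intro r hr
      rw [State.set_reg, if_neg (by omega), State.set_reg, if_neg (by omega)]
      obtain ⟨x, rfl⟩ : ∃ x, r = x + 40 := ⟨r - 40, by omega⟩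
      rw [sim6.reg, hrun.reg_of_regBound_le (by omega)]
      simp only [State.init, Function.update_apply]
      rw [if_neg (by omega)]
  · simp [State.set_reg]


/-- The program rejects the instance for the given clauses if and only if they are satisfiable. -/
theorem exists_exec_instPoints {P : Program} {C : ℕ} {T : ℕ → ℝ} {k h d : ℕ} {F : Finset ℕ}
    (hP : DistinguishesULT P (fun n => C * Nat.clog 2 n) T)
    (hd : d = C * Nat.clog 2 (2 ^ (h + 1))) (hh : 0 < h) (hk : 0 < k)
    (hF : ∀ E ∈ F, E < (4 * h + 1) ^ k) (hcard : (minIds (4 * h + 1) k F).card + h ≤ d)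
    (hunit : 4 * h ∈ F) :
    ∃ s t, Exec P (State.init (encodePoints (instPoints (4 * h + 1) k h F d))) s t ∧
      (t : ℝ) ≤ T (2 ^ (h + 1)) ∧ (s.reg 0 = 0 ↔
        ∃ a : ℕ → ℕ, (∀ v, a v < 2) ∧ SatIds (4 * h + 1) k (LitTrue a) F) := by
  have hsat : (∃ a : ℕ → ℕ, (∀ v, a v < 2) ∧ SatIds (4 * h + 1) k (LitTrue a) F) ↔
      ∃ x < 2 ^ h, ∃ y < 2 ^ h, ∀ E ∈ minIds (4 * h + 1) k F,
        ¬ (Fails (4 * h + 1) k h 0 x E ∧ Fails (4 * h + 1) k h 1 y E) := by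
    rw [← satIds_iff_halves hh rfl]
    simp only [satIds_minIds hF]
  subst hd
  obtain ⟨hacc, hrej⟩ := hP (2 ^ (h + 1)) Nat.one_le_two_pow
    (instPoints (4 * h + 1) k h F (C * Nat.clog 2 (2 ^ (h + 1))))
    (instPoints_injective hF hcard ⟨_, hunit⟩) (instPoints_le hh)
  rw [hsat]
  by_cases hs : ∃ x < 2 ^ h, ∃ y < 2 ^ h, ∀ E ∈ minIds (4 * h + 1) k F,
      ¬ (Fails (4 * h + 1) k h 0 x E ∧ Fails (4 * h + 1) k h 1 y E)
  · obtain ⟨s, t, e, ht, h0⟩ := hrej fun α hα =>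
      le_distortion_of_sat hF hcard hs (exists_fails hF hh hk rfl hunit) hα
    exact ⟨s, t, e, ht, by simp only [h0, hs]⟩
  · obtain ⟨s, t, e, ht, h0⟩ := hacc (hasUltrametricFit_of_unsat hF hcard ⟨_, hunit⟩ (by
      push Not at hs
      exact hs))
    exact ⟨s, t, e, ht, by simp only [h0, hs]⟩

/-- Register `11` collects the disjunction of the answers at the leaves. An assignment that
satisfies a leaf satisfies `F`, which the leaf contains; conversely an assignment that satisfies `F`
satisfies some visited leaf. -/
theorem exec_rounds {P : Program} {k h L d V T Tm : ℕ} {θ : ℕ → ℕ} {F : Finset ℕ}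
    (hθ : ∀ j, 1 ≤ θ j) (hh : 0 < h) (hL : 0 < L) (hV3 : 3 ≤ V)
    (hV1 : 2 ^ (4 * h + 1) ^ k + L ≤ V) (hV2 : 2 + 2 ^ (h + 1) * d ≤ V)
    (htime : ∀ ρ : ℕ → ℕ, ρ 1 = h → ρ 3 = (4 * h + 1) ^ k →
      ρ 9 = (k + 1) ^ 2 * (4 * h + 1) ^ k → ρ 12 = 2 ^ (h + 1) →
      (replayProg k θ).time ρ + (buildProg k).time ρ ≤ Tm)
    (hF : ∀ C ∈ F, C < (4 * h + 1) ^ k) (hunit : 4 * h ∈ F)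
    (hcard : ∀ F' : Finset ℕ, (∀ C ∈ F', C < (4 * h + 1) ^ k) → pick (4 * h + 1) k θ F' = none →
      (minIds (4 * h + 1) k F').card + h ≤ d)
    (hrun : ∀ F' : Finset ℕ, (∀ C ∈ F', C < (4 * h + 1) ^ k) → pick (4 * h + 1) k θ F' = none →
      4 * h ∈ F' → ∃ s, ∃ t ≤ T,
        Exec P (State.init (encodePoints (instPoints (4 * h + 1) k h F' d))) s t ∧
        (s.reg 0 = 0 ↔ ∃ a : ℕ → ℕ, (∀ v, a v < 2) ∧ SatIds (4 * h + 1) k (LitTrue a) F'))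
    {s : State} (hs : Ready k h L d (P.regBound + 1) V 0 F s) (h11 : s.reg 11 = 0) :
    ∃ σ, ∃ t ≤ leaves (4 * h + 1) k θ ((4 * h + 1) ^ k) F *
        ((2 * Tm + 4 * P.regBound + 400 + 100 * T) * Nat.size V) + 20 * Nat.size V,
      Exec (.while (.sub (.reg 4) (.reg 8)) (roundProg k θ P)) s σ t ∧ σ.reg 11 ≤ V ∧
      (σ.reg 11 ≠ 0 ↔
        ∃ a : ℕ → ℕ, (∀ v, a v < 2) ∧ SatIds (4 * h + 1) k (LitTrue a) F) := by
  obtain ⟨o1, o2, o3⟩ := orbit (by omega) hθ hF ⟨_, hunit⟩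
  set B := 4 * h + 1 with hB
  set m := leaves B k θ (B ^ k) F with hm
  set f : ℕ → ℕ := fun j => (nextPath B k θ F)^[j] 0 with hf
  have fsucc : ∀ j, f (j + 1) = f j + (replay B k θ F (f j)).2 := fun j =>
    Function.iterate_succ_apply' _ _ _
  have fle : ∀ j, j ≤ m → f j ≤ 2 ^ B ^ k := by
    intro j hj
    rcases Nat.lt_or_eq_of_le hj with h1 | rfl
    · exact (o2 j h1).1.le
    · exact o1.le
  -- A weight zero would stop the odometer below `2 ^ B ^ k`, which it is known to reach.
  have fpos : ∀ j < m, 0 < (replay B k θ F (f j)).2 := by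
    intro j hj
    by_contra h0
    have hfix : nextPath B k θ F (f j) = f j := by
      rw [nextPath]
      omega
    have h1 : f m = f j := by
      have h2 : m = (m - j) + j := by omega
      rw [h2, hf]
      simp only
      rw [Function.iterate_add_apply]
      exact Function.iterate_fixed hfix _
    have h2 := (o2 j hj).1
    have h3 : f m = 2 ^ B ^ k := o1
    have h4 : f j < 2 ^ B ^ k := h2
    omega
  set S := fun j => ∃ a : ℕ → ℕ, (∀ v, a v < 2) ∧ SatIds B k (LitTrue a) (replay B k θ F (f j)).1
    with hS
  have hS1 : 1 ≤ Nat.size V := Nat.size_pos.2 (by omega)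
  have htest : ∀ {s w}, Ready k h L d (P.regBound + 1) V w F s →
      (Term.sub (.reg 4) (.reg 8)).val s = 2 ^ B ^ k - w ∧
      (Term.sub (.reg 4) (.reg 8)).cost s ≤ 18 * Nat.size V := by
    intro s w hs
    refine ⟨by simp [Term.val, hs.consts.paths, hs.path, hB], ?_⟩
    have := (Term.size_and_cost_le (e := .sub (.reg 4) (.reg 8)) (by simp) hs.bdd (by omega)).2
    simpa [Term.weight] using this
  have key : ∀ r i, i + r = m → ∀ s, Ready k h L d (P.regBound + 1) V (f i) F s →
      ∃ σ, ∃ t ≤ r * ((2 * Tm + 4 * P.regBound + 400 + 100 * T) * Nat.size V) + 20 * Nat.size V,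
        Exec (.while (.sub (.reg 4) (.reg 8)) (roundProg k θ P)) s σ t ∧ σ.reg 11 ≤ V ∧
        (σ.reg 11 ≠ 0 ↔ s.reg 11 ≠ 0 ∨ ∃ j, i ≤ j ∧ j < m ∧ S j) := by
    intro r
    induction r with
    | zero =>
      intro i hi s hs
      obtain ⟨v1, v2⟩ := htest hs
      obtain rfl : i = m := by omega
      refine ⟨s, _, ?_, Exec.while_false ?_, hs.bdd.reg 11 (by omega), ?_⟩
      · omega
      · rw [v1, show f m = 2 ^ B ^ k from o1, Nat.sub_self]
      · refine ⟨Or.inl, fun h1 => h1.resolve_right ?_⟩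
        rintro ⟨j, h2, h3, -⟩
        omega
    | succ r ih =>
      intro i hi s hs
      obtain ⟨v1, v2⟩ := htest hs
      obtain ⟨p1, p2, p3, p4⟩ := o2 i (by omega)
      obtain ⟨s', t, ht, he, hiff⟩ := hrun _ p3 p2 (p4 hunit)
      obtain ⟨σ, t', ht', he', hr', h11'⟩ := exec_round hh hL hV3 hV1 hV2 htime hs hF rfl rfl p3
        (hcard _ p3 p2) (fpos i (by omega)) (by rw [← fsucc]; exact fle _ (by omega)) he
      rw [← hB, ← fsucc] at hr'
      obtain ⟨σ', t'', ht'', he'', hle, hans⟩ := ih (i + 1) (by omega) σ hr'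
      refine ⟨σ', _, ?_, Exec.while_true ?_ he' he'', hle, ?_⟩
      · have e1 : (2 * Tm + 4 * P.regBound + 300 + 100 * t) * Nat.size V + 19 * Nat.size V ≤
            (2 * Tm + 4 * P.regBound + 400 + 100 * T) * Nat.size V := by
          rw [← add_mul]
          refine Nat.mul_le_mul_right _ ?_
          omega
        rw [add_mul r, one_mul]
        omega
      · rw [v1]
        have : f i < 2 ^ B ^ k := p1
        omega
      · have hiff' : s'.reg 0 = 0 ↔ S i := hiff
        have h1 : σ.reg 11 ≠ 0 ↔ s.reg 11 ≠ 0 ∨ S i := by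
          rw [h11', ← hiff']
          split_ifs with hc <;> simp [hc]
        rw [hans, h1]
        constructor
        · rintro ((h1 | h1) | ⟨j, h1, h2, h3⟩)
          · exact Or.inl h1
          · exact Or.inr ⟨i, le_rfl, by omega, h1⟩
          · exact Or.inr ⟨j, by omega, h2, h3⟩
        · rintro (h1 | ⟨j, h1, h2, h3⟩)
          · exact Or.inl (Or.inl h1)
          · rcases Nat.lt_or_eq_of_le h1 with h4 | rfl
            · exact Or.inr ⟨j, h4, h2, h3⟩
            · exact Or.inl (Or.inr h3)
  obtain ⟨σ, t, ht, he, hle, hans⟩ := key m 0 (by omega) s hs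
  refine ⟨σ, t, ht, he, hle, hans.trans ?_⟩
  constructor
  · rintro (h1 | ⟨j, -, h2, a, h3, h4⟩)
    · exact absurd h11 h1
    · exact ⟨a, h3, fun C hC => h4 C ((o2 j h2).2.2.2 hC)⟩
  · rintro ⟨a, h1, h2⟩
    obtain ⟨j, hj, h3⟩ := o3 _ h2
    exact Or.inr ⟨j, Nat.zero_le _, hj, a, h1, h3⟩

/-- A bound for the running times of the parts of one round. -/
theorem exists_time_le (k : ℕ) (θ : ℕ → ℕ) : ∃ c e : ℕ, ∀ (ρ : ℕ → ℕ) (X : ℕ), 1 ≤ X → ρ 1 ≤ X →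
    ρ 3 ≤ X → ρ 9 ≤ X →
    (replayProg k θ).time ρ + (buildProg k).time ρ ≤ c * X ^ e * (ρ 12 + 1) := by
  set a := (replayProg k θ).time (fun _ => 1)
  set b := (rowProg k).time (fun _ => 1)
  set c := (buildProg k).time (fun _ => 0)
  refine ⟨a + b + c + 100, (replayProg k θ).depth + (rowProg k).depth, fun ρ X hX h1 h3 h9 => ?_⟩
  have t1 : (replayProg k θ).time ρ ≤ a * X ^ (replayProg k θ).depth :=
    time_le hX (by
      simp [replayProg, copyProg, minProg, pickProg, branchProg, petalsProg, when, BoundsLe, h3, h9])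
  have t2 : (rowProg k).time ρ ≤ b * X ^ (rowProg k).depth :=
    time_le hX (by simp [rowProg, emitProg, when, BoundsLe, h1, h3])
  -- Only the loop over the points has an exponential bound. It is not nested in another loop, so
  -- register `12` enters linearly.
  have t3 : (buildProg k).time ρ = c + ρ 12 * ((rowProg k).time ρ + 100) := by
    simp only [c, buildProg, time]
    omega
  have p1 : X ^ (replayProg k θ).depth ≤ X ^ ((replayProg k θ).depth + (rowProg k).depth) :=
    Nat.pow_le_pow_right hX (by omega)
  have p2 : X ^ (rowProg k).depth ≤ X ^ ((replayProg k θ).depth + (rowProg k).depth) :=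
    Nat.pow_le_pow_right hX (by omega)
  set Y := X ^ ((replayProg k θ).depth + (rowProg k).depth)
  have p3 : 1 ≤ Y := Nat.pow_pos hX
  have t1' := t1.trans (Nat.mul_le_mul_left _ p1)
  have t2' := t2.trans (Nat.mul_le_mul_left _ p2)
  rw [t3]
  calc _ ≤ a * Y + (c * Y + ρ 12 * (b * Y + 100 * Y)) := by
        gcongr
        · exact Nat.le_mul_of_pos_right _ p3
        · omega
    _ ≤ _ := by
      nlinarith [Nat.zero_le (a * Y * ρ 12), Nat.zero_le (c * Y * ρ 12), Nat.zero_le (b * Y),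
        Nat.zero_le Y]


/-! ### Initialization -/

/-- Compute the constants, and read the formula. -/
def initProg (k C : ℕ) : Program :=
  .seq (.assign 1 (.add (.div (.load (.lit 0)) (.lit 2)) (.lit 1)))
    (.seq (.assign 2 (.add (.mul (.lit 4) (.reg 1)) (.lit 1)))
    (.seq (.assign 3 (.pow (.reg 2) k))
    (.seq (.assign 9 (.mul (.lit ((k + 1) ^ 2)) (.reg 3)))
    (.seq (.assign 13 (.load (.lit 1)))
    (.seq (.assign 6 (.mul (.lit C) (.add (.reg 1) (.lit 1))))
    (.seq powerProg.compile
    (.seq (.assign 4 (.reg 31))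
    (.seq (.assign 7 (.add (.reg 4) (.reg 0)))
    (.seq tableProg.compile
    (.seq (.assign 5 (.reg 31))
    (.seq (.assign 12 (.mul (.lit 2) (.reg 5)))
    (.seq (.assign 14 (.add (.lit 2) (.mul (.reg 12) (.reg 6))))
    (parseProg k).compile))))))))))))

theorem length_le_length_flatClauses (l : List (List ℕ)) : l.length ≤ (flatClauses l).length := by
  induction l with
  | nil => simp
  | cons a l ih =>
    have e : flatClauses (a :: l) = (a.length :: a) ++ flatClauses l := rfl
    rw [e, List.length_append, List.length_cons, List.length_cons]
    omega

-- With `h = n / 2 + 1` there are more than `n` variables, so variable `2 * h - 1` is fresh. Before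
-- the first simulation all memory cells are bounded, hence the domain `Set.univ`; only the even
-- cells are kept for `Ready`.
set_option maxHeartbeats 1000000 in
theorem runs_initProg (k C : ℕ) : ∃ c : ℕ, ∀ {n nr V X L h d : ℕ} {cs : List (List ℕ)} {s : State},
    s = State.init (n :: cs.length :: flatClauses cs) → L = 2 + (flatClauses cs).length →
    h = n / 2 + 1 → d = C * (h + 1) → 4 * h + 1 ≤ X → (4 * h + 1) ^ k ≤ X →
    (k + 1) ^ 2 * (4 * h + 1) ^ k ≤ X → L ≤ X → X ≤ V → 2 ^ (h + 1) ≤ V →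
    2 ^ (4 * h + 1) ^ k + L ≤ V → 2 + 2 ^ (h + 1) * d ≤ V →
    (∀ a ∈ n :: cs.length :: flatClauses cs, a ≤ V) →
    ∃ s', Runs Set.univ V (initProg k C) s (c * X) s' ∧ s'.reg 11 = 0 ∧
      Ready k h L d nr V 0 (insert (4 * h) (cs.map (clauseId (4 * h + 1) k)).toFinset) s' := by
  refine ⟨10000 + 2 * (Term.pow (.reg 2) k).weight ^ 2 +
    2 * (Term.mul (.lit ((k + 1) ^ 2)) (.reg 3)).weight ^ 2 +
    2 * (Term.mul (.lit C) (.add (.reg 1) (.lit 1))).weight ^ 2 + powerProg.time (fun _ => 1) +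
    tableProg.time (fun _ => 1) + (parseProg k).time (fun _ => 1), fun {n nr V X L h d cs s} hs hL hh hd hB hR hZ hLX hXV hN hV1 hV2 hin => ?_⟩
  have hm : cs.length ≤ L := by
    have := length_le_length_flatClauses cs
    omega
  have hinput : ∀ a, s.mem a = (n :: cs.length :: flatClauses cs).getD a 0 := fun a => by
    rw [hs]; rfl
  have hreg0 : s.reg 0 = L := by
    rw [hs, hL]
    simp [State.init]
    omega
  have hreg : ∀ r, r ≠ 0 → s.reg r = 0 := by
    intro r hr
    rw [hs]
    simp [State.init, hr]
  have hzero : ∀ a, L ≤ a → s.mem a = 0 := by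
    intro a ha
    rw [hinput]
    refine List.getD_eq_default _ _ ?_
    simp only [List.length_cons]
    omega
  have hX1 : 1 ≤ X := by omega
  have hV : 1 ≤ V := by omega
  have b0 : Bdd Set.univ V s := by
    refine ⟨fun r _ => ?_, fun a _ => ?_⟩
    · by_cases hr : r = 0
      · rw [hr, hreg0]; omega
      · rw [hreg r hr]; omega
    · rw [hinput]
      by_cases ha : a < (n :: cs.length :: flatClauses cs).length
      · rw [List.getD_eq_getElem _ _ ha]
        exact hin _ (List.getElem_mem ha)
      · rw [List.getD_eq_default _ _ (by omega)]
        omega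
  have hdV : d ≤ V := by
    have : d ≤ 2 ^ (h + 1) * d := Nat.le_mul_of_pos_left _ (by positivity)
    omega
  have hNh : 2 ^ (h + 1) = 2 * 2 ^ h := by rw [pow_succ]; ring
  have hm0 : s.mem 0 = n := by rw [hinput]; rfl
  have hm1 : s.mem 1 = cs.length := by rw [hinput]; rfl
  have ok1 : ∀ c, (Term.load (.lit c)).Ok Set.univ := fun c => ⟨trivial, fun _ => trivial⟩
  have r1 := runs_assign (s := s) (V := V) (D := Set.univ) 1
    (e := .add (.div (.load (.lit 0)) (.lit 2)) (.lit 1)) (v := h) (by simp [ok1]) b0 hV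
    (by simp [Term.val, hm0, hh]) (by omega)
  have r2 := runs_assign 2 (e := .add (.mul (.lit 4) (.reg 1)) (.lit 1)) (v := 4 * h + 1)
    (by simp) r1.bdd hV (by simp [Term.val, State.set_reg]) (by omega)
  have r3 := runs_assign 3 (e := .pow (.reg 2) k) (v := (4 * h + 1) ^ k)
    (Term.ok_pow (by simp) _) r2.bdd hV (by simp [State.set_reg, Term.val]) (by omega)
  have r4 := runs_assign 9 (e := .mul (.lit ((k + 1) ^ 2)) (.reg 3))
    (v := (k + 1) ^ 2 * (4 * h + 1) ^ k)
    (by simp) r3.bdd hV (by simp [State.set_reg, Term.val]) (by omega)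
  have r5 := runs_assign 13 (e := .load (.lit 1)) (v := cs.length)
    (ok1 1) r4.bdd hV (by simp [Term.val, hm1]) (by omega)
  have r6 := runs_assign 6 (e := .mul (.lit C) (.add (.reg 1) (.lit 1))) (v := d)
    (by simp) r5.bdd hV (by simp [Term.val, State.set_reg, hd]) (by omega)
  set s6 := (((((s.set 1 h).set 2 (4 * h + 1)).set 3 ((4 * h + 1) ^ k)).set 9
    ((k + 1) ^ 2 * (4 * h + 1) ^ k)).set 13 cs.length).set 6 d with hs6
  have e0 : s6.reg 0 = L := by simp [hs6, State.set_reg, hreg0]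
  have e1 : s6.reg 1 = h := by simp [hs6, State.set_reg]
  have e2 : s6.reg 2 = 4 * h + 1 := by simp [hs6, State.set_reg]
  have e3 : s6.reg 3 = (4 * h + 1) ^ k := by simp [hs6, State.set_reg]
  have e9 : s6.reg 9 = (k + 1) ^ 2 * (4 * h + 1) ^ k := by simp [hs6, State.set_reg]
  have e13 : s6.reg 13 = cs.length := by simp [hs6, State.set_reg]
  have e6 : s6.reg 6 = d := by simp [hs6, State.set_reg]
  have ez : ∀ r, r = 8 ∨ r = 11 ∨ 40 ≤ r → s6.reg r = 0 := by
    intro r hr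
    rw [hs6]
    simp only [State.set_reg]
    rw [if_neg (by omega), if_neg (by omega), if_neg (by omega), if_neg (by omega),
      if_neg (by omega), if_neg (by omega), hreg r (by omega)]
  obtain ⟨p1, p2, p3⟩ := powerProg_spec (s := s6) (V := V) e3 (by omega)
  have r7 := (runs_loopProg powerProg_ok r6.bdd hV p1).mono
    (time_le (X := X) hX1 (by simp only [powerProg, BoundsLe, e3]; simpa using hR))
  set s7 := powerProg.eval s6 with hs7
  have k7 : ∀ x, x < 20 ∨ 40 ≤ x → s7.reg x = s6.reg x := fun x hx =>
    eval_reg (writes_of_ok powerProg_ok hx) s6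
  have r8 := runs_assign 4 (e := .reg 31) (v := 2 ^ (4 * h + 1) ^ k) (by simp) r7.bdd hV p3
    (by omega)
  have r9 := runs_assign 7 (e := .add (.reg 4) (.reg 0)) (v := 2 ^ (4 * h + 1) ^ k + L) (by simp)
    r8.bdd hV (by simp [Term.val, State.set_reg, k7, e0]) (by omega)
  set s9 := (s7.set 4 (2 ^ (4 * h + 1) ^ k)).set 7 (2 ^ (4 * h + 1) ^ k + L) with hs9
  have k9 : ∀ x, x < 20 ∨ 40 ≤ x → x ≠ 4 → x ≠ 7 → s9.reg x = s6.reg x := by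
    intro x hx h4 h7
    rw [hs9, State.set_reg, if_neg h7, State.set_reg, if_neg h4, k7 x hx]
  obtain ⟨q1, q2, q3, q4⟩ := tableProg_spec (s := s9) (V := V) (L := L) (h := h)
    (by simp [k9, e0]) (by simp [k9, e1]) (by omega)
  have r10 := (runs_loopProg tableProg_ok r9.bdd hV q1).mono
    (time_le (X := X) hX1 (by
      simp only [tableProg, BoundsLe]
      rw [k9 1 (by omega) (by omega) (by omega), e1]
      simp
      omega))
  set s10 := tableProg.eval s9 with hs10
  have k10 : ∀ x, x < 20 ∨ 40 ≤ x → s10.reg x = s9.reg x := fun x hx =>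
    eval_reg (writes_of_ok tableProg_ok hx) s9
  have r11 := runs_assign 5 (e := .reg 31) (v := 2 ^ h) (by simp) r10.bdd hV q3
    (by omega)
  have r12 := runs_assign 12 (e := .mul (.lit 2) (.reg 5)) (v := 2 ^ (h + 1)) (by simp)
    r11.bdd hV (by simp [Term.val, State.set_reg, hNh]) hN
  have r13 := runs_assign 14 (e := .add (.lit 2) (.mul (.reg 12) (.reg 6)))
    (v := 2 + 2 ^ (h + 1) * d) (by simp)
    r12.bdd hV (by simp [Term.val, State.set_reg, k10, k9, e6]) hV2
  set s13 := ((s10.set 5 (2 ^ h)).set 12 (2 ^ (h + 1))).set 14 (2 + 2 ^ (h + 1) * d) with hs13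
  have k13 : ∀ x, x < 20 ∨ 40 ≤ x → x ≠ 4 → x ≠ 7 → x ≠ 5 → x ≠ 12 → x ≠ 14 →
      s13.reg x = s6.reg x := by
    intro x hx h4 h7 h5 h12 h14
    rw [hs13, State.set_reg, if_neg h14, State.set_reg, if_neg h12, State.set_reg, if_neg h5,
      k10 x hx, k9 x hx h4 h7]
  have mem13 : ∀ a, (∀ i, a ≠ arrAddr L 3 i) → s13.mem a = s.mem a := by
    intro a ha
    have h1 : s13.mem a = s9.mem a := q2 a ha
    have h2 : s9.mem a = s6.mem a := congrFun p2 a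
    rw [h1, h2]
    rfl
  have harr : ∀ c i, c < 3 → s13.mem (arrAddr L c i) = 0 := by
    intro c i hc
    rw [mem13 _ fun j hj => by have := (arrAddr_inj (by omega) (by omega)).1 hj; omega]
    exact hzero _ (by unfold arrAddr; omega)
  have okp := parseProg_ok k
  have r14 := (runs_loopProg okp r13.bdd hV
    ((parseProg_tame k).safe okp r13.bdd (by omega))).mono
    (time_le (X := X) hX1 (by
      simp only [parseProg, BoundsLe]
      rw [k13 13 (by omega) (by omega) (by omega) (by omega) (by omega) (by omega), e13]
      simp
      omega))
  have c13 : Consts k h L d s13 := by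
    constructor
    case paths =>
      rw [hs13]
      simp [State.set_reg, k10, hs9]
    case factor =>
      rw [hs13]
      simp [State.set_reg, k10, hs9]
    case side => simp [hs13, State.set_reg]
    case points => simp [hs13, State.set_reg]
    case input => simp [hs13, State.set_reg]
    all_goals
      rw [k13 _ (by omega) (by omega) (by omega) (by omega) (by omega) (by omega)]
      assumption
  obtain ⟨u1, u2⟩ := parseProg_spec (s := s13) (k := k) (n := n) (cs := cs) c13.length c13.half
    c13.base (by rw [k13 13 (by omega) (by omega) (by omega) (by omega) (by omega) (by omega), e13])
    hL (fun a ha => by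
      rw [mem13 a fun i hi => by rw [hi] at ha; unfold arrAddr at ha; omega, hinput a])
    (fun i => harr 0 i (by omega))
  set s14 := (parseProg k).eval s13 with hs14
  have k14 : ∀ x, x < 20 ∨ 40 ≤ x → s14.reg x = s13.reg x := fun x hx =>
    eval_reg (writes_of_ok okp hx) s13
  have kz : ∀ r, r = 8 ∨ r = 11 ∨ 40 ≤ r → s14.reg r = 0 := by
    intro r hr
    rw [k14 r (by omega), k13 r (by omega) (by omega) (by omega) (by omega) (by omega) (by omega),
      ez r hr]
  refine ⟨s14, ?_, kz 11 (by omega), c13.congr fun r hr _ _ _ => k14 r (Or.inl hr), kz 8 (by omega),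
    u1, ?_, ?_, fun r hr => kz r (by omega), ⟨r14.bdd.reg, fun a _ => r14.bdd.mem a trivial⟩⟩
  · refine (r1.seq (r2.seq (r3.seq (r4.seq (r5.seq (r6.seq (r7.seq (r8.seq (r9.seq (r10.seq
      (r11.seq (r12.seq (r13.seq r14))))))))))))).mono ?_
    have d1 : powerProg.depth = 1 := rfl
    have d2 : tableProg.depth = 1 := rfl
    have d3 : (parseProg k).depth = 1 := rfl
    rw [d1, d2, d3, pow_one]
    generalize (Term.pow (.reg 2) k).weight ^ 2 = x1
    generalize (Term.mul (.lit ((k + 1) ^ 2)) (.reg 3)).weight ^ 2 = x2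
    generalize (Term.mul (.lit C) (.add (.reg 1) (.lit 1))).weight ^ 2 = x3
    generalize powerProg.time (fun _ => 1) = y1
    generalize tableProg.time (fun _ => 1) = y2
    generalize (parseProg k).time (fun _ => 1) = y3
    have s2 : Nat.size 2 = 2 := by decide
    have s4 : Nat.size 4 = 3 := by decide
    have s0 : Nat.size 0 = 0 := by decide
    simp only [Term.weight, Nat.size_one, s2, s4, s0]
    norm_num
    have z1 : x1 ≤ x1 * X := Nat.le_mul_of_pos_right _ hX1
    have z2 : x2 ≤ x2 * X := Nat.le_mul_of_pos_right _ hX1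
    have z3 : x3 ≤ x3 * X := Nat.le_mul_of_pos_right _ hX1
    linarith
  · intro v hv
    rw [u2.apply (by omega) (by omega) (by omega)]
    exact q4 v hv
  · intro w' _ _ a
    rw [u2 _ fun i => (arrAddr_ne_relocIdx _ _ _ _ _ _).symm,
      mem13 _ fun i => (arrAddr_ne_relocIdx _ _ _ _ _ _).symm]
    refine hzero _ ?_
    unfold relocIdx
    omega


/-! ### Formulas as families of coded clauses -/

section Formulas

/-- The codes of the literals of the clauses. -/
def clauseCodes {n : ℕ} (φ : Std.Sat.CNF (Fin n)) : List (List ℕ) :=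
  φ.clauses.toList.map fun c => c.map fun l => 2 * (l.1 : ℕ) + l.2.toNat

variable {n h k : ℕ} {φ : Std.Sat.CNF (Fin n)}

theorem encodeCNF_eq (φ : Std.Sat.CNF (Fin n)) :
    encodeCNF φ = n :: (clauseCodes φ).length :: LoopProg.flatClauses (clauseCodes φ) := by
  simp [encodeCNF, clauseCodes, LoopProg.flatClauses, List.flatMap_map]

theorem lt_of_mem_clauseCodes {c : List ℕ} (hc : c ∈ clauseCodes φ) {x : ℕ} (hx : x ∈ c) :
    x < 2 * n := by
  simp only [clauseCodes, List.mem_map] at hc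
  obtain ⟨c', -, rfl⟩ := hc
  obtain ⟨l, -, rfl⟩ := List.mem_map.1 hx
  have := l.1.2
  have := Bool.toNat_le l.2
  omega

theorem clauseId_digit_lt (hn : n < 2 * h) {c : List ℕ} (hc : ∀ x ∈ c, x < 2 * n) (j : ℕ) :
    (if j < c.length then c.getD j 0 + 1 else 0) < 4 * h + 1 := by
  split_ifs with hj
  · rw [List.getD_eq_getElem _ _ hj]
    have := hc _ (List.getElem_mem hj)
    omega
  · omega

theorem mem_dec_clauseId (hn : n < 2 * h) {u : List ℕ} (hc : ∀ x ∈ u, x < 2 * n)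
    (hk : u.length ≤ k) {z : ℕ × ℕ} :
    z ∈ dec (4 * h + 1) k (LoopProg.clauseId (4 * h + 1) k u) ↔
      ∃ hj : z.1 < u.length, z.2 = u[z.1] + 1 := by
  rw [mem_dec]
  constructor
  · rintro ⟨h1, h2, h3⟩
    rw [LoopProg.clauseId, dig_enc (fun j _ => clauseId_digit_lt hn hc j) h1] at h3
    split_ifs at h3 with hj
    · rw [List.getD_eq_getElem _ _ hj] at h3
      exact ⟨hj, h3.symm⟩
    · exact absurd h3.symm h2
  · rintro ⟨hj, h2⟩
    refine ⟨by omega, by omega, ?_⟩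
    rw [LoopProg.clauseId, dig_enc (fun j _ => clauseId_digit_lt hn hc j) (by omega), if_pos hj,
      List.getD_eq_getElem _ _ hj, h2]

/-- The clauses of the formula, and the unit clause of a new variable. -/
def formulaIds (h k : ℕ) (φ : Std.Sat.CNF (Fin n)) : Finset ℕ :=
  insert (4 * h) ((clauseCodes φ).map (LoopProg.clauseId (4 * h + 1) k)).toFinset

theorem formulaIds_lt (hn : n < 2 * h) (hk : 0 < k) :
    ∀ C ∈ formulaIds h k φ, C < (4 * h + 1) ^ k := by
  intro C hC
  rcases mem_insert.1 hC with rfl | hC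
  · calc 4 * h < (4 * h + 1) ^ 1 := by rw [pow_one]; omega
      _ ≤ _ := Nat.pow_le_pow_right (by omega) hk
  · rw [List.mem_toFinset, List.mem_map] at hC
    obtain ⟨c, hc, rfl⟩ := hC
    exact enc_lt fun j _ => clauseId_digit_lt hn (fun x hx => lt_of_mem_clauseCodes hc hx) j

theorem exists_sat_iff (hn : n < 2 * h) (hk : 0 < k) (hφ : ∀ c ∈ φ.clauses, c.length ≤ k) :
    (∃ a : Fin n → Bool, φ.Sat a) ↔
      ∃ a : ℕ → ℕ, (∀ v, a v < 2) ∧ SatIds (4 * h + 1) k (LitTrue a) (formulaIds h k φ) := by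
  have hmem : ∀ c ∈ φ.clauses.toList,
      (c.map fun l : Fin n × Bool => 2 * (l.1 : ℕ) + l.2.toNat) ∈ clauseCodes φ := fun c hc =>
    List.mem_map.2 ⟨c, hc, rfl⟩
  have hlit : ∀ (a : ℕ → ℕ) (v b : ℕ), b < 2 → (LitTrue a (2 * v + b + 1) ↔ a v = b) := by
    intro a v b hb
    have h1 : (2 * v + b + 1 - 1) / 2 = v := by omega
    have h2 : (2 * v + b + 1 - 1) % 2 = b := by omega
    rw [LitTrue, h1, h2]
  have hclause : ∀ (a : ℕ → ℕ), ∀ u ∈ φ.clauses.toList,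
      ((∃ z ∈ dec (4 * h + 1) k (LoopProg.clauseId (4 * h + 1) k
        (u.map fun l : Fin n × Bool => 2 * (l.1 : ℕ) + l.2.toNat)), LitTrue a z.2) ↔
        ∃ l ∈ u, a l.1 = l.2.toNat) := by
    intro a u hc
    have hlen : u.length ≤ k := hφ u (by simpa using hc)
    simp only [mem_dec_clauseId hn (fun x hx => lt_of_mem_clauseCodes (hmem u hc) hx)
      (show (u.map fun l : Fin n × Bool => 2 * (l.1 : ℕ) + l.2.toNat).length ≤ k by simpa using hlen)]
    constructor
    · rintro ⟨z, ⟨hz, hz2⟩, hT⟩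
      rw [hz2, List.getElem_map, hlit a _ _ (Nat.lt_succ_of_le (Bool.toNat_le _))] at hT
      exact ⟨_, List.getElem_mem _, hT⟩
    · rintro ⟨l, hl, hT⟩
      obtain ⟨j, hj, rfl⟩ := List.getElem_of_mem hl
      refine ⟨(j, 2 * (u[j].1 : ℕ) + u[j].2.toNat + 1), ⟨by simpa using hj, by simp⟩, ?_⟩
      rwa [hlit a _ _ (Nat.lt_succ_of_le (Bool.toNat_le _))]
  have hsat : ∀ a : Fin n → Bool, φ.Sat a ↔ ∀ c ∈ φ.clauses.toList, ∃ l ∈ c, a l.1 = l.2 := by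
    intro a
    simp [Std.Sat.CNF.sat_def, Std.Sat.CNF.eval, Std.Sat.CNF.Clause.eval, ← Array.all_toList]
  simp only [hsat]
  constructor
  · rintro ⟨a, ha⟩
    -- The additional variables get the value `1`, which makes the unit clause true.
    refine ⟨fun v => if hv : v < n then (a ⟨v, hv⟩).toNat else 1, fun v => ?_, fun C hC => ?_⟩
    · dsimp only
      split_ifs with hv
      · exact Nat.lt_succ_of_le (Bool.toNat_le _)
      · omega
    · rcases mem_insert.1 hC with rfl | hC
      · refine ⟨(0, 4 * h), by rw [dec_unit (by omega) hk rfl]; simp, ?_⟩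
        rw [LitTrue, dif_neg (by dsimp only; omega)]
        dsimp only
        omega
      · rw [List.mem_toFinset, List.mem_map] at hC
        obtain ⟨c', hc', rfl⟩ := hC
        obtain ⟨c, hc, rfl⟩ := List.mem_map.1 hc'
        obtain ⟨l, hl, hal⟩ := ha c hc
        exact (hclause _ c hc).2 ⟨l, hl, by simp [hal]⟩
  · rintro ⟨a, ha, hs⟩
    refine ⟨fun v => a v == 1, fun c hc => ?_⟩
    obtain ⟨l, hl, hal⟩ := (hclause a c hc).1
      (hs _ (mem_insert_of_mem (List.mem_toFinset.2 (List.mem_map.2 ⟨_, hmem c hc, rfl⟩))))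
    refine ⟨l, hl, ?_⟩
    cases hb : l.2 <;> simp [hal, hb]

end Formulas

/-! ### The algorithm for satisfiability and its running time -/

/-- Decide satisfiability with calls of a program for points sets. -/
def satProg (k C : ℕ) (θ : ℕ → ℕ) (P : Program) : Program :=
  .seq (initProg k C) (.seq (.while (.sub (.reg 4) (.reg 8)) (roundProg k θ P))
    (.assign 0 (.reg 11)))

/-- The left side bounds the polynomial loop bounds and, as `V = 2 ^ X`, the bit lengths of the
numbers involved. For fixed `k` and `C` it is polynomial in the size of the formula. -/
theorem size_param_le {n L h : ℕ} (k C : ℕ) (hh : h = n / 2 + 1) (hL : 2 ≤ L) :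
    (k + 1) ^ 2 * (4 * h + 1) ^ k + L + C + (4 * h + 1) ≤
      ((k + 1) ^ 2 * 5 ^ k + C + 6) * (n + L) ^ (k + 1) := by
  set Y := n + L
  have h1 : 4 * h + 1 ≤ 5 * Y := by omega
  have h2 : (4 * h + 1) ^ k ≤ 5 ^ k * Y ^ k := by
    rw [← mul_pow]
    exact Nat.pow_le_pow_left h1 k
  have h3 : Y ^ k ≤ Y ^ (k + 1) := Nat.pow_le_pow_right (by omega) (by omega)
  have h4 : Y ≤ Y ^ (k + 1) := Nat.le_self_pow (by omega) _
  have h5 : 1 ≤ Y ^ (k + 1) := Nat.pow_pos (by omega)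
  calc _ ≤ (k + 1) ^ 2 * (5 ^ k * Y ^ (k + 1)) + Y ^ (k + 1) + C * Y ^ (k + 1) +
        5 * Y ^ (k + 1) := by
        gcongr
        · exact h2.trans (Nat.mul_le_mul_left _ h3)
        · omega
        · exact Nat.le_mul_of_pos_right _ h5
        · omega
    _ = _ := by ring

theorem le_two_pow_of_mem {n k V : ℕ} {φ : Std.Sat.CNF (Fin n)}
    (hφ : ∀ c ∈ φ.clauses, c.length ≤ k) (hk : k ≤ V) (hn : 2 * n ≤ V)
    (hL : (encodeCNF φ).length ≤ V) :
    ∀ a ∈ n :: (clauseCodes φ).length :: LoopProg.flatClauses (clauseCodes φ), a ≤ V := by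
  intro a ha
  rw [List.mem_cons, List.mem_cons] at ha
  rcases ha with rfl | rfl | ha
  · omega
  · refine le_trans ?_ hL
    rw [encodeCNF_eq]
    have := length_le_length_flatClauses (clauseCodes φ)
    simp only [List.length_cons]
    omega
  · obtain ⟨u, hu, hau⟩ := List.mem_flatMap.1 ha
    rcases List.mem_cons.1 hau with rfl | hau
    · obtain ⟨v, hv, rfl⟩ := List.mem_map.1 hu
      rw [List.length_map]
      exact (hφ v (by simpa using hv)).trans hk
    · have := lt_of_mem_clauseCodes hu hau
      omega

/-- Used with `Y = X ^ e` for the time of a round and `Z = X ^ (e + 2)`, which absorbs all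
polynomial factors. -/
theorem total_time_le {c₁ c₂ r m N T X Y Z : ℕ} (z2 : X * X ≤ Z) (z3 : X ≤ Z) (z4 : Y * X ≤ Z)
    (z5 : 1 ≤ Z) :
    c₂ * X * (2 * X) + (m * ((2 * (c₁ * Y * (N + 1)) + 4 * r + 400 + 100 * T) * (2 * X)) +
      20 * (2 * X) + (2 + 2 * X)) ≤
      (2 * c₂ + 4 * c₁ + 8 * r + 1800) * Z * ((m + 1) * (N + T + 1)) := by
  calc _ = 2 * c₂ * (X * X) + (m * (4 * c₁ * (Y * X) * (N + 1) + (8 * r + 800 + 200 * T) * X) +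
        (42 * X + 2)) := by ring
    _ ≤ 2 * c₂ * Z + (m * (4 * c₁ * Z * (N + 1) + (8 * r + 800 + 200 * T) * Z) +
        (42 * Z + 2 * Z)) := by gcongr; omega
    _ = (2 * c₂ + 44 + m * (4 * c₁ * (N + 1) + (8 * r + 800 + 200 * T))) * Z := by ring
    _ ≤ ((2 * c₂ + 900) * ((m + 1) * (N + T + 1)) +
        m * ((4 * c₁ + 8 * r) * (N + T + 1) + 900 * (N + T + 1))) * Z := by
        refine Nat.mul_le_mul_right _ (add_le_add ?_ (Nat.mul_le_mul_left _ ?_))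
        · calc 2 * c₂ + 44 ≤ (2 * c₂ + 900) * 1 := by omega
            _ ≤ _ := Nat.mul_le_mul_left _ (Nat.mul_pos (by omega) (by omega))
        · nlinarith [Nat.zero_le (c₁ * T), Nat.zero_le (r * N), Nat.zero_le (r * T)]
    _ ≤ ((2 * c₂ + 900) * ((m + 1) * (N + T + 1)) +
        (m + 1) * ((4 * c₁ + 8 * r) * (N + T + 1) + 900 * (N + T + 1))) * Z := by gcongr; omega
    _ = (2 * c₂ + 4 * c₁ + 8 * r + 1800) * Z * ((m + 1) * (N + T + 1)) := by ring

theorem exec_satProg (k C : ℕ) {θ : ℕ → ℕ} (hk : 0 < k) (hθ : ∀ j, 1 ≤ θ j)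
    (hC : 2 + 4 * k * ∑ j ∈ range k, θ j ≤ C) {P : Program} {T : ℕ → ℝ}
    (hP : DistinguishesULT P (fun n => C * Nat.clog 2 n) T) :
    ∃ c e : ℕ, ∀ (n : ℕ) (φ : Std.Sat.CNF (Fin n)), (∀ c ∈ φ.clauses, c.length ≤ k) →
      ∃ m s t, m = leaves (4 * (n / 2 + 1) + 1) k θ ((4 * (n / 2 + 1) + 1) ^ k)
          (formulaIds (n / 2 + 1) k φ) ∧
        Exec (satProg k C θ P) (State.init (encodeCNF φ)) s t ∧
        t ≤ c * (n + (encodeCNF φ).length) ^ e *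
          ((m + 1) * (2 ^ (n / 2 + 2) + ⌊T (2 ^ (n / 2 + 2))⌋₊ + 1)) ∧
        (s.reg 0 ≠ 0 ↔ ∃ a : Fin n → Bool, φ.Sat a) := by
  obtain ⟨c₁, e₁, htime⟩ := exists_time_le k θ
  obtain ⟨c₂, hinit⟩ := runs_initProg k C
  refine ⟨(2 * c₂ + 4 * c₁ + 8 * P.regBound + 1800) * ((k + 1) ^ 2 * 5 ^ k + C + 6) ^ (e₁ + 2),
    (k + 1) * (e₁ + 2), fun n φ hφ => ?_⟩
  obtain ⟨h, hh⟩ : ∃ h, h = n / 2 + 1 := ⟨_, rfl⟩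
  have hN : n / 2 + 2 = h + 1 := by omega
  rw [hN, ← hh]
  obtain ⟨L, hL⟩ : ∃ L, L = (encodeCNF φ).length := ⟨_, rfl⟩
  have hL2 : L = 2 + (LoopProg.flatClauses (clauseCodes φ)).length := by
    rw [hL, encodeCNF_eq]
    simp only [List.length_cons]
    omega
  rw [← hL]
  have hXle := size_param_le (L := L) k C hh (by omega)
  set X := (k + 1) ^ 2 * (4 * h + 1) ^ k + L + C + (4 * h + 1) with hX
  set R := (4 * h + 1) ^ k with hR
  have hR1 : 1 ≤ R := Nat.pow_pos (by omega)
  have hk2 : k + 1 ≤ (k + 1) ^ 2 := Nat.le_self_pow (by omega) _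
  have hRZ : R ≤ (k + 1) ^ 2 * R := Nat.le_mul_of_pos_left _ (by positivity)
  have hkZ : (k + 1) ^ 2 ≤ (k + 1) ^ 2 * R := Nat.le_mul_of_pos_right _ hR1
  -- The largest numbers are the paths and the relocation factor, of about `(4 * h + 1) ^ k ≤ X`
  -- bits.
  obtain ⟨V, hV⟩ : ∃ V, V = 2 ^ X := ⟨_, rfl⟩
  have hXV : X < V := by rw [hV]; exact Nat.lt_two_pow_self
  have hSV : Nat.size V ≤ 2 * X := by rw [hV, Nat.size_pow]; omega
  obtain ⟨d, hd⟩ : ∃ d, d = C * (h + 1) := ⟨_, rfl⟩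
  have hV0 : 2 ^ (h + 1) ≤ V := by
    rw [hV]; exact Nat.pow_le_pow_right (by omega) (by omega)
  have hV1 : 2 ^ R + L ≤ V := by
    calc 2 ^ R + L ≤ 2 ^ R * 2 ^ L := by
          have h1 : L + 1 ≤ 2 ^ L := Nat.lt_two_pow_self
          have h2 : 1 ≤ 2 ^ R := Nat.one_le_two_pow
          nlinarith
      _ = 2 ^ (R + L) := (pow_add _ _ _).symm
      _ ≤ V := by rw [hV]; exact Nat.pow_le_pow_right (by omega) (by omega)
  have hV2 : 2 + 2 ^ (h + 1) * d ≤ V := by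
    have h1 : C < 2 ^ C := Nat.lt_two_pow_self
    have h2 : h + 1 < 2 ^ (h + 1) := Nat.lt_two_pow_self
    have h3 : d ≤ 2 ^ C * 2 ^ (h + 1) := by
      rw [hd]
      exact Nat.mul_le_mul h1.le h2.le
    have h4 : 2 ^ 1 ≤ 2 ^ (h + 1 + (C + (h + 1))) := Nat.pow_le_pow_right (by omega) (by omega)
    calc 2 + 2 ^ (h + 1) * d ≤ 2 ^ (h + 1 + (C + (h + 1))) + 2 ^ (h + 1) * (2 ^ C * 2 ^ (h + 1)) :=
          add_le_add h4 (Nat.mul_le_mul_left _ h3)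
      _ = 2 ^ (h + 1 + (C + (h + 1)) + 1) := by
          rw [pow_succ, pow_add _ (h + 1) (C + (h + 1)), pow_add _ C (h + 1)]
          ring
      _ ≤ V := by rw [hV]; exact Nat.pow_le_pow_right (by omega) (by omega)
  obtain ⟨s₁, r₁, a₁, ready⟩ := hinit (n := n) (nr := P.regBound + 1) (V := V) (X := X) (L := L)
    (h := h) (d := d) (cs := clauseCodes φ) (by rw [← encodeCNF_eq]) hL2 hh hd (by omega)
    (by omega) (by omega) (by omega) (by omega) hV0 hV1 hV2
    (le_two_pow_of_mem hφ (by omega) (by omega) (by omega))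
  set m := leaves (4 * h + 1) k θ R (formulaIds h k φ) with hm
  set T₀ := ⌊T (2 ^ (h + 1))⌋₊ with hT₀
  have hlt := formulaIds_lt (φ := φ) (show n < 2 * h by omega) hk
  have hdclog : d = C * Nat.clog 2 (2 ^ (h + 1)) := by
    rw [Nat.clog_pow 2 _ (by omega), hd]
  have hcard : ∀ F' : Finset ℕ, (∀ C ∈ F', C < (4 * h + 1) ^ k) →
      pick (4 * h + 1) k θ F' = none → (minIds (4 * h + 1) k F').card + h ≤ d := by
    intro F' hF' hp
    have h1 := card_minIds_le (by omega) hF' hθ hp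
    rw [Nat.add_sub_cancel] at h1
    -- The number of columns is at most `1 + 4 * h * k * ∑ θ + h`, which the choice of `C` keeps
    -- below `C * (h + 1)`.
    have h2 := Nat.mul_le_mul_right (h + 1) hC
    rw [← hd] at h2
    refine le_trans (Nat.add_le_add_right h1 h) (le_trans ?_ h2)
    nlinarith [Nat.zero_le (k * ∑ j ∈ range k, θ j)]
  obtain ⟨s₂, t₂, l₂, x₂, b₂, i₂⟩ := exec_rounds (T := T₀) (Tm := c₁ * X ^ e₁ * (2 ^ (h + 1) + 1)) hθ
    (by omega) (by omega) (by omega) hV1 hV2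
    (fun ρ h1 h3 h9 h12 => by
      have := htime ρ X (by omega) (by omega) (by rw [h3]; omega) (by rw [h9]; omega)
      rwa [h12] at this) hlt (mem_insert_self _ _) hcard
    (fun F' hF' hp hu => by
      obtain ⟨s, t, he, ht, hiff⟩ := exists_exec_instPoints hP hdclog (by omega) hk hF'
        (hcard F' hF' hp) hu
      exact ⟨s, t, Nat.le_floor ht, he, hiff⟩)
    ready a₁
  obtain ⟨t₁, l₁, x₁, -⟩ := r₁
  refine ⟨m, _, _, rfl, .seq x₁ (.seq x₂ (.assign 0 (.reg 11) s₂)), ?_, ?_⟩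
  · have hc : (Term.reg 11).cost s₂ ≤ 1 + Nat.size V := by
      have := Nat.size_le_size b₂
      simp only [Term.cost]
      omega
    have l₂' : t₂ ≤ m * ((2 * (c₁ * X ^ e₁ * (2 ^ (h + 1) + 1)) + 4 * P.regBound + 400 + 100 * T₀) *
      Nat.size V) + 20 * Nat.size V := l₂
    have hX1 : 1 ≤ X := by omega
    set N := 2 ^ (h + 1)
    set r := P.regBound
    have hpow : X ^ (e₁ + 2) ≤ ((k + 1) ^ 2 * 5 ^ k + C + 6) ^ (e₁ + 2) *
        (n + L) ^ ((k + 1) * (e₁ + 2)) := by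
      rw [pow_mul, ← mul_pow]
      exact Nat.pow_le_pow_left hXle _
    calc _ ≤ c₂ * X * Nat.size V + (m * ((2 * (c₁ * X ^ e₁ * (N + 1)) + 4 * r + 400 + 100 * T₀) *
          Nat.size V) + 20 * Nat.size V + (2 + Nat.size V)) := by omega
      _ ≤ c₂ * X * (2 * X) + (m * ((2 * (c₁ * X ^ e₁ * (N + 1)) + 4 * r + 400 + 100 * T₀) *
          (2 * X)) + 20 * (2 * X) + (2 + 2 * X)) := by gcongr
      _ ≤ (2 * c₂ + 4 * c₁ + 8 * r + 1800) * X ^ (e₁ + 2) * ((m + 1) * (N + T₀ + 1)) := by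
        have z1 : X ^ (e₁ + 2) = X ^ e₁ * (X * X) := by ring
        have y1 : 1 ≤ X ^ e₁ := Nat.pow_pos hX1
        have z2 : X * X ≤ X ^ (e₁ + 2) := by rw [z1]; exact Nat.le_mul_of_pos_left _ y1
        have z3 : X ≤ X ^ (e₁ + 2) := (Nat.le_mul_of_pos_left _ hX1).trans z2
        have z4 : X ^ e₁ * X ≤ X ^ (e₁ + 2) := by
          rw [z1]; exact Nat.mul_le_mul_left _ (Nat.le_mul_of_pos_left _ hX1)
        have z5 : 1 ≤ X ^ (e₁ + 2) := hX1.trans z3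
        exact total_time_le z2 z3 z4 z5
      _ ≤ (2 * c₂ + 4 * c₁ + 8 * r + 1800) * (((k + 1) ^ 2 * 5 ^ k + C + 6) ^ (e₁ + 2) *
        (n + L) ^ ((k + 1) * (e₁ + 2))) * ((m + 1) * (N + T₀ + 1)) := by gcongr
      _ = _ := by ring
  · rw [exists_sat_iff (show n < 2 * h by omega) hk hφ]
    simpa [Term.val] using i₂


/-! ### Exponents and conclusion -/

theorem add_one_le_of_le_exp {ε : ℝ} (hε0 : 0 < ε) (hε1 : ε ≤ 1) {k n m : ℕ} (hk : 0 < k)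
    (hm : (m : ℝ) ≤ Real.exp (ε * Real.log 2 / (8 * k) * ((k * (4 * (n / 2 + 1) + 1 - 1) : ℕ) : ℝ))) :
    (m : ℝ) + 1 ≤ 3 * (2 : ℝ) ^ (ε / 4 * n) := by
  have hk' : (0 : ℝ) < k := by exact_mod_cast hk
  have hlog : 0 < Real.log 2 := Real.log_pos (by norm_num)
  have h1 : ((k * (4 * (n / 2 + 1) + 1 - 1) : ℕ) : ℝ) ≤ k * (2 * n + 4) := by
    have : k * (4 * (n / 2 + 1) + 1 - 1) ≤ k * (2 * n + 4) := Nat.mul_le_mul_left _ (by omega)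
    exact_mod_cast this
  have h2 : ε * Real.log 2 / (8 * k) * ((k * (4 * (n / 2 + 1) + 1 - 1) : ℕ) : ℝ) ≤
      Real.log 2 * (ε / 4 * n + 1) := by
    calc _ ≤ ε * Real.log 2 / (8 * k) * (k * (2 * n + 4)) := by gcongr
      _ = Real.log 2 * (ε / 4 * n + ε / 2) := by field_simp; ring
      _ ≤ _ := by gcongr; linarith
  have h3 : (m : ℝ) ≤ (2 : ℝ) ^ (ε / 4 * n) * 2 := by
    calc (m : ℝ) ≤ Real.exp (Real.log 2 * (ε / 4 * n + 1)) := hm.trans (Real.exp_le_exp.2 h2)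
      _ = (2 : ℝ) ^ (ε / 4 * n + 1) := (Real.rpow_def_of_pos (by norm_num) _).symm
      _ = _ := by rw [Real.rpow_add (by norm_num), Real.rpow_one]
  have h4 : (1 : ℝ) ≤ (2 : ℝ) ^ (ε / 4 * n) := Real.one_le_rpow (by norm_num) (by positivity)
  linarith

/-- Since `N ≤ 2 ^ (n / 2 + 2)`, its power `2 - ε'` is at most `16 * 2 ^ ((1 - ε' / 2) * n)`. The
bound `ε' ≤ 1` lets the term `N` for writing the points be absorbed, and `|K|` covers negative
constants. -/
theorem calls_le {ε ε' : ℝ} (hε0 : 0 < ε') (hε1 : ε' ≤ 1) (hε : ε' ≤ ε) (K : ℝ) (n : ℕ) :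
    (2 : ℝ) ^ (n / 2 + 2) + (⌊K * (((2 ^ (n / 2 + 2) : ℕ)) : ℝ) ^ (2 - ε)⌋₊ : ℝ) + 1 ≤
      16 * (|K| + 2) * (2 : ℝ) ^ ((1 - ε' / 2) * n) := by
  set N : ℝ := (2 : ℝ) ^ (n / 2 + 2) with hN
  have hcast : (((2 ^ (n / 2 + 2) : ℕ)) : ℝ) = N := by push_cast; rfl
  rw [hcast]
  have hN1 : 1 ≤ N := one_le_pow₀ (by norm_num)
  have h1 : N ≤ N ^ (2 - ε') := by
    conv_lhs => rw [← Real.rpow_one N]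
    exact Real.rpow_le_rpow_of_exponent_le hN1 (by linarith)
  have h2 : (⌊K * N ^ (2 - ε)⌋₊ : ℝ) ≤ |K| * N ^ (2 - ε') := by
    have h3 : K * N ^ (2 - ε) ≤ |K| * N ^ (2 - ε') := by
      have h4 : N ^ (2 - ε) ≤ N ^ (2 - ε') :=
        Real.rpow_le_rpow_of_exponent_le hN1 (by linarith)
      have h5 : 0 ≤ N ^ (2 - ε) := by positivity
      calc _ ≤ |K| * N ^ (2 - ε) := mul_le_mul_of_nonneg_right (le_abs_self K) h5
        _ ≤ _ := mul_le_mul_of_nonneg_left h4 (abs_nonneg K)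
    calc (⌊K * N ^ (2 - ε)⌋₊ : ℝ) ≤ ⌊|K| * N ^ (2 - ε')⌋₊ := by exact_mod_cast Nat.floor_mono h3
      _ ≤ _ := Nat.floor_le (by positivity)
  have h6 : N ≤ (2 : ℝ) ^ ((n : ℝ) / 2 + 2) := by
    rw [hN, ← Real.rpow_natCast]
    refine Real.rpow_le_rpow_of_exponent_le (by norm_num) ?_
    push_cast
    have := @Nat.cast_div_le ℝ _ _ _ n 2
    push_cast at this
    linarith
  have h7 : N ^ (2 - ε') ≤ 16 * (2 : ℝ) ^ ((1 - ε' / 2) * n) := by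
    calc N ^ (2 - ε') ≤ ((2 : ℝ) ^ ((n : ℝ) / 2 + 2)) ^ (2 - ε') :=
          Real.rpow_le_rpow (by positivity) h6 (by linarith)
      _ = (2 : ℝ) ^ (((n : ℝ) / 2 + 2) * (2 - ε')) := (Real.rpow_mul (by norm_num) _ _).symm
      _ ≤ (2 : ℝ) ^ ((4 : ℝ) + (1 - ε' / 2) * n) :=
          Real.rpow_le_rpow_of_exponent_le (by norm_num) (by nlinarith)
      _ = _ := by
          rw [Real.rpow_add (by norm_num)]
          norm_num
  have h8 : N + (⌊K * N ^ (2 - ε)⌋₊ : ℝ) + 1 ≤ (|K| + 2) * N ^ (2 - ε') := by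
    have : 1 ≤ N ^ (2 - ε') := hN1.trans h1
    linarith
  calc _ ≤ (|K| + 2) * N ^ (2 - ε') := h8
    _ ≤ (|K| + 2) * (16 * (2 : ℝ) ^ ((1 - ε' / 2) * n)) :=
        mul_le_mul_of_nonneg_left h7 (by positivity)
    _ = _ := by ring

/-- A fast distinguisher yields a fast algorithm for satisfiability. -/
theorem exists_decidesSAT {ε : ℝ} (hε : 0 < ε) {k : ℕ} (hk : 0 < k) : ∃ C : ℕ,
    ∀ (P : Program) (K : ℝ), DistinguishesULT P (fun n => C * Nat.clog 2 n)
      (fun n => K * (n : ℝ) ^ (2 - ε)) → ∃ (Q : Program) (c : ℕ),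
        DecidesSAT Q k (fun n L => c * ((n : ℝ) + L) ^ c * (2 : ℝ) ^ ((1 - min ε 1 / 4) * n)) := by
  set ε' := min ε 1
  have h0 : 0 < ε' := lt_min hε one_pos
  have h1 : ε' ≤ 1 := min_le_right _ _
  have hlog : 0 < Real.log 2 := Real.log_pos (by norm_num)
  have hk' : (0 : ℝ) < k := by exact_mod_cast hk
  -- There are at most `k * (2 * n + 4)` literals with positions, so this rate allows about `2 ^ (ε'
  -- / 4 * n)` leaves: half of the saving `ε' / 2` in a single call.
  obtain ⟨θ, hθ, hleaves⟩ := exists_thresholds k hk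
    (show 0 < ε' * Real.log 2 / (8 * k) by positivity)
  refine ⟨2 + 4 * k * ∑ j ∈ range k, θ j, fun P K hP => ?_⟩
  obtain ⟨c, e, hrun⟩ := exec_satProg k _ hk hθ le_rfl hP
  obtain ⟨c', hc'⟩ := exists_nat_ge ((c : ℝ) * (3 * (16 * (|K| + 2))))
  refine ⟨satProg k (2 + 4 * k * ∑ j ∈ range k, θ j) θ P, max c' e, fun n φ hφ => ?_⟩
  obtain ⟨m, s, t, hm, he, ht, hiff⟩ := hrun n φ hφ
  set L := (encodeCNF φ).length with hL
  have hL1 : 1 ≤ L := by rw [hL, encodeCNF]; simp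
  have htime : (t : ℝ) ≤ (max c' e : ℕ) * ((n : ℝ) + L) ^ max c' e *
      (2 : ℝ) ^ ((1 - ε' / 4) * n) := by
    have hm' := hleaves (4 * (n / 2 + 1) + 1) ((4 * (n / 2 + 1) + 1) ^ k)
      (formulaIds (n / 2 + 1) k φ) (by omega) (formulaIds_lt (by omega) hk)
    rw [← hm] at hm'
    have a1 := add_one_le_of_le_exp h0 h1 hk hm'
    have a2 := calls_le h0 h1 (min_le_left _ _ : ε' ≤ ε) K n
    have a3 : (t : ℝ) ≤ c * ((n : ℝ) + L) ^ e * (((m : ℝ) + 1) * ((2 : ℝ) ^ (n / 2 + 2) +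
        (⌊K * (((2 ^ (n / 2 + 2) : ℕ)) : ℝ) ^ (2 - ε)⌋₊ : ℝ) + 1)) := by
      exact_mod_cast ht
    have hY : (1 : ℝ) ≤ (n : ℝ) + L := by
      have : 1 ≤ n + L := by omega
      exact_mod_cast this
    have hY2 : ((n : ℝ) + L) ^ e ≤ ((n : ℝ) + L) ^ max c' e :=
      pow_le_pow_right₀ hY (le_max_right _ _)
    have hexp : (2 : ℝ) ^ (ε' / 4 * n) * (2 : ℝ) ^ ((1 - ε' / 2) * n) =
        (2 : ℝ) ^ ((1 - ε' / 4) * n) := by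
      rw [← Real.rpow_add (by norm_num)]
      congr 1
      ring
    have hc2 : (c' : ℝ) ≤ (max c' e : ℕ) := by exact_mod_cast le_max_left _ _
    calc (t : ℝ) ≤ c * ((n : ℝ) + L) ^ e * ((3 * (2 : ℝ) ^ (ε' / 4 * n)) *
          (16 * (|K| + 2) * (2 : ℝ) ^ ((1 - ε' / 2) * n))) := by
          refine a3.trans (mul_le_mul_of_nonneg_left ?_ (by positivity))
          exact mul_le_mul a1 a2 (by positivity) (by positivity)
      _ = (c * (3 * (16 * (|K| + 2)))) * ((n : ℝ) + L) ^ e *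
          ((2 : ℝ) ^ (ε' / 4 * n) * (2 : ℝ) ^ ((1 - ε' / 2) * n)) := by ring
      _ ≤ (max c' e : ℕ) * ((n : ℝ) + L) ^ max c' e * (2 : ℝ) ^ ((1 - ε' / 4) * n) := by
          rw [hexp]
          have := hc'.trans hc2
          gcongr
  refine ⟨fun hsat => ⟨s, t, he, htime, hiff.2 hsat⟩, fun hsat => ⟨s, t, he, htime, ?_⟩⟩
  by_contra h
  exact hsat (hiff.1 h)

end UltraFit

theorem theorem4p1 (hSETH : UltraFit.SETH) (ε : ℝ) (hε : 0 < ε) :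
    ∃ C : ℕ, ¬ ∃ (P : UltraFit.Program) (K : ℝ),
      UltraFit.DistinguishesULT P (fun n => C * Nat.clog 2 n)
        (fun n => K * (n : ℝ) ^ (2 - ε)) := by
  obtain ⟨k, hk⟩ := hSETH (min ε 1 / 4) (by have := lt_min hε one_pos; linarith)
  -- The construction needs a positive clause width, so `k + 1` replaces `k`; an algorithm for the
  -- larger width also handles the smaller one.
  obtain ⟨C, hC⟩ := UltraFit.exists_decidesSAT hε (Nat.succ_pos k)
  refine ⟨C, fun ⟨P, K, hP⟩ => hk ?_⟩
  obtain ⟨Q, c, hQ⟩ := hC P K hP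
  exact ⟨Q, c, fun n φ hφ => hQ n φ fun cl hcl => (hφ cl hcl).trans (Nat.le_succ k)⟩
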